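/- Let $\mathbb{T}^3=(\mathbb{R}/\mathbb{Z})^3$, $T>0$, $\nu>0$, $s\ge 0$, $A=-\Delta$, and let $A^{\sigma}$ be the Fourier multiplier $|2\pi k|^{2\sigma}$, $k\in\mathbb{Z}^3$. Let $u_0\in L^2(\mathbb{T}^3)$ and let $u$, with pressure $P$ integrable on $(0,T')\times\mathbb{T}^3$ for every $T'<T$, be a Leray–Hopf weak solution on $(0,T)$ of the fractional Navier–Stokes equations $\partial_t u+(u\cdot\nabla)u+\nu A^s u+\nabla P=0$, $\nabla\cdot u=0$, $u(0)=u_0$. This means that $u\in L^\infty((0,T);L^2(\mathbb{T}^3))\cap L^2((0,T);H^s(\mathbb{T}^3))$, that $\nabla\cdot u=0$ in the sense of distributions, that $$\int_0^T\!\!\int_{\mathbb{T}^3}\big[u\cdot\partial_t\psi-\nu A^{s/2}u\cdot A^{s/2}\psi+u\otimes u:\nabla\psi+P\,\nabla\cdot\psi\big]\,dx\,dt=-\int_{\mathbb{T}^3}u_0\cdot\psi(x,0)\,dx$$ for all vector fields $\psi\in\mathcal{D}(\mathbb{T}^3\times[0,T))$, and that $\tfrac12\|u(t)\|_{L^2}^2+\nu\int_0^t\|A^{s/2}u\|_{L^2}^2\,d\tau\le\tfrac12\|u_0\|_{L^2}^2$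 for almost every $t\in(0,T)$. For a radial $\varphi\in C_c^\infty(\mathbb{R}^3)$ with $\int\varphi=1$ put $\varphi^\epsilon(x)=\epsilon^{-3}\varphi(x/\epsilon)$, $\delta u(\xi;x,t)=u(x+\xi,t)-u(x,t)$ and $$D_\epsilon(u)(x,t)=\int_{\mathbb{R}^3}\nabla\varphi^\epsilon(\xi)\cdot\delta u(\xi;x,t)\,|\delta u(\xi;x,t)|^2\,d\xi .$$ The defect term is $D(u)=\tfrac12\lim_{\epsilon\to0}D_\epsilon(u)$, the limit being taken in the sense of distributions on $\mathbb{T}^3\times(0,T)$ and being the same for every such $\varphi$. **Proposition.** Suppose that $u\in L^3((0,T);B^{\alpha}_{3,\infty}(\mathbb{T}^3))$ for some $\alpha>\tfrac13$, the Besov norm being defined by the Littlewood–Paley blocks of any smooth dyadic partition of unity. Then the defect term $D(u)$ exists and $D(u)=0$ in $L^1(\mathbb{T}^3\times(0,T))$: for every such $\varphi$ the functions $D_\epsilon(u)$, $\epsilon>0$, are integrable and $D_\epsilon(u)\to0$ in $L^1(\mathbb{T}^3\times(0,T))$ as $\epsilon\to0^+$. Consequently the local energy equality holds with no defect: for all scalar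 $\psi\in\mathcal{D}(\mathbb{T}^3\times(0,T))$ the following integrals converge and $$\int_0^T\!\!\int_{\mathbb{T}^3}\big[|u|^2\partial_t\psi-2\nu\,A^{s/2}u\cdot A^{s/2}(u\psi)+2P\,u\cdot\nabla\psi+|u|^2\,u\cdot\nabla\psi\big]\,dx\,dt=0 .$$ -/

import Mathlib

open MeasureTheory Set Filter Topology
open scoped ENNReal NNReal ContDiff

noncomputable section

namespace FracNS

/-! ### The unit torus, derivatives and test functions -/

/-- The three-dimensional unit torus `(ℝ / ℤ)³`. -/
abbrev T3 : Type := UnitAddTorus (Fin 3)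

/-- Euclidean three-space. -/
abbrev E3 : Type := EuclideanSpace ℝ (Fin 3)

/-- Lebesgue (Haar) measure of total mass one on the torus. -/
abbrev torusVol : Measure T3 := Measure.pi fun _ : Fin 3 => AddCircle.haarAddCircle

/-- Lebesgue measure on the space-time domain `(0,T) × 𝕋³`. -/
abbrev spaceTime (T : ℝ) : Measure (ℝ × T3) :=
  ((volume : Measure ℝ).restrict (Ioo 0 T)).prod torusVol

/-- The covering map `ℝ³ → 𝕋³`. -/
def toTorus (y : E3) : T3 := fun i => (y i : UnitAddCircle)

/-- The partial derivative `∂ᵢ f` of a function on the torus. -/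
def pderiv (i : Fin 3) (f : T3 → ℝ) (x : T3) : ℝ :=
  deriv (fun h : ℝ => f (x + Pi.single i (h : UnitAddCircle))) 0

/-- The gradient of a scalar function on the torus. -/
def grad (f : T3 → ℝ) (x : T3) : E3 := WithLp.toLp 2 fun i => pderiv i f x

/-- The divergence of a vector field on the torus. -/
def divg (v : T3 → E3) (x : T3) : ℝ := ∑ i, pderiv i (fun y => v y i) x

/-- A function of time and of a point of the torus is smooth if its periodic lift to
`ℝ × ℝ³` is. -/
def SmoothST {F : Type*} [NormedAddCommGroup F] [NormedSpace ℝ F] (ψ : ℝ → T3 → F) : Prop :=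
  ContDiff ℝ ∞ fun p : ℝ × E3 => ψ p.1 (toTorus p.2)

/-- Test functions in `𝒟(𝕋³ × [0,T))`: smooth, vanishing for times close to `T`
(they need not vanish at time `0`). -/
def TestInit (T : ℝ) (ψ : ℝ → T3 → E3) : Prop :=
  SmoothST ψ ∧ ∃ b < T, ∀ t, b ≤ t → ∀ x, ψ t x = 0

/-- Scalar test functions in `𝒟(𝕋³ × (0,T))`: smooth, vanishing for times close to `0` and
for times close to `T`. -/
def TestOpen (T : ℝ) (ψ : ℝ → T3 → ℝ) : Prop :=
  SmoothST ψ ∧ ∃ a b : ℝ, 0 < a ∧ b < T ∧ ∀ t, (t ≤ a ∨ b ≤ t) → ∀ x, ψ t x = 0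

/-! ### Fourier coefficients, Sobolev norms and the fractional Laplacian -/

/-- The frequency `k ∈ ℤ³` as a vector of `ℝ³`. -/
def freq (k : Fin 3 → ℤ) : E3 := WithLp.toLp 2 fun i => (k i : ℝ)

/-- The Fourier coefficients of a real function, with respect to `exp (2π i k · x)`. -/
def coeff (f : T3 → ℝ) (k : Fin 3 → ℤ) : ℂ :=
  ∫ x, UnitAddTorus.mFourier (-k) x * (f x : ℂ) ∂torusVol

/-- The square of the `H^s(𝕋³)` norm, `∑ₖ (1 + |2πk|²)^s |f̂(k)|²`, as an extended real. -/
def sobolevSq (s : ℝ) (f : T3 → ℝ) : ℝ≥0∞ :=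
  ∑' k : Fin 3 → ℤ, ENNReal.ofReal ((1 + (2 * Real.pi * ‖freq k‖) ^ 2) ^ s) * ‖coeff f k‖ₑ ^ 2

/-- The Fourier coefficients `|2πk|^{2σ} f̂(k)` of `A^σ f`, where `A = -Δ`. -/
def fracCoeff (σ : ℝ) (f : T3 → ℝ) (k : Fin 3 → ℤ) : ℂ :=
  (((2 * Real.pi * ‖freq k‖) ^ (2 * σ) : ℝ) : ℂ) * coeff f k

open Classical in
/-- `A^σ f` with `A = -Δ`, as an element of `L²(𝕋³)`: the function whose Fourier coefficients are
`|2πk|^{2σ} f̂(k)`, whenever these are square summable. -/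
def fracLapL2 (σ : ℝ) (f : T3 → ℝ) : Lp ℂ 2 torusVol :=
  if h : Memℓp (fracCoeff σ f) 2 then
    (UnitAddTorus.mFourierBasis (d := Fin 3)).repr.symm ⟨fracCoeff σ f, h⟩
  else 0

/-- `A^σ v` for a real vector field `v`, componentwise (`A^σ` of a real function is real almost
everywhere, so taking the real part changes nothing). -/
def fracLap (σ : ℝ) (v : T3 → E3) (x : T3) : E3 :=
  WithLp.toLp 2 fun i => (fracLapL2 σ (fun y => v y i) x).re

/-! ### Besov spaces on the torus -/

/-- The low frequency cut-off `ρ₋₁ = 1 - ∑_{j ≥ 0} ρ(2^{-j} ·)`. -/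
def lowCutoff (ρ : E3 → ℝ) (ξ : E3) : ℝ := 1 - ∑' j : ℕ, ρ (((2 : ℝ) ^ j)⁻¹ • ξ)

/-- `ρ` generates a dyadic partition of unity: it is smooth, supported in an annulus, and the
remaining cut-off `ρ₋₁` has compact support. -/
structure IsDyadicPartition (ρ : E3 → ℝ) : Prop where
  smooth : ContDiff ℝ ∞ ρ
  annulus : ∃ r R : ℝ, 0 < r ∧ ∀ ξ, ρ ξ ≠ 0 → r ≤ ‖ξ‖ ∧ ‖ξ‖ ≤ R
  low : HasCompactSupport (lowCutoff ρ)

/-- The function on the torus obtained from `f` by the (compactly supported) Fourier multiplier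
`m`. -/
def multiplier (m : E3 → ℝ) (f : T3 → ℝ) (x : T3) : ℂ :=
  ∑' k : Fin 3 → ℤ, (m (freq k) : ℂ) * coeff f k * UnitAddTorus.mFourier k x

/-- The Littlewood-Paley block `Δ₋₁ f`. -/
def blockLow (ρ : E3 → ℝ) (f : T3 → ℝ) : T3 → ℂ := multiplier (lowCutoff ρ) f

/-- The Littlewood-Paley blocks `Δⱼ f`, `j ≥ 0`. -/
def block (ρ : E3 → ℝ) (j : ℕ) (f : T3 → ℝ) : T3 → ℂ :=
  multiplier (fun ξ => ρ (((2 : ℝ) ^ j)⁻¹ • ξ)) f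

/-- The norm of `B^α_{p,∞}(𝕋³)`. -/
def besovNorm (ρ : E3 → ℝ) (α : ℝ) (p : ℝ≥0∞) (f : T3 → ℝ) : ℝ≥0∞ :=
  eLpNorm (blockLow ρ f) p torusVol +
    ⨆ j : ℕ, ENNReal.ofReal ((2 : ℝ) ^ (α * j)) * eLpNorm (block ρ j f) p torusVol

/-- The vector field `u` belongs to `L³((0,T); B^α_{3,∞}(𝕋³))`. -/
structure MemL3Besov (ρ : E3 → ℝ) (α T : ℝ) (u : ℝ → T3 → E3) : Prop where
  meas : AEStronglyMeasurable (fun p : ℝ × T3 => u p.1 p.2) (spaceTime T)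
  integrable : ∀ᵐ t ∂(volume : Measure ℝ).restrict (Ioo 0 T), Integrable (u t) torusVol
  finite : ∀ i, ∫⁻ t in Ioo 0 T, besovNorm ρ α 3 (fun x => u t x i) ^ 3 < ⊤

/-! ### Leray-Hopf solutions of the fractional Navier-Stokes equations -/

/-- The integrand
`u · ∂ₜψ - ν A^{s/2}u · A^{s/2}ψ + u ⊗ u : ∇ψ + P ∇·ψ` of the weak formulation. -/
def weakIntegrand (ν s : ℝ) (u : ℝ → T3 → E3) (P : ℝ → T3 → ℝ) (ψ : ℝ → T3 → E3)
    (t : ℝ) (x : T3) : ℝ :=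
  inner ℝ (u t x) (deriv (fun τ => ψ τ x) t)
    - ν * inner ℝ (fracLap (s / 2) (u t) x) (fracLap (s / 2) (ψ t) x)
    + ∑ i, ∑ j, u t x i * u t x j * pderiv i (fun y => ψ t y j) x
    + P t x * divg (ψ t) x

/-- `u`, with pressure `P`, is a Leray-Hopf weak solution on `(0,T)` of
`∂ₜu + (u · ∇)u + ν A^s u + ∇P = 0`, `∇ · u = 0`, with initial datum `u₀`. -/
structure IsLerayHopf (ν s T : ℝ) (u₀ : T3 → E3) (u : ℝ → T3 → E3) (P : ℝ → T3 → ℝ) : Prop where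
  meas : AEStronglyMeasurable (fun p : ℝ × T3 => u p.1 p.2) (spaceTime T)
  /-- `u₀ ∈ L²` -/
  init : MemLp u₀ 2 torusVol
  /-- `u ∈ L^∞((0,T); L²)` -/
  bounded : ∃ M : ℝ≥0, ∀ᵐ t ∂(volume : Measure ℝ).restrict (Ioo 0 T),
    eLpNorm (u t) 2 torusVol ≤ M
  /-- `u ∈ L²((0,T); H^s)` -/
  sobolev : ∀ i, ∫⁻ t in Ioo 0 T, sobolevSq s (fun x => u t x i) < ⊤
  /-- `∇ · u = 0` in the sense of distributions -/
  divFree : ∀ ψ, TestOpen T ψ → ∫ p, inner ℝ (u p.1 p.2) (grad (ψ p.1) p.2) ∂spaceTime T = 0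
  /-- the pressure is integrable up to time `0` and locally in `[0,T)` -/
  pressure : ∀ T' < T, Integrable (fun p : ℝ × T3 => P p.1 p.2) (spaceTime T')
  weak : ∀ ψ, TestInit T ψ →
    ∫ t in Ioo 0 T, ∫ x, weakIntegrand ν s u P ψ t x ∂torusVol
      = -∫ x, inner ℝ (u₀ x) (ψ 0 x) ∂torusVol
  /-- the energy inequality; as `u` is determined up to null sets of times only, it is asked
  for at almost every time -/
  energy : ∀ᵐ t ∂(volume : Measure ℝ).restrict (Ioo 0 T),
    1 / 2 * ∫ x, ‖u t x‖ ^ 2 ∂torusVol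
      + ν * ∫ τ in Ioo 0 t, ∫ x, ‖fracLap (s / 2) (u τ) x‖ ^ 2 ∂torusVol
      ≤ 1 / 2 * ∫ x, ‖u₀ x‖ ^ 2 ∂torusVol

/-! ### The defect term -/

/-- Radial mollifiers: smooth, compactly supported, radial, of integral one. -/
structure IsMollifier (φ : E3 → ℝ) : Prop where
  smooth : ContDiff ℝ ∞ φ
  compact : HasCompactSupport φ
  radial : ∀ x y : E3, ‖x‖ = ‖y‖ → φ x = φ y
  integral_one : ∫ x, φ x = 1

/-- The rescaled mollifier `φ^ε(x) = ε⁻³ φ(x/ε)`. -/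
def rescale (φ : E3 → ℝ) (ε : ℝ) (x : E3) : ℝ := (ε ^ 3)⁻¹ * φ (ε⁻¹ • x)

/-- The increment `δv(ξ; x) = v(x + ξ) - v(x)`. -/
def increment (v : T3 → E3) (ξ : E3) (x : T3) : E3 := v (x + toTorus ξ) - v x

/-- The mollified defect `D_ε(v)(x) = ∫ ∇φ^ε(ξ) · δv(ξ; x) |δv(ξ; x)|² dξ`. -/
def mollDefect (φ : E3 → ℝ) (ε : ℝ) (v : T3 → E3) (x : T3) : ℝ :=
  ∫ ξ : E3, inner ℝ (gradient (rescale φ ε) ξ) (increment v ξ x) * ‖increment v ξ x‖ ^ 2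

/-- The functional `D` on test functions is the defect term `D(u) = ½ lim_{ε → 0} D_ε(u)`, the
limit being taken in the sense of distributions on `𝕋³ × (0,T)`, and being the same for every
mollifier. -/
def IsDefectTerm (T : ℝ) (u : ℝ → T3 → E3) (D : (ℝ → T3 → ℝ) → ℝ) : Prop :=
  ∀ φ, IsMollifier φ → ∀ ψ, TestOpen T ψ →
    Tendsto
      (fun ε : ℝ => 1 / 2 * ∫ p, mollDefect φ ε (u p.1) p.2 * ψ p.1 p.2 ∂spaceTime T)
      (𝓝[>] 0) (𝓝 (D ψ))

/-- The defect term vanishes in `L¹(𝕋³ × (0,T))`: for every mollifier the functions `D_ε(u)` are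
integrable and tend to `0` in `L¹`. -/
def DefectVanishesL1 (T : ℝ) (u : ℝ → T3 → E3) : Prop :=
  ∀ φ, IsMollifier φ →
    (∀ ε : ℝ, 0 < ε → Integrable (fun p : ℝ × T3 => mollDefect φ ε (u p.1) p.2) (spaceTime T)) ∧
    Tendsto (fun ε : ℝ =>
        eLpNorm (fun p : ℝ × T3 => mollDefect φ ε (u p.1) p.2) 1 (spaceTime T))
      (𝓝[>] 0) (𝓝 0)

/-! ### The local energy balance -/

/-- `|u|² ∂ₜψ + 2 P u · ∇ψ + |u|² u · ∇ψ` -/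
def fluxIntegrand (u : ℝ → T3 → E3) (P : ℝ → T3 → ℝ) (ψ : ℝ → T3 → ℝ) (t : ℝ) (x : T3) : ℝ :=
  ‖u t x‖ ^ 2 * deriv (fun τ => ψ τ x) t
    + 2 * P t x * inner ℝ (u t x) (grad (ψ t) x)
    + ‖u t x‖ ^ 2 * inner ℝ (u t x) (grad (ψ t) x)

/-- `A^{s/2}u · A^{s/2}(u ψ)` -/
def viscIntegrand (s : ℝ) (u : ℝ → T3 → E3) (ψ : ℝ → T3 → ℝ) (t : ℝ) (x : T3) : ℝ :=
  inner ℝ (fracLap (s / 2) (u t) x) (fracLap (s / 2) (fun y => ψ t y • u t y) x)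

/-- The local energy equality without defect, tested against `ψ`: all the integrals in it
converge, `A^{s/2}(u ψ)` is a genuine element of `L²` for almost every time, and
`∫∫ |u|² ∂ₜψ - 2ν A^{s/2}u · A^{s/2}(uψ) + 2 P u · ∇ψ + |u|² u · ∇ψ = 0`. -/
structure EnergyBalance (ν s T : ℝ) (u : ℝ → T3 → E3) (P : ℝ → T3 → ℝ) (ψ : ℝ → T3 → ℝ) :
    Prop where
  flux : Integrable (fun p : ℝ × T3 => fluxIntegrand u P ψ p.1 p.2) (spaceTime T)
  sobolev : ∀ᵐ t ∂(volume : Measure ℝ).restrict (Ioo 0 T),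
    ∀ i, Memℓp (fracCoeff (s / 2) fun y => (ψ t y • u t y) i) 2
  visc : ∀ᵐ t ∂(volume : Measure ℝ).restrict (Ioo 0 T), Integrable (viscIntegrand s u ψ t) torusVol
  visc_time : IntegrableOn (fun t => ∫ x, viscIntegrand s u ψ t x ∂torusVol) (Ioo 0 T)
  balance : ∫ t in Ioo 0 T,
    ∫ x, (fluxIntegrand u P ψ t x - 2 * ν * viscIntegrand s u ψ t x) ∂torusVol = 0

end FracNS

end

noncomputable section

namespace FracNS

/-! ### The covering map and translations -/

/-! The Besov norm enters only through its effect on translations. Fix β with 1/3 < β < min(α, 1). A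
Bernstein inequality on each Littlewood–Paley block and a geometric sum of 2^(-(α-β)j) give ‖u(· +
y) - u‖ ≤ C|y|^β in L³ of space-time (`exists_besov_bound`, `MemL3Besov.exists_modulus`). Everything
after that uses only this modulus of continuity and u ∈ L³.

Defect: |D_ε(u)| ≤ ∫ |∇φ^ε(ξ)| |δu(ξ)|³ dξ, and by scaling the L¹ norm of the right side is
O(ε^(3β-1)), which tends to 0 (`eLpNorm_mollDefect_le`).

Energy equality: it is proved by the method of Constantin, E and Titi rather than deduced from the
vanishing of the defect. The field is mollified in space by a Schwartz kernel whose Fourier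
transform has compact support, so the truncation is a trigonometric polynomial with coefficients
depending on time. These coefficients have integrable weak derivatives, hence are absolutely
continuous up to null sets. The product rule then gives an exact local balance for each truncation
(`IsLerayHopf.truncated_balance`), with no mollification in time. It remains to let the scale c tend
to 0.

Nonlinear term: the commutator S_c(u_j u_i) - S_c u_j S_c u_i is O(c^(2β)) in L^(3/2) and ∇S_c u is
O(c^(β-1)) in L³, so their product is O(c^(3β-1)) in L¹.

Pressure: it is only assumed integrable. The divergence of the momentum equation expresses each
dyadic piece of P as a convolution of the products u_j u_i with mean zero Schwartz kernels. The
pieces are therefore O(2^(-βn)) in L^(3/2) and summable, so no Calderón–Zygmund theory is needed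
(`IsLerayHopf.memLp_pres_and_tendsto`). Only the spatial mean of P escapes this argument, and it
drops out because u is divergence free.

Viscous term: it is an absolutely convergent double Fourier series, dominated uniformly in c by the
squared H^s norm of u times a constant depending on the test function (`norm_viscTerm_le`,
`IsLerayHopf.visc_limit`). -/

lemma continuous_toTorus : Continuous toTorus := by
  unfold toTorus
  refine continuous_pi fun i => ?_
  exact (AddCircle.continuous_mk' 1).comp (by fun_prop)

lemma measurable_toTorus : Measurable toTorus := continuous_toTorus.measurable

lemma toTorus_add (y z : E3) : toTorus (y + z) = toTorus y + toTorus z := by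
  ext i; simp [toTorus]

lemma isOpenQuotientMap_toTorus : IsOpenQuotientMap toTorus := by
  have h : IsOpenQuotientMap (fun (y : Fin 3 → ℝ) (i : Fin 3) => ((y i : ℝ) : UnitAddCircle)) :=
    IsOpenQuotientMap.piMap (fun _ => QuotientAddGroup.isOpenQuotientMap_mk)
  exact h.comp (PiLp.homeomorph 2 (fun _ : Fin 3 => ℝ)).isOpenQuotientMap

lemma surjective_toTorus : Function.Surjective toTorus := isOpenQuotientMap_toTorus.surjective

lemma toTorus_single (i : Fin 3) (h : ℝ) :
    toTorus (h • EuclideanSpace.single i (1 : ℝ)) = Pi.single i (h : UnitAddCircle) := by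
  ext j
  by_cases hj : j = i
  · subst hj; simp [toTorus]
  · simp [toTorus, hj]

instance : IsProbabilityMeasure torusVol := inferInstance
instance : torusVol.IsAddHaarMeasure := inferInstance

instance (T : ℝ) : IsFiniteMeasure (spaceTime T) := inferInstance

/-- Translation in the space variable. -/
def shift (y : E3) (x : T3) : T3 := x + toTorus y

/-- Translation in the space variable of a point of space-time. -/
def stShift (y : E3) (p : ℝ × T3) : ℝ × T3 := (p.1, p.2 + toTorus y)

lemma measurable_shift : Measurable (Function.uncurry shift) :=
  measurable_snd.add (measurable_toTorus.comp measurable_fst)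

lemma measurable_stShift : Measurable (Function.uncurry stShift) :=
  (measurable_fst.comp measurable_snd).prodMk
    ((measurable_snd.comp measurable_snd).add (measurable_toTorus.comp measurable_fst))

lemma measurePreserving_shift (y : E3) : MeasurePreserving (shift y) torusVol torusVol :=
  measurePreserving_add_right torusVol (toTorus y)

lemma measurePreserving_stShift (T : ℝ) (y : E3) :
    MeasurePreserving (stShift y) (spaceTime T) (spaceTime T) :=
  (MeasurePreserving.id _).prod (measurePreserving_shift y)

/-- A jointly measurable family of measure preserving maps indexed by `ℝ³`. -/
structure IsShift {X : Type*} [MeasurableSpace X] (ν : Measure X) (sh : E3 → X → X) : Prop where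
  meas : Measurable (Function.uncurry sh)
  pres : ∀ y, MeasurePreserving (sh y) ν ν

lemma isShift_shift : IsShift torusVol shift := ⟨measurable_shift, measurePreserving_shift⟩

lemma isShift_stShift (T : ℝ) : IsShift (spaceTime T) stShift :=
  ⟨measurable_stShift, measurePreserving_stShift T⟩

/-- The skew product (y, x) ↦ (y, sh (g y) x) preserves the product measure, and the projection to
the second factor is quasi measure preserving. This makes f(sh (g y) x) jointly measurable in (y, x)
for f measurable only up to null sets. -/
lemma IsShift.quasi {X : Type*} [MeasurableSpace X] {ν : Measure X} [SFinite ν]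
    {sh : E3 → X → X} (h : IsShift ν sh) {g : E3 → E3} (hg : Measurable g) :
    Measure.QuasiMeasurePreserving (fun q : E3 × X => sh (g q.1) q.2)
      ((volume : Measure E3).prod ν) ν := by
  have hm : Measurable (fun q : E3 × X => sh (g q.1) q.2) :=
    h.meas.comp ((hg.comp measurable_fst).prodMk measurable_snd)
  have h1 : MeasurePreserving (fun q : E3 × X => (q.1, sh (g q.1) q.2))
      ((volume : Measure E3).prod ν) ((volume : Measure E3).prod ν) :=
    (MeasurePreserving.id _).skew_product (g := fun y x => sh (g y) x) hm
      (ae_of_all _ fun y => (h.pres (g y)).map_eq)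
  exact Measure.quasiMeasurePreserving_snd.comp h1.quasiMeasurePreserving

lemma IsShift.aestronglyMeasurable {X F : Type*} [MeasurableSpace X] {ν : Measure X} [SFinite ν]
    [TopologicalSpace F]
    {sh : E3 → X → X} (h : IsShift ν sh) {g : E3 → E3} (hg : Measurable g) {f : X → F}
    (hf : AEStronglyMeasurable f ν) :
    AEStronglyMeasurable (fun q : E3 × X => f (sh (g q.1) q.2)) ((volume : Measure E3).prod ν) :=
  hf.comp_quasiMeasurePreserving (h.quasi hg)

/-! ### Integral inequalities -/

/-- Jensen's inequality for the unnormalised weight k: Hölder applied to the splitting (k^(1/p) h) ·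
k^(1/q). With Lebesgue measure it bounds averages of functions in L^p; with counting measure on ℤ³
it gives Young's inequality. -/
lemma lintegral_mul_rpow_le {Z : Type*} [MeasurableSpace Z] {μ : Measure Z} {p : ℝ} (hp : 1 ≤ p)
    {k h : Z → ℝ≥0∞} (hk : AEMeasurable k μ) (hh : AEMeasurable h μ) :
    (∫⁻ z, k z * h z ∂μ) ^ p ≤ (∫⁻ z, k z ∂μ) ^ (p - 1) * ∫⁻ z, k z * h z ^ p ∂μ := by
  rcases hp.eq_or_lt with rfl | hp1
  · simp
  have hp0 : 0 < p := by linarith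
  set q := p / (p - 1)
  have hpq : p.HolderConjugate q := Real.HolderConjugate.conjExponent hp1
  have e1 : ∀ z, k z * h z = (fun z => k z ^ (1 / p) * h z) z * (fun z => k z ^ (1 / q)) z := by
    intro z
    have : k z = k z ^ (1 / p) * k z ^ (1 / q) := by
      rw [← ENNReal.rpow_add_of_nonneg _ _ (by positivity) (one_div_nonneg.2 hpq.symm.nonneg)]
      have := hpq.inv_add_inv_eq_one
      simp only [one_div, this, ENNReal.rpow_one]
    calc k z * h z = (k z ^ (1 / p) * k z ^ (1 / q)) * h z := by rw [← this]
      _ = _ := by ring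
  have := ENNReal.lintegral_mul_le_Lp_mul_Lq μ hpq (f := fun z => k z ^ (1 / p) * h z)
    (g := fun z => k z ^ (1 / q)) ((hk.pow_const _).mul hh) (hk.pow_const _)
  have e2 : ∫⁻ z, k z * h z ∂μ ≤
      (∫⁻ z, k z * h z ^ p ∂μ) ^ (1 / p) * (∫⁻ z, k z ∂μ) ^ (1 / q) := by
    refine (lintegral_congr e1).trans_le (this.trans_eq ?_)
    congr 2
    · refine lintegral_congr fun z => ?_
      rw [ENNReal.mul_rpow_of_nonneg _ _ hp0.le, ← ENNReal.rpow_mul, one_div,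
        inv_mul_cancel₀ hp0.ne', ENNReal.rpow_one]
    · refine lintegral_congr fun z => ?_
      rw [← ENNReal.rpow_mul, one_div, inv_mul_cancel₀ hpq.symm.pos.ne', ENNReal.rpow_one]
  calc (∫⁻ z, k z * h z ∂μ) ^ p
      ≤ ((∫⁻ z, k z * h z ^ p ∂μ) ^ (1 / p) * (∫⁻ z, k z ∂μ) ^ (1 / q)) ^ p :=
        ENNReal.rpow_le_rpow e2 hp0.le
    _ = _ := by
      rw [ENNReal.mul_rpow_of_nonneg _ _ hp0.le, ← ENNReal.rpow_mul, ← ENNReal.rpow_mul, one_div,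
        inv_mul_cancel₀ hp0.ne', ENNReal.rpow_one, mul_comm]
      congr 2
      have : p - 1 ≠ 0 := by linarith
      simp only [q]; field_simp

lemma eLpNorm_rpow_eq {X F : Type*} [MeasurableSpace X] {ν : Measure X} [NormedAddCommGroup F]
    {p : ℝ≥0∞} (hp : 1 ≤ p) (hp' : p ≠ ⊤) (f : X → F) :
    eLpNorm f p ν ^ p.toReal = ∫⁻ x, ‖f x‖ₑ ^ p.toReal ∂ν := by
  have h0 : p ≠ 0 := (zero_lt_one.trans_le hp).ne'
  have : 0 < p.toReal := ENNReal.toReal_pos h0 hp'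
  rw [eLpNorm_eq_lintegral_rpow_enorm_toReal h0 hp', ← ENNReal.rpow_mul, one_div,
    inv_mul_cancel₀ this.ne', ENNReal.rpow_one]

lemma one_le_toReal {p : ℝ≥0∞} (hp : 1 ≤ p) (hp' : p ≠ ⊤) : 1 ≤ p.toReal := by
  rw [← ENNReal.toReal_one]; exact ENNReal.toReal_mono hp' hp

/-- The `L^p` norm of an average of functions. -/
lemma eLpNorm_integral_mul_le {Z X : Type*} [MeasurableSpace Z] [MeasurableSpace X]
    {μ : Measure Z} {ν : Measure X} [SFinite μ] [SFinite ν] {p : ℝ≥0∞} (hp : 1 ≤ p) (hp' : p ≠ ⊤)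
    {K : Z → ℂ} (hK : AEStronglyMeasurable K μ) {g : Z → X → ℂ}
    (hg : AEStronglyMeasurable (Function.uncurry g) (μ.prod ν)) {M : Z → ℝ≥0∞}
    (hM : ∀ z, eLpNorm (g z) p ν ≤ M z) :
    eLpNorm (fun x => ∫ z, K z * g z x ∂μ) p ν ^ p.toReal ≤
      (∫⁻ z, ‖K z‖ₑ ∂μ) ^ (p.toReal - 1) * ∫⁻ z, ‖K z‖ₑ * M z ^ p.toReal ∂μ := by
  have h1 := one_le_toReal hp hp'
  have h0 : 0 ≤ p.toReal := by linarith
  rw [eLpNorm_rpow_eq hp hp']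
  have hg' : AEStronglyMeasurable (fun q : X × Z => g q.2 q.1) (ν.prod μ) := hg.prod_swap
  calc ∫⁻ x, ‖∫ z, K z * g z x ∂μ‖ₑ ^ p.toReal ∂ν
      ≤ ∫⁻ x, (∫⁻ z, ‖K z‖ₑ * ‖g z x‖ₑ ∂μ) ^ p.toReal ∂ν := by
        refine lintegral_mono fun x => ENNReal.rpow_le_rpow ?_ h0
        refine (enorm_integral_le_lintegral_enorm _).trans_eq ?_
        simp only [enorm_mul]
    _ ≤ ∫⁻ x, (∫⁻ z, ‖K z‖ₑ ∂μ) ^ (p.toReal - 1) *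
          ∫⁻ z, ‖K z‖ₑ * ‖g z x‖ₑ ^ p.toReal ∂μ ∂ν := by
        refine lintegral_mono_ae ?_
        filter_upwards [hg'.prodMk_left] with x hx
        exact lintegral_mul_rpow_le h1 hK.enorm hx.enorm
    _ = (∫⁻ z, ‖K z‖ₑ ∂μ) ^ (p.toReal - 1) *
          ∫⁻ z, ‖K z‖ₑ * ∫⁻ x, ‖g z x‖ₑ ^ p.toReal ∂ν ∂μ := by
        have hm : AEMeasurable (fun q : X × Z => ‖K q.2‖ₑ * ‖g q.2 q.1‖ₑ ^ p.toReal) (ν.prod μ) :=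
          (hK.comp_snd.enorm).mul (hg'.enorm.pow_const _)
        rw [lintegral_const_mul'' _ hm.lintegral_prod_right', lintegral_lintegral_swap hm]
        congr 1
        refine lintegral_congr_ae ?_
        filter_upwards [hg.prodMk_left] with z hz
        exact lintegral_const_mul'' _ (hz.enorm.pow_const _)
    _ ≤ _ := by
        gcongr with z
        rw [← eLpNorm_rpow_eq hp hp']
        exact ENNReal.rpow_le_rpow (hM z) h0

lemma eLpNorm_integral_mul_le_const {Z X : Type*} [MeasurableSpace Z] [MeasurableSpace X]
    {μ : Measure Z} {ν : Measure X} [SFinite μ] [SFinite ν] {p : ℝ≥0∞} (hp : 1 ≤ p) (hp' : p ≠ ⊤)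
    {K : Z → ℂ} (hK : Integrable K μ) {g : Z → X → ℂ}
    (hg : AEStronglyMeasurable (Function.uncurry g) (μ.prod ν)) {M : ℝ≥0∞}
    (hM : ∀ z, eLpNorm (g z) p ν ≤ M) :
    eLpNorm (fun x => ∫ z, K z * g z x ∂μ) p ν ≤ (∫⁻ z, ‖K z‖ₑ ∂μ) * M := by
  have h1 := one_le_toReal hp hp'
  have h0 : 0 < p.toReal := by linarith
  have := eLpNorm_integral_mul_le hp hp' hK.aestronglyMeasurable hg hM
  rw [lintegral_mul_const'' _ hK.aestronglyMeasurable.enorm, ← mul_assoc] at this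
  have e : (∫⁻ z, ‖K z‖ₑ ∂μ) ^ (p.toReal - 1) * (∫⁻ z, ‖K z‖ₑ ∂μ) =
      (∫⁻ z, ‖K z‖ₑ ∂μ) ^ p.toReal := by
    conv_lhs => rw [← ENNReal.rpow_one (∫⁻ z, ‖K z‖ₑ ∂μ)]
    rw [ENNReal.rpow_one, ← ENNReal.rpow_one (∫⁻ z, ‖K z‖ₑ ∂μ)]
    rw [← ENNReal.rpow_mul, ← ENNReal.rpow_add_of_nonneg _ _ (by linarith) (by linarith)]
    simp
  rw [e, ← ENNReal.mul_rpow_of_nonneg _ _ h0.le] at this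
  exact (ENNReal.rpow_le_rpow_iff h0).1 this

/-- If functions bounded in `L^p` converge in `L¹`, the limit satisfies the same bound. -/
lemma eLpNorm_le_of_tendsto_eLpNorm_one {X : Type*} [MeasurableSpace X] {ν : Measure X}
    {p : ℝ≥0∞} {f : ℕ → X → ℂ} {g : X → ℂ} (hf : ∀ n, AEStronglyMeasurable (f n) ν)
    (hg : AEStronglyMeasurable g ν)
    (h : Tendsto (fun n => eLpNorm (fun x => f n x - g x) 1 ν) atTop (𝓝 0)) {B : ℝ≥0∞}
    (hB : ∀ n, eLpNorm (f n) p ν ≤ B) : eLpNorm g p ν ≤ B := by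
  -- Convergence in L¹ implies convergence in measure, hence almost everywhere along a subsequence;
  -- Fatou's lemma then transfers the bound.
  obtain ⟨φ, -, hφ⟩ := (tendstoInMeasure_of_tendsto_eLpNorm one_ne_zero hf hg h).exists_seq_tendsto_ae
  refine Lp.eLpNorm_le_of_ae_tendsto (u := atTop) (f := fun n => f (φ n)) ?_ (fun n => hf _) hφ
  exact Eventually.of_forall fun n => hB _

open UnitAddTorus (mFourier)
open scoped FourierTransform SchwartzMap

/-! ### Fourier coefficients of complex functions and trigonometric sums -/

/-- The Fourier coefficients of a complex function on the torus. -/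
def fc (f : T3 → ℂ) (k : Fin 3 → ℤ) : ℂ := ∫ x, mFourier (-k) x * f x ∂torusVol

lemma coeff_eq_fc (f : T3 → ℝ) (k : Fin 3 → ℤ) : coeff f k = fc (fun x => (f x : ℂ)) k := rfl

/-- The link between the torus and ℝ³: lifted characters are the characters of ℝ³ at integer
frequencies. It turns Fourier transforms of kernels on ℝ³ into Fourier multipliers on the torus. -/
lemma mFourier_toTorus (k : Fin 3 → ℤ) (y : E3) :
    mFourier k (toTorus y) = (Real.fourierChar (inner ℝ (freq k) y) : ℂ) := by
  simp only [mFourier, ContinuousMap.coe_mk, toTorus, fourier_coe_apply, Real.fourierChar_apply,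
    ← Complex.exp_sum]
  congr 1
  simp only [PiLp.inner_apply, freq, RCLike.inner_apply, conj_trivial, Complex.ofReal_sum,
    Complex.ofReal_mul, Finset.mul_sum, Finset.sum_mul]
  refine Finset.sum_congr rfl fun i _ => ?_
  push_cast; ring

lemma norm_mFourier_apply (k : Fin 3 → ℤ) (x : T3) : ‖mFourier k x‖ = 1 := by
  obtain ⟨y, rfl⟩ := surjective_toTorus x
  rw [mFourier_toTorus]; exact Circle.norm_coe _

lemma mFourier_add_apply (k : Fin 3 → ℤ) (x y : T3) :
    mFourier k (x + y) = mFourier k x * mFourier k y := by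
  obtain ⟨x, rfl⟩ := surjective_toTorus x
  obtain ⟨y, rfl⟩ := surjective_toTorus y
  rw [← toTorus_add, mFourier_toTorus, mFourier_toTorus, mFourier_toTorus, inner_add_right,
    AddChar.map_add_eq_mul]; simp

lemma integrable_mFourier_mul {f : T3 → ℂ} (hf : Integrable f torusVol) (k : Fin 3 → ℤ) :
    Integrable (fun x => mFourier k x * f x) torusVol :=
  hf.bdd_mul (c := 1) (mFourier k).continuous.aestronglyMeasurable
    (ae_of_all _ fun x => (norm_mFourier_apply k x).le)

lemma integrable_mFourier (k : Fin 3 → ℤ) : Integrable (mFourier k) torusVol :=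
  (mFourier k).continuous.integrable_of_hasCompactSupport (HasCompactSupport.of_compactSpace _)

lemma integral_mFourier_mul (k l : Fin 3 → ℤ) :
    ∫ x, mFourier (-k) x * mFourier l x ∂torusVol = if l = k then 1 else 0 := by
  have := orthonormal_iff_ite.1 (UnitAddTorus.orthonormal_mFourier (d := Fin 3)) k l
  simp only [ContinuousMap.inner_toLp, ← UnitAddTorus.mFourier_neg] at this
  simp only [mul_comm (mFourier (-k) _), eq_comm (a := l)]
  exact this

lemma norm_fc_le {f : T3 → ℂ} (k : Fin 3 → ℤ) :
    ‖fc f k‖ₑ ≤ eLpNorm f 1 torusVol := by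
  rw [eLpNorm_one_eq_lintegral_enorm]
  refine (enorm_integral_le_lintegral_enorm _).trans_eq ?_
  refine lintegral_congr fun x => ?_
  rw [enorm_mul, ← ofReal_norm, norm_mFourier_apply]; simp

lemma fc_sub {f g : T3 → ℂ} (hf : Integrable f torusVol) (hg : Integrable g torusVol)
    (k : Fin 3 → ℤ) : fc (fun x => f x - g x) k = fc f k - fc g k := by
  simp only [fc, mul_sub]
  exact integral_sub (integrable_mFourier_mul hf _) (integrable_mFourier_mul hg _)

lemma fc_add {f g : T3 → ℂ} (hf : Integrable f torusVol) (hg : Integrable g torusVol)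
    (k : Fin 3 → ℤ) : fc (fun x => f x + g x) k = fc f k + fc g k := by
  simp only [fc, mul_add]
  exact integral_add (integrable_mFourier_mul hf _) (integrable_mFourier_mul hg _)

lemma fc_const_mul (a : ℂ) (f : T3 → ℂ) (k : Fin 3 → ℤ) :
    fc (fun x => a * f x) k = a * fc f k := by
  simp only [fc]; rw [← integral_const_mul]; congr 1; ext x; ring

lemma fc_congr {f g : T3 → ℂ} (h : f =ᵐ[torusVol] g) (k : Fin 3 → ℤ) : fc f k = fc g k :=
  integral_congr_ae (h.mono fun x hx => by simp only [hx])

/-- The trigonometric polynomial with frequencies in `F` and coefficients `a`. -/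
def trigPoly (F : Finset (Fin 3 → ℤ)) (a : (Fin 3 → ℤ) → ℂ) (x : T3) : ℂ :=
  ∑ k ∈ F, a k * mFourier k x

lemma continuous_trigPoly (F : Finset (Fin 3 → ℤ)) (a : (Fin 3 → ℤ) → ℂ) :
    Continuous (trigPoly F a) := by
  unfold trigPoly; fun_prop

lemma integrable_trigPoly (F : Finset (Fin 3 → ℤ)) (a : (Fin 3 → ℤ) → ℂ) :
    Integrable (trigPoly F a) torusVol :=
  (continuous_trigPoly F a).integrable_of_hasCompactSupport (HasCompactSupport.of_compactSpace _)

lemma fc_trigPoly (F : Finset (Fin 3 → ℤ)) (a : (Fin 3 → ℤ) → ℂ) (k : Fin 3 → ℤ) :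
    fc (trigPoly F a) k = if k ∈ F then a k else 0 := by
  simp only [fc, trigPoly, Finset.mul_sum]
  rw [integral_finsetSum]
  · have : ∀ l ∈ F, ∫ x, mFourier (-k) x * (a l * mFourier l x) ∂torusVol =
        if l = k then a l else 0 := by
      intro l _
      have e : ∀ x : T3, mFourier (-k) x * (a l * mFourier l x) =
        a l * (mFourier (-k) x * mFourier l x) := fun x => by ring
      simp only [e]
      rw [integral_const_mul, integral_mFourier_mul]
      simp
    rw [Finset.sum_congr rfl this]
    simp
  · intro l _
    exact integrable_mFourier_mul ((integrable_mFourier l).const_mul _) _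

/-- Density of trigonometric polynomials in L¹. Identities between operators bounded on L¹ then need
to be checked on characters only. -/
lemma exists_trigPoly_approx {f : T3 → ℂ} (hf : Integrable f torusVol) {ε : ℝ≥0∞} (hε : ε ≠ 0) :
    ∃ F a, eLpNorm (fun x => f x - trigPoly F a x) 1 torusVol ≤ ε := by
  have hd := UnitAddTorus.span_mFourierLp_closure_eq_top (d := Fin 3) (p := 1) (by simp)
  have hf1 : MemLp f 1 torusVol := memLp_one_iff_integrable.2 hf
  have hmem : hf1.toLp f ∈ (Submodule.span ℂ
      (range (UnitAddTorus.mFourierLp (d := Fin 3) 1))).topologicalClosure := by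
    rw [hd]; trivial
  rw [← SetLike.mem_coe, Submodule.topologicalClosure_coe, EMetric.mem_closure_iff] at hmem
  obtain ⟨g, hg, hfg⟩ := hmem ε hε.bot_lt
  obtain ⟨a, rfl⟩ := (Finsupp.mem_span_range_iff_exists_finsupp).1 hg
  refine ⟨a.support, a, ?_⟩
  rw [Lp.edist_def] at hfg
  refine le_of_eq_of_le (eLpNorm_congr_ae ?_) hfg.le
  have h1 : (a.sum fun i b => b • UnitAddTorus.mFourierLp (d := Fin 3) 1 i : Lp ℂ 1 torusVol)
      =ᵐ[torusVol] trigPoly a.support a := by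
    have : (a.sum fun i b => b • UnitAddTorus.mFourierLp (d := Fin 3) 1 i : Lp ℂ 1 torusVol) =
        ContinuousMap.toLp (E := ℂ) 1 torusVol ℂ (∑ i ∈ a.support, a i • mFourier i) := by
      rw [map_sum]; simp only [map_smul]; rfl
    rw [this]
    refine (ContinuousMap.coeFn_toLp torusVol _).trans (ae_of_all _ fun x => ?_)
    simp [trigPoly]
  filter_upwards [hf1.coeFn_toLp, h1] with x h2 h3
  simp only [Pi.sub_apply]
  rw [h2]
  congr 1
  exact h3.symm

/-! ### Convolution with a rescaled kernel on `ℝ³` -/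

/-- Convolution of a function on the torus with the kernel `c⁻³ K(c⁻¹ ·)` on `ℝ³`. -/
def kconv (K : E3 → ℂ) (c : ℝ) (f : T3 → ℂ) (x : T3) : ℂ := ∫ z, K z * f (shift (-(c • z)) x)

lemma measurable_neg_smul (c : ℝ) : Measurable fun z : E3 => -(c • z) := by fun_prop

lemma aestronglyMeasurable_kconv {X : Type*} [MeasurableSpace X] {ν : Measure X} [SFinite ν]
    {sh : E3 → X → X} (h : IsShift ν sh) {K : E3 → ℂ} (hK : Integrable K) (c : ℝ) {f : X → ℂ}
    (hf : AEStronglyMeasurable f ν) :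
    AEStronglyMeasurable (fun x => ∫ z, K z * f (sh (-(c • z)) x)) ν := by
  have : AEStronglyMeasurable (fun q : X × E3 => K q.2 * f (sh (-(c • q.2)) q.1))
      (ν.prod volume) :=
    (hK.aestronglyMeasurable.comp_snd).mul
      (h.aestronglyMeasurable (measurable_neg_smul c) hf).prod_swap
  exact this.integral_prod_right'

lemma eLpNorm_kconv_le {X : Type*} [MeasurableSpace X] {ν : Measure X} [SFinite ν]
    {sh : E3 → X → X} (h : IsShift ν sh) {K : E3 → ℂ} (hK : Integrable K) (c : ℝ) {f : X → ℂ}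
    (hf : AEStronglyMeasurable f ν) {p : ℝ≥0∞} (hp : 1 ≤ p) (hp' : p ≠ ⊤) :
    eLpNorm (fun x => ∫ z, K z * f (sh (-(c • z)) x)) p ν ≤ (∫⁻ z, ‖K z‖ₑ) * eLpNorm f p ν := by
  refine eLpNorm_integral_mul_le_const hp hp' hK
    (g := fun z x => f (sh (-(c • z)) x)) (h.aestronglyMeasurable (measurable_neg_smul c) hf)
    fun z => ?_
  exact (eLpNorm_comp_measurePreserving hf (h.pres _)).le

/-- Fubini, with translations preserving the measure. The convolution integral may diverge at
exceptional points, so its linearity in f is available almost everywhere only. -/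
lemma ae_integrable_kconv {X : Type*} [MeasurableSpace X] {ν : Measure X} [SFinite ν]
    {sh : E3 → X → X} (h : IsShift ν sh) {K : E3 → ℂ} (hK : Integrable K) (c : ℝ) {f : X → ℂ}
    (hf : Integrable f ν) :
    ∀ᵐ x ∂ν, Integrable (fun z => K z * f (sh (-(c • z)) x)) := by
  have hm : AEStronglyMeasurable (fun q : E3 × X => K q.1 * f (sh (-(c • q.1)) q.2))
      ((volume : Measure E3).prod ν) :=
    (hK.aestronglyMeasurable.comp_fst).mul
      (h.aestronglyMeasurable (measurable_neg_smul c) hf.aestronglyMeasurable)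
  have : Integrable (fun q : E3 × X => K q.1 * f (sh (-(c • q.1)) q.2))
      ((volume : Measure E3).prod ν) := by
    rw [integrable_prod_iff hm]
    have hp : ∀ z, Integrable (fun x => f (sh (-(c • z)) x)) ν := fun z =>
      (h.pres _).integrable_comp_of_integrable hf
    refine ⟨ae_of_all _ fun z => (hp z).const_mul (K z), ?_⟩
    have : ∀ z, ∫ x, ‖K z * f (sh (-(c • z)) x)‖ ∂ν = ‖K z‖ * ∫ x, ‖f x‖ ∂ν := by
      intro z
      simp only [norm_mul]
      rw [integral_const_mul]
      congr 1
      have := integral_map (μ := ν) (φ := sh (-(c • z))) (h.pres _).measurable.aemeasurable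
        (f := fun x => ‖f x‖) (by rw [(h.pres _).map_eq]; exact hf.norm.aestronglyMeasurable)
      rw [(h.pres _).map_eq] at this
      exact this.symm
    simp only [this]
    exact hK.norm.mul_const _
  exact this.prod_left_ae

/-- Characters are eigenfunctions of translations; the eigenvalue of the average is the Fourier
transform of the kernel at the rescaled frequency. -/
lemma kconv_mFourier (K : E3 → ℂ) (c : ℝ) (k : Fin 3 → ℤ) (x : T3) :
    kconv K c (mFourier k) x = 𝓕 K (c • freq k) * mFourier k x := by
  simp only [kconv, shift, mFourier_add_apply]
  rw [Real.fourier_eq, ← integral_mul_const]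
  refine integral_congr_ae (ae_of_all _ fun z => ?_)
  simp only [mFourier_toTorus, inner_neg_right, inner_smul_right, real_inner_comm, Circle.smul_def,
    smul_eq_mul]
  ring

lemma kconv_trigPoly {K : E3 → ℂ} (hK : Integrable K) (c : ℝ) (F : Finset (Fin 3 → ℤ))
    (a : (Fin 3 → ℤ) → ℂ) (x : T3) :
    kconv K c (trigPoly F a) x = trigPoly F (fun k => 𝓕 K (c • freq k) * a k) x := by
  simp only [kconv, trigPoly, Finset.mul_sum]
  have hi : ∀ k ∈ F, Integrable fun z => K z * (a k * mFourier k (shift (-(c • z)) x)) := by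
    intro k _
    refine hK.mul_bdd (c := ‖a k‖) ?_ ?_
    · refine Continuous.aestronglyMeasurable ?_
      have := continuous_toTorus
      unfold shift; fun_prop
    · exact ae_of_all _ fun z => by rw [norm_mul, norm_mFourier_apply, mul_one]
  rw [integral_finsetSum _ hi]
  refine Finset.sum_congr rfl fun k _ => ?_
  have e : ∀ z, K z * (a k * mFourier k (shift (-(c • z)) x)) =
      a k * (K z * mFourier k (shift (-(c • z)) x)) := fun z => by ring
  simp only [e]
  rw [integral_const_mul]
  have := kconv_mFourier K c k x
  unfold kconv at this
  rw [this]; ring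

/-- The trigonometric polynomial obtained from `f` by a finitely supported multiplier. -/
def trigOp (F : Finset (Fin 3 → ℤ)) (a : (Fin 3 → ℤ) → ℂ) (f : T3 → ℂ) : T3 → ℂ :=
  trigPoly F fun k => a k * fc f k

lemma eLpNorm_trigPoly_le (F : Finset (Fin 3 → ℤ)) (a : (Fin 3 → ℤ) → ℂ) (p : ℝ≥0∞) :
    eLpNorm (trigPoly F a) p torusVol ≤ ∑ k ∈ F, ‖a k‖ₑ := by
  have h : ∀ x, ‖trigPoly F a x‖ ≤ ∑ k ∈ F, ‖a k‖ := fun x => by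
    refine (norm_sum_le _ _).trans (Finset.sum_le_sum fun k _ => ?_)
    rw [norm_mul, norm_mFourier_apply, mul_one]
  refine (eLpNorm_le_of_ae_bound (ae_of_all _ h)).trans ?_
  simp only [measure_univ, ENNReal.one_rpow, one_mul]
  rw [ENNReal.ofReal_sum_of_nonneg (fun _ _ => norm_nonneg _)]
  simp only [ofReal_norm]; exact le_rfl

lemma kconv_sub_ae {K : E3 → ℂ} (hK : Integrable K) (c : ℝ) {f g : T3 → ℂ}
    (hf : Integrable f torusVol) (hg : Integrable g torusVol) :
    kconv K c (fun x => f x - g x) =ᵐ[torusVol] fun x => kconv K c f x - kconv K c g x := by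
  filter_upwards [ae_integrable_kconv isShift_shift hK c hf,
    ae_integrable_kconv isShift_shift hK c hg] with x h1 h2
  simp only [kconv, mul_sub]
  exact integral_sub h1 h2

/-- Convolution with a kernel whose Fourier transform vanishes outside a finite set of
frequencies is given by a finite Fourier multiplier. -/
lemma kconv_ae_eq_trigOp {K : E3 → ℂ} (hK : Integrable K) (c : ℝ) {F : Finset (Fin 3 → ℤ)}
    (hF : ∀ k ∉ F, 𝓕 K (c • freq k) = 0) {f : T3 → ℂ} (hf : Integrable f torusVol) :
    kconv K c f =ᵐ[torusVol] trigOp F (fun k => 𝓕 K (c • freq k)) f := by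
  set m : (Fin 3 → ℤ) → ℂ := fun k => 𝓕 K (c • freq k)
  have hA : ∫⁻ z, ‖K z‖ₑ ≠ ⊤ := hK.2.ne
  set B : ℝ≥0∞ := (∫⁻ z, ‖K z‖ₑ) + ∑ k ∈ F, ‖m k‖ₑ
  have hB : B ≠ ⊤ := ENNReal.add_ne_top.2 ⟨hA, ENNReal.sum_ne_top.2 fun k _ => enorm_ne_top⟩
  have hmk : AEStronglyMeasurable (kconv K c f) torusVol :=
    aestronglyMeasurable_kconv isShift_shift hK c hf.aestronglyMeasurable
  have hmt : AEStronglyMeasurable (trigOp F m f) torusVol :=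
    (continuous_trigPoly _ _).aestronglyMeasurable
  -- The difference of the two operators is linear in f and vanishes on trigonometric polynomials,
  -- since `hF` kills the frequencies outside F. Its L¹ norm is thus at most B times the error of
  -- any trigonometric approximation of f.
  have key : ∀ ε : ℝ≥0∞, ε ≠ 0 →
      eLpNorm (kconv K c f - trigOp F m f) 1 torusVol ≤ B * ε := by
    intro ε hε
    obtain ⟨G, a, hG⟩ := exists_trigPoly_approx hf hε
    set g := trigPoly G a
    have hg : Integrable g torusVol := integrable_trigPoly _ _
    have e1 : kconv K c f - trigOp F m f =ᵐ[torusVol]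
        kconv K c (fun x => f x - g x) - trigOp F m (fun x => f x - g x) := by
      filter_upwards [kconv_sub_ae hK c hf hg] with x hx
      simp only [Pi.sub_apply, hx]
      have e2 : trigOp F m (fun x => f x - g x) x = trigOp F m f x - trigOp F m g x := by
        simp only [trigOp, trigPoly, fc_sub hf hg, ← Finset.sum_sub_distrib]
        exact Finset.sum_congr rfl fun k _ => by ring
      have e3 : kconv K c g x = trigOp F m g x := by
        simp only [g, kconv_trigPoly hK, trigOp, fc_trigPoly]
        simp only [trigPoly]
        rw [← Finset.sum_filter_of_ne (s := G) (p := (· ∈ F)),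
          ← Finset.sum_filter_of_ne (s := F) (p := (· ∈ G))]
        · have : G.filter (· ∈ F) = F.filter (· ∈ G) := by
            ext k; simp [and_comm]
          rw [this]
          refine Finset.sum_congr rfl fun k hk => ?_
          rw [if_pos (Finset.mem_filter.1 hk).2]
        · intro k _ h
          by_contra hk
          simp [hk] at h
        · intro k _ h
          by_contra hk
          simp [hF k hk] at h
      rw [e2, e3]; ring
    rw [eLpNorm_congr_ae e1]
    have hfg : Integrable (fun x => f x - g x) torusVol := hf.sub hg
    refine (eLpNorm_sub_le (aestronglyMeasurable_kconv isShift_shift hK c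
      hfg.aestronglyMeasurable) (continuous_trigPoly _ _).aestronglyMeasurable le_rfl).trans ?_
    rw [add_mul]
    gcongr
    · refine (eLpNorm_kconv_le isShift_shift hK c hfg.aestronglyMeasurable le_rfl
        ENNReal.one_ne_top).trans ?_
      gcongr
    · refine (eLpNorm_trigPoly_le _ _ _).trans ?_
      rw [Finset.sum_mul]
      gcongr with k _
      rw [enorm_mul]
      gcongr
      exact (norm_fc_le k).trans hG
  have h0 : eLpNorm (kconv K c f - trigOp F m f) 1 torusVol = 0 := by
    by_contra hne
    have hBp : B ≠ 0 := by
      intro h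
      have := key 1 one_ne_zero
      simp [h] at this
      exact hne this
    have hfin : eLpNorm (kconv K c f - trigOp F m f) 1 torusVol ≠ ⊤ :=
      ((key 1 one_ne_zero).trans_lt (by simpa using hB.lt_top)).ne
    -- With this ε the bound says that a finite nonzero norm is at most half of itself.
    have := key (eLpNorm (kconv K c f - trigOp F m f) 1 torusVol / (2 * B))
      (ENNReal.div_ne_zero.2 ⟨hne, ENNReal.mul_ne_top (by simp) hB⟩)
    have e : B * (eLpNorm (kconv K c f - trigOp F m f) 1 torusVol / (2 * B)) =
        eLpNorm (kconv K c f - trigOp F m f) 1 torusVol / 2 := by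
      rw [mul_comm 2 B, ENNReal.div_eq_inv_mul, ENNReal.mul_inv (Or.inl hBp) (Or.inl hB),
        ← mul_assoc, ← mul_assoc, ENNReal.mul_inv_cancel hBp hB, one_mul, ENNReal.div_eq_inv_mul]
    rw [e] at this
    exact absurd this (not_le.2 (ENNReal.half_lt_self hne hfin))
  have := (eLpNorm_eq_zero_iff (hmk.sub hmt) one_ne_zero).1 h0
  filter_upwards [this] with x hx
  simpa [sub_eq_zero] using hx

/-- Convolutions with rescaled kernels of integral one approximate the identity in `L¹`. -/
lemma tendsto_kconv_sub {K : E3 → ℂ} (hK : Integrable K)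
    (h1 : ∀ ξ : E3, ‖ξ‖ ≤ 1 → 𝓕 K ξ = 1) {c : ℕ → ℝ} (hc : Tendsto c atTop (𝓝 0))
    {f : T3 → ℂ} (hf : Integrable f torusVol) :
    Tendsto (fun n => eLpNorm (fun x => kconv K (c n) f x - f x) 1 torusVol) atTop (𝓝 0) := by
  set B : ℝ≥0∞ := (∫⁻ z, ‖K z‖ₑ) + 1
  have hB : B ≠ ⊤ := ENNReal.add_ne_top.2 ⟨hK.2.ne, by simp⟩
  have hBp : B ≠ 0 := by simp [B]
  rw [ENNReal.tendsto_atTop_zero]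
  intro ε hε
  obtain ⟨G, a, hG⟩ := exists_trigPoly_approx hf (ε := ε / B)
    (ENNReal.div_ne_zero.2 ⟨hε.ne', hB⟩)
  set g := trigPoly G a
  have hg : Integrable g torusVol := integrable_trigPoly _ _
  have hfg : Integrable (fun x => f x - g x) torusVol := hf.sub hg
  -- Once all frequencies of the approximant g are rescaled into the unit ball, where 𝓕 K = 1, the
  -- convolution fixes g exactly.
  have hev : ∀ᶠ n in atTop, ∀ k ∈ G, ‖c n • freq k‖ ≤ 1 := by
    rw [Filter.eventually_all_finset]
    intro k _
    have : Tendsto (fun n => ‖c n • freq k‖) atTop (𝓝 0) := by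
      simpa using (hc.smul_const (freq k)).norm
    exact this.eventually_le_const zero_lt_one
  obtain ⟨N, hN⟩ := eventually_atTop.1 hev
  refine ⟨N, fun n hn => ?_⟩
  have e : (fun x => kconv K (c n) f x - f x) =ᵐ[torusVol]
      (kconv K (c n) fun x => f x - g x) - fun x => f x - g x := by
    filter_upwards [kconv_sub_ae hK (c n) hf hg] with x hx
    have e3 : kconv K (c n) g x = g x := by
      simp only [g, kconv_trigPoly hK, trigPoly]
      refine Finset.sum_congr rfl fun k hk => ?_
      rw [h1 _ (hN n hn k hk), one_mul]
    simp only [Pi.sub_apply, hx, e3]; ring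
  rw [eLpNorm_congr_ae e]
  refine (eLpNorm_sub_le (aestronglyMeasurable_kconv isShift_shift hK _
      hfg.aestronglyMeasurable) hfg.aestronglyMeasurable le_rfl).trans ?_
  calc _ ≤ (∫⁻ z, ‖K z‖ₑ) * (ε / B) + ε / B := by
        gcongr
        refine (eLpNorm_kconv_le isShift_shift hK _ hfg.aestronglyMeasurable le_rfl
          ENNReal.one_ne_top).trans ?_
        gcongr
    _ = B * (ε / B) := by simp only [B]; ring
    _ = ε := ENNReal.mul_div_cancel hBp hB

/-! ### Schwartz kernels with compactly supported Fourier transform -/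

/-- The kernel is the inverse Fourier transform of the symbol. It is Schwartz but not compactly
supported in general, so locality in later estimates comes from finite moments. -/
lemma exists_kernel {m : E3 → ℂ} (hc : HasCompactSupport m) (hs : ContDiff ℝ ∞ m) :
    ∃ K : 𝓢(E3, ℂ), ∀ ξ, 𝓕 (K : E3 → ℂ) ξ = m ξ := by
  refine ⟨𝓕⁻ (hc.toSchwartzMap hs), fun ξ => ?_⟩
  rw [← SchwartzMap.fourier_coe, FourierTransform.fourier_fourierInv_eq]
  rfl

lemma integral_kernel {K : E3 → ℂ} : ∫ z, K z = 𝓕 K 0 := by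
  rw [Real.fourier_eq]; simp

/-- A smooth cut-off function, equal to one on the unit ball and supported in the ball of
radius two. -/
def chiBump : ContDiffBump (0 : E3) := ⟨1, 2, one_pos, one_lt_two⟩

/-- The cut-off function as a complex valued function. -/
def chi (ξ : E3) : ℂ := (chiBump ξ : ℂ)

lemma contDiff_chi : ContDiff ℝ ∞ chi := Complex.ofRealCLM.contDiff.comp chiBump.contDiff

lemma hasCompactSupport_chi : HasCompactSupport chi :=
  chiBump.hasCompactSupport.comp_left (g := fun r : ℝ => (r : ℂ)) (by simp)

lemma chi_eq_one {ξ : E3} (h : ‖ξ‖ ≤ 1) : chi ξ = 1 := by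
  simp [chi, chiBump.one_of_mem_closedBall (x := ξ) (by simpa [chiBump] using h)]

lemma chi_eq_zero {ξ : E3} (h : 2 ≤ ‖ξ‖) : chi ξ = 0 := by
  simp [chi, chiBump.zero_of_le_dist (x := ξ) (by simpa [chiBump] using h)]

lemma norm_chi_le (ξ : E3) : ‖chi ξ‖ ≤ 1 := by
  simp only [chi, Complex.norm_real, Real.norm_eq_abs, abs_of_nonneg chiBump.nonneg]
  exact chiBump.le_one

/-- The Schwartz kernel with Fourier transform `chi`. -/
def chiK : 𝓢(E3, ℂ) := (exists_kernel hasCompactSupport_chi contDiff_chi).choose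

lemma fourier_chiK (ξ : E3) : 𝓕 (chiK : E3 → ℂ) ξ = chi ξ :=
  (exists_kernel hasCompactSupport_chi contDiff_chi).choose_spec ξ

lemma finite_norm_freq_le (R : ℝ) : {k : Fin 3 → ℤ | ‖freq k‖ ≤ R}.Finite := by
  refine ((Fintype.piFinset fun _ : Fin 3 => Finset.Icc (-⌈R⌉) ⌈R⌉).finite_toSet).subset ?_
  intro k hk
  simp only [Finset.mem_coe, Fintype.mem_piFinset, Finset.mem_Icc]
  intro i
  have h1 : |(k i : ℝ)| ≤ R := by
    have := PiLp.norm_apply_le (freq k) i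
    simp only [freq, Real.norm_eq_abs] at this
    exact this.trans hk
  have h2 := (abs_le.1 h1)
  have h3 := Int.le_ceil R
  constructor
  · have : (-(⌈R⌉ : ℝ)) ≤ k i := by linarith
    exact_mod_cast this
  · have : (k i : ℝ) ≤ ⌈R⌉ := by linarith
    exact_mod_cast this

/-- The frequencies of modulus at most `R`. -/
def modes (R : ℝ) : Finset (Fin 3 → ℤ) := (finite_norm_freq_le R).toFinset

lemma mem_modes {R : ℝ} {k : Fin 3 → ℤ} : k ∈ modes R ↔ ‖freq k‖ ≤ R := by
  simp [modes]

lemma two_lt_of_notMem_modes {c : ℝ} (hc : 0 < c) {k : Fin 3 → ℤ} (hk : k ∉ modes (2 / c)) :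
    2 < ‖c • freq k‖ := by
  rw [mem_modes, not_le, div_lt_iff₀ hc] at hk
  rw [norm_smul, Real.norm_of_nonneg hc.le]; linarith

/-- The smooth truncation of the Fourier series of `f` to frequencies of order `1 / c`. -/
def lowPass (c : ℝ) (f : T3 → ℂ) : T3 → ℂ :=
  trigOp (modes (2 / c)) (fun k => chi (c • freq k)) f

lemma kconv_chiK_ae_eq {c : ℝ} (hc : 0 < c) {f : T3 → ℂ} (hf : Integrable f torusVol) :
    kconv chiK c f =ᵐ[torusVol] lowPass c f := by
  have := kconv_ae_eq_trigOp chiK.integrable c (F := modes (2 / c))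
    (fun k hk => by rw [fourier_chiK, chi_eq_zero (two_lt_of_notMem_modes hc hk).le]) hf
  simpa only [fourier_chiK] using! this

/-! ### Moments of Schwartz kernels -/

lemma lintegral_moment_ne_top (K : 𝓢(E3, ℂ)) {r : ℝ} (hr : 0 ≤ r) :
    ∫⁻ z, ‖K z‖ₑ * ENNReal.ofReal (‖z‖ ^ r) ≠ ⊤ := by
  obtain ⟨n, hn⟩ := exists_nat_ge r
  have h1 := (K.integrable_pow_mul (volume : Measure E3) n)
  have h2 := (K.integrable (μ := (volume : Measure E3))).norm
  have h3 := (h1.add h2).lintegral_lt_top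
  refine (lt_of_le_of_lt (lintegral_mono fun z => ?_) h3).ne
  rw [← ofReal_norm, ← ENNReal.ofReal_mul (norm_nonneg _)]
  refine ENNReal.ofReal_le_ofReal ?_
  have : ‖z‖ ^ r ≤ ‖z‖ ^ n + 1 := by
    rcases le_total ‖z‖ 1 with h | h
    · have := Real.rpow_le_one (norm_nonneg z) h hr
      have : 0 ≤ ‖z‖ ^ n := by positivity
      linarith
    · have := Real.rpow_le_rpow_of_exponent_le h hn
      rw [Real.rpow_natCast] at this
      linarith
  simp only [Pi.add_apply]
  nlinarith [norm_nonneg (K z)]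

/-- Averages with respect to a Schwartz kernel of a family of functions that is small near the
origin. -/
lemma exists_moment_bound (K : 𝓢(E3, ℂ)) {p : ℝ≥0∞} (hp : 1 ≤ p) (hp' : p ≠ ⊤) {β : ℝ}
    (hβ : 0 ≤ β) :
    ∃ A : ℝ≥0, ∀ {X : Type} [MeasurableSpace X] {ν : Measure X} [SFinite ν] (g : E3 → X → ℂ)
      (C : ℝ≥0∞) (c : ℝ), 0 ≤ c →
      AEStronglyMeasurable (Function.uncurry g) ((volume : Measure E3).prod ν) →
      (∀ z, eLpNorm (g z) p ν ≤ C * ENNReal.ofReal ((c * ‖z‖) ^ β)) →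
      eLpNorm (fun x => ∫ z, K z * g z x) p ν ≤ A * C * ENNReal.ofReal (c ^ β) := by
  have h1 := one_le_toReal hp hp'
  have h0 : 0 < p.toReal := by linarith
  set I := ∫⁻ z, ‖K z‖ₑ
  have hI : I ≠ ⊤ := K.integrable.2.ne
  set J := ∫⁻ z, ‖K z‖ₑ * ENNReal.ofReal (‖z‖ ^ (β * p.toReal))
  have hJ : J ≠ ⊤ := lintegral_moment_ne_top K (by positivity)
  have hAfin : (I ^ (p.toReal - 1) * J) ^ (1 / p.toReal) ≠ ⊤ :=
    ENNReal.rpow_ne_top_of_nonneg (by positivity)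
      (ENNReal.mul_ne_top (ENNReal.rpow_ne_top_of_nonneg (by linarith) hI) hJ)
  -- The constant involves only the L¹ norm I of the kernel and its moment J of order βp. It is
  -- therefore uniform in the measure space, the family g and the scale c.
  lift (I ^ (p.toReal - 1) * J) ^ (1 / p.toReal) to ℝ≥0 using hAfin with A hA
  refine ⟨A, fun {X} _ {ν} _ g C c hc hg hM => ?_⟩
  have := eLpNorm_integral_mul_le hp hp' K.integrable.aestronglyMeasurable hg hM
  have e : ∫⁻ z, ‖K z‖ₑ * (C * ENNReal.ofReal ((c * ‖z‖) ^ β)) ^ p.toReal =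
      J * (C * ENNReal.ofReal (c ^ β)) ^ p.toReal := by
    rw [← lintegral_mul_const'']
    · refine lintegral_congr fun z => ?_
      rw [Real.mul_rpow hc (norm_nonneg _), ENNReal.ofReal_mul (by positivity), ← mul_assoc,
        ENNReal.mul_rpow_of_nonneg _ (ENNReal.ofReal _) h0.le,
        ENNReal.ofReal_rpow_of_nonneg (x := ‖z‖ ^ β) (by positivity) h0.le, ← Real.rpow_mul (norm_nonneg _)]
      ring
    · exact (K.continuous.aestronglyMeasurable.enorm).mul
        ((continuous_norm.rpow_const fun _ => Or.inr (by positivity)).measurable.ennreal_ofReal.aemeasurable)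
  rw [e, ← mul_assoc] at this
  rw [← ENNReal.rpow_le_rpow_iff h0, hA, mul_assoc, ENNReal.mul_rpow_of_nonneg _ _ h0.le,
    ← ENNReal.rpow_mul, one_div, inv_mul_cancel₀ h0.ne', ENNReal.rpow_one]
  exact this

/-- The `L^p` modulus of continuity of `f` under translations is at most `C |y|^β`. -/
def HasModulus {X : Type} [MeasurableSpace X] (ν : Measure X) (sh : E3 → X → X) (p : ℝ≥0∞) (β : ℝ)
    (C : ℝ≥0∞) (f : X → ℂ) : Prop :=
  ∀ y, eLpNorm (fun x => f (sh y x) - f x) p ν ≤ C * ENNReal.ofReal (‖y‖ ^ β)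

lemma IsShift.aestronglyMeasurable_sub {X : Type} [MeasurableSpace X] {ν : Measure X} [SFinite ν]
    {sh : E3 → X → X} (h : IsShift ν sh) {g : E3 → E3} (hg : Measurable g) {f : X → ℂ}
    (hf : AEStronglyMeasurable f ν) :
    AEStronglyMeasurable (fun q : E3 × X => f (sh (g q.1) q.2) - f q.2)
      ((volume : Measure E3).prod ν) :=
  (h.aestronglyMeasurable hg hf).sub hf.comp_snd

/-- Convolutions of increments. -/
lemma exists_modulus_bound (K : 𝓢(E3, ℂ)) {p : ℝ≥0∞} (hp : 1 ≤ p) (hp' : p ≠ ⊤) {β : ℝ}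
    (hβ : 0 ≤ β) :
    ∃ A : ℝ≥0, ∀ {X : Type} [MeasurableSpace X] {ν : Measure X} [SFinite ν] {sh : E3 → X → X}
      (_ : IsShift ν sh) {f : X → ℂ} {C : ℝ≥0∞} (c : ℝ), 0 ≤ c → AEStronglyMeasurable f ν →
      HasModulus ν sh p β C f →
      eLpNorm (fun x => ∫ z, K z * (f (sh (-(c • z)) x) - f x)) p ν ≤
        A * C * ENNReal.ofReal (c ^ β) := by
  obtain ⟨A, hA⟩ := exists_moment_bound K hp hp' hβ
  refine ⟨A, fun {X} _ {ν} _ {sh} h {f C} c hc hf hM => ?_⟩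
  refine hA (fun z x => f (sh (-(c • z)) x) - f x) C c hc
    (h.aestronglyMeasurable_sub (measurable_neg_smul c) hf) fun z => (hM _).trans_eq ?_
  rw [norm_neg, norm_smul, Real.norm_of_nonneg hc]

/-! ### Translates of kernels -/

/-- The fundamental theorem of calculus along the segment from z to z + w, followed by Tonelli and
translation invariance. The constant is the L¹ norm of the derivative of the kernel. -/
lemma lintegral_translate_sub_le (K : 𝓢(E3, ℂ)) :
    ∃ A : ℝ≥0, ∀ w : E3, ∫⁻ z, ‖K (z + w) - K z‖ₑ ≤ A * ENNReal.ofReal ‖w‖ := by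
  set K' : E3 → (E3 →L[ℝ] ℂ) := fderiv ℝ K
  have hK' : Continuous K' := K.smooth'.continuous_fderiv (by simp)
  have hfin : ∫⁻ z, ‖K' z‖ₑ ≠ ⊤ := ((SchwartzMap.fderivCLM ℝ E3 ℂ K).integrable).2.ne
  lift (∫⁻ z, ‖K' z‖ₑ) to ℝ≥0 using hfin with A hA
  refine ⟨A, fun w => ?_⟩
  have hd : ∀ z : E3, ∀ s : ℝ, HasDerivAt (fun s : ℝ => K (z + s • w)) (K' (z + s • w) w) s := by
    intro z s
    have h1 : HasFDerivAt K (K' (z + s • w)) (z + s • w) :=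
      (K.differentiableAt).hasFDerivAt
    have h2 : HasDerivAt (fun s : ℝ => z + s • w) w s := by
      simpa using ((hasDerivAt_id s).smul_const w).const_add z
    exact h1.comp_hasDerivAt s h2
  have key : ∀ z, ‖K (z + w) - K z‖ₑ ≤
      ∫⁻ s in Icc (0 : ℝ) 1, ‖K' (z + s • w)‖ₑ * ‖w‖ₑ := by
    intro z
    have hcont : Continuous fun s : ℝ => K' (z + s • w) w := by fun_prop
    have e : K (z + w) - K z = ∫ s in (0 : ℝ)..1, K' (z + s • w) w := by
      rw [intervalIntegral.integral_eq_sub_of_hasDerivAt (fun s _ => hd z s)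
        (hcont.intervalIntegrable _ _)]
      simp
    rw [e, intervalIntegral.integral_of_le zero_le_one]
    refine (enorm_integral_le_lintegral_enorm _).trans ?_
    refine (lintegral_mono fun s => ?_).trans (lintegral_mono_set Ioc_subset_Icc_self)
    rw [← ofReal_norm, ← ofReal_norm, ← ofReal_norm, ← ENNReal.ofReal_mul (norm_nonneg _)]
    exact ENNReal.ofReal_le_ofReal (ContinuousLinearMap.le_opNorm _ _)
  calc ∫⁻ z, ‖K (z + w) - K z‖ₑ
      ≤ ∫⁻ z, ∫⁻ s in Icc (0 : ℝ) 1, ‖K' (z + s • w)‖ₑ * ‖w‖ₑ := lintegral_mono key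
    _ = ∫⁻ s in Icc (0 : ℝ) 1, ∫⁻ z, ‖K' (z + s • w)‖ₑ * ‖w‖ₑ := by
        rw [lintegral_lintegral_swap]
        exact (by fun_prop : Continuous fun q : E3 × ℝ => ‖K' (q.1 + q.2 • w)‖ₑ).aemeasurable.mul_const _
    _ = ∫⁻ s in Icc (0 : ℝ) 1, A * ENNReal.ofReal ‖w‖ := by
        refine lintegral_congr fun s => ?_
        rw [lintegral_mul_const _ (by fun_prop), lintegral_add_right_eq_self (fun z => ‖K' z‖ₑ),
          hA, ofReal_norm]
    _ = A * ENNReal.ofReal ‖w‖ := by simp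

/-- Interpolation: for ‖w‖ ≤ 1 the Lipschitz bound suffices because ‖w‖ ≤ ‖w‖^β; for ‖w‖ ≥ 1 the
triangle inequality gives twice the L¹ norm of the kernel. -/
lemma lintegral_translate_sub_le_rpow (K : 𝓢(E3, ℂ)) {β : ℝ} (hβ : 0 ≤ β) (hβ1 : β ≤ 1) :
    ∃ A : ℝ≥0, ∀ w : E3, ∫⁻ z, ‖K (z + w) - K z‖ₑ ≤ A * ENNReal.ofReal (‖w‖ ^ β) := by
  obtain ⟨A, hA⟩ := lintegral_translate_sub_le K
  have hIfin : ∫⁻ z, ‖K z‖ₑ ≠ ⊤ := K.integrable.2.ne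
  lift (∫⁻ z, ‖K z‖ₑ) to ℝ≥0 using hIfin with I hI
  refine ⟨A + 2 * I, fun w => ?_⟩
  rcases le_total ‖w‖ 1 with h | h
  · refine (hA w).trans ?_
    gcongr
    · exact_mod_cast le_self_add
    · calc ‖w‖ = ‖w‖ ^ (1 : ℝ) := (Real.rpow_one _).symm
        _ ≤ ‖w‖ ^ β := by
          rcases (norm_nonneg w).eq_or_lt with h0 | h0
          · rw [← h0]; rw [Real.zero_rpow one_ne_zero]; positivity
          · exact Real.rpow_le_rpow_of_exponent_ge h0 h hβ1
  · calc ∫⁻ z, ‖K (z + w) - K z‖ₑ ≤ ∫⁻ z, (‖K (z + w)‖ₑ + ‖K z‖ₑ) :=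
          lintegral_mono fun z => enorm_sub_le
      _ = 2 * I := by
          rw [lintegral_add_right _ (by fun_prop),
            lintegral_add_right_eq_self (fun z => ‖K z‖ₑ), hI, two_mul]
      _ ≤ ↑(A + 2 * I) * ENNReal.ofReal (‖w‖ ^ β) := by
          refine le_trans ?_ (le_mul_of_one_le_right (zero_le) ?_)
          · push_cast; exact le_add_self
          · rw [← ENNReal.ofReal_one]
            exact ENNReal.ofReal_le_ofReal (Real.one_le_rpow h hβ)

lemma shift_shift (y z : E3) (x : T3) : shift y (shift z x) = shift (z + y) x := by
  simp [shift, toTorus_add, add_assoc]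

/-- The translation is moved from the function to the kernel, at rescaled length c⁻¹‖y‖. Applied to
a function reproduced by the kernel at scale c, this is a Bernstein inequality in Hölder form. -/
lemma exists_eLpNorm_shift_kconv_sub_le (K : 𝓢(E3, ℂ)) {p : ℝ≥0∞} (hp : 1 ≤ p) (hp' : p ≠ ⊤)
    {β : ℝ} (hβ : 0 ≤ β) (hβ1 : β ≤ 1) :
    ∃ A : ℝ≥0, ∀ (c : ℝ), 0 < c → ∀ f : T3 → ℂ, Integrable f torusVol → ∀ y : E3,
      eLpNorm (fun x => kconv K c f (shift y x) - kconv K c f x) p torusVol ≤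
        A * ENNReal.ofReal ((c⁻¹ * ‖y‖) ^ β) * eLpNorm f p torusVol := by
  obtain ⟨A, hA⟩ := lintegral_translate_sub_le_rpow K hβ hβ1
  refine ⟨A, fun c hc f hf y => ?_⟩
  have hKt : Integrable fun z => K (z + c⁻¹ • y) := K.integrable.comp_add_right _
  have hKd : Integrable fun z => K (z + c⁻¹ • y) - K z := hKt.sub K.integrable
  have e : (fun x => kconv K c f (shift y x) - kconv K c f x) =ᵐ[torusVol]
      fun x => ∫ z, (K (z + c⁻¹ • y) - K z) * f (shift (-(c • z)) x) := by
    filter_upwards [ae_integrable_kconv isShift_shift hKt c hf,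
      ae_integrable_kconv isShift_shift K.integrable c hf] with x h1 h2
    simp only [sub_mul]
    rw [integral_sub h1 h2]
    congr 1
    simp only [kconv]
    -- Substituting z + c⁻¹y for z cancels the translation by y in the argument of f.
    rw [← integral_add_right_eq_self _ (c⁻¹ • y)]
    refine integral_congr_ae (ae_of_all _ fun z => ?_)
    simp only [shift_shift, smul_add, smul_smul, mul_inv_cancel₀ hc.ne', one_smul]
    congr 3; abel
  rw [eLpNorm_congr_ae e]
  refine (eLpNorm_kconv_le isShift_shift hKd c hf.aestronglyMeasurable hp hp').trans ?_
  gcongr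
  refine (hA _).trans_eq ?_
  rw [norm_smul, Real.norm_of_nonneg (inv_nonneg.2 hc.le)]

/-- Convolution commutes with translations, so increments pass through it. This carries the modulus
of a single block over to its truncation. -/
lemma eLpNorm_kconv_sub_shift_le (K : 𝓢(E3, ℂ)) {p : ℝ≥0∞} (hp : 1 ≤ p) (hp' : p ≠ ⊤)
    (c : ℝ) {f : T3 → ℂ} (hf : Integrable f torusVol) (y : E3) :
    eLpNorm (fun x => kconv K c f (shift y x) - kconv K c f x) p torusVol ≤
      (∫⁻ z, ‖K z‖ₑ) * eLpNorm (fun x => f (shift y x) - f x) p torusVol := by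
  have hfy : Integrable (fun x => f (shift y x)) torusVol :=
    (measurePreserving_shift y).integrable_comp_of_integrable hf
  have e : (fun x => kconv K c f (shift y x) - kconv K c f x) =ᵐ[torusVol]
      kconv K c fun x => f (shift y x) - f x := by
    filter_upwards [kconv_sub_ae K.integrable c hfy hf] with x hx
    rw [hx]
    congr 1
    simp only [kconv, shift_shift, add_comm]
  rw [eLpNorm_congr_ae e]
  exact eLpNorm_kconv_le isShift_shift K.integrable c (hfy.sub hf).aestronglyMeasurable hp hp'

/-! ### From Littlewood-Paley blocks to increments -/

lemma multiplier_eq_trigPoly {m : E3 → ℝ} {R : ℝ} (hm : ∀ ξ, m ξ ≠ 0 → ‖ξ‖ ≤ R) (f : T3 → ℝ) :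
    multiplier m f = trigPoly (modes R) fun k => (m (freq k) : ℂ) * coeff f k := by
  funext x
  refine tsum_eq_sum fun k hk => ?_
  have : m (freq k) = 0 := by
    by_contra h
    exact hk (mem_modes.2 (hm _ h))
  simp [this]

/-- Reproducing formula: `chi` equals one on the rescaled spectrum. Littlewood–Paley blocks can thus
be written as convolutions, to which the translation estimates for kernels apply. -/
lemma kconv_chiK_eq_self {R : ℝ} (hR : 0 < R) (a : (Fin 3 → ℤ) → ℂ) (x : T3) :
    kconv chiK R⁻¹ (trigPoly (modes R) a) x = trigPoly (modes R) a x := by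
  rw [kconv_trigPoly chiK.integrable]
  refine Finset.sum_congr rfl fun k hk => ?_
  dsimp only
  rw [fourier_chiK, chi_eq_one, one_mul]
  rw [norm_smul, Real.norm_of_nonneg (inv_nonneg.2 hR.le), inv_mul_le_iff₀ hR, mul_one]
  exact mem_modes.1 hk

/-- A bound on the frequencies occurring in a dyadic partition of unity. -/
lemma IsDyadicPartition.exists_bound {ρ : E3 → ℝ} (hρ : IsDyadicPartition ρ) :
    ∃ R : ℝ, 0 < R ∧ (∀ ξ, lowCutoff ρ ξ ≠ 0 → ‖ξ‖ ≤ R) ∧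
      ∀ (j : ℕ) (ξ : E3), ρ (((2 : ℝ) ^ j)⁻¹ • ξ) ≠ 0 → ‖ξ‖ ≤ 2 ^ j * R := by
  obtain ⟨r, R, hr, h⟩ := hρ.annulus
  obtain ⟨R', hR'⟩ := hρ.low.isCompact.isBounded.exists_norm_le
  refine ⟨max 1 (max R R'), by positivity, fun ξ hξ => ?_, fun j ξ hξ => ?_⟩
  · exact (hR' ξ (subset_tsupport _ hξ)).trans ((le_max_right _ _).trans (le_max_right _ _))
  · have h1 := (h _ hξ).2
    rw [norm_smul, norm_inv, norm_pow, Real.norm_ofNat, inv_mul_le_iff₀ (by positivity)] at h1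
    refine h1.trans ?_
    gcongr
    exact (le_max_left _ _).trans (le_max_right _ _)

/-- On a finite set of frequencies finitely many blocks sum up to one. -/
lemma IsDyadicPartition.exists_sum_eq_one {ρ : E3 → ℝ} (hρ : IsDyadicPartition ρ)
    (F : Finset (Fin 3 → ℤ)) :
    ∃ J : ℕ, ∀ k ∈ F, lowCutoff ρ (freq k) +
      ∑ j ∈ Finset.range J, ρ (((2 : ℝ) ^ j)⁻¹ • freq k) = 1 := by
  obtain ⟨r, R, hr, h⟩ := hρ.annulus
  have : ∀ᶠ J : ℕ in atTop, ∀ k ∈ F, lowCutoff ρ (freq k) +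
      ∑ j ∈ Finset.range J, ρ (((2 : ℝ) ^ j)⁻¹ • freq k) = 1 := by
    rw [Filter.eventually_all_finset]
    intro k _
    have ht : Tendsto (fun j : ℕ => ((2 : ℝ) ^ j)⁻¹ * ‖freq k‖) atTop (𝓝 0) := by
      have := (tendsto_inv_atTop_zero.comp
        (tendsto_pow_atTop_atTop_of_one_lt (one_lt_two (α := ℝ)))).mul_const ‖freq k‖
      simpa using this
    obtain ⟨N, hN⟩ := eventually_atTop.1 (ht.eventually_lt_const hr)
    filter_upwards [eventually_ge_atTop N] with J hJ
    rw [lowCutoff, tsum_eq_sum (s := Finset.range J)]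
    · ring
    · intro j hj
      by_contra h0
      have h1 := (h _ h0).1
      rw [norm_smul, norm_inv, norm_pow, Real.norm_ofNat] at h1
      exact absurd (hN j (hJ.trans (by simpa using hj))) (not_lt.2 h1)
  exact this.exists

/-- A truncation sees finitely many frequencies, on which finitely many blocks already sum to one,
so no convergence of the Littlewood–Paley series is needed. The number J depends on c, which is
harmless because the block estimates sum to a bound independent of J. -/
lemma lowPass_eq_sum_block {ρ : E3 → ℝ} (hρ : IsDyadicPartition ρ) {c : ℝ} (f : T3 → ℝ) :
    ∃ J : ℕ, ∀ x, lowPass c (fun x => (f x : ℂ)) x =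
      lowPass c (blockLow ρ f) x + ∑ j ∈ Finset.range J, lowPass c (block ρ j f) x := by
  obtain ⟨R, hR, hlow, hblock⟩ := hρ.exists_bound
  obtain ⟨J, hJ⟩ := hρ.exists_sum_eq_one (modes (2 / c))
  refine ⟨J, fun x => ?_⟩
  simp only [lowPass, trigOp, trigPoly]
  rw [Finset.sum_comm, ← Finset.sum_add_distrib]
  refine Finset.sum_congr rfl fun k hk => ?_
  rw [blockLow, multiplier_eq_trigPoly hlow, fc_trigPoly]
  have e1 : (if k ∈ modes R then (lowCutoff ρ (freq k) : ℂ) * coeff f k else 0) =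
      (lowCutoff ρ (freq k) : ℂ) * coeff f k := by
    split_ifs with h
    · rfl
    · have : lowCutoff ρ (freq k) = 0 := by
        by_contra h0; exact h (mem_modes.2 (hlow _ h0))
      simp [this]
  have e2 : ∀ j, fc (block ρ j f) k = (ρ (((2 : ℝ) ^ j)⁻¹ • freq k) : ℂ) * coeff f k := by
    intro j
    rw [block, multiplier_eq_trigPoly (hblock j), fc_trigPoly]
    split_ifs with h
    · rfl
    · have : ρ (((2 : ℝ) ^ j)⁻¹ • freq k) = 0 := by
        by_contra h0; exact h (mem_modes.2 (hblock j _ h0))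
      simp [this]
  simp only [e1, e2]
  rw [← Finset.sum_mul, ← Finset.mul_sum, ← Finset.sum_mul, ← add_mul, ← mul_add, ← add_mul]
  have := hJ k hk
  have h1 : (lowCutoff ρ (freq k) : ℂ) +
      ∑ j ∈ Finset.range J, (ρ (((2 : ℝ) ^ j)⁻¹ • freq k) : ℂ) = 1 := by
    rw [← Complex.ofReal_sum, ← Complex.ofReal_add, this, Complex.ofReal_one]
  rw [h1, one_mul, coeff_eq_fc]

lemma eLpNorm_block_le {ρ : E3 → ℝ} {α : ℝ} {p : ℝ≥0∞} {f : T3 → ℝ} (j : ℕ) :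
    eLpNorm (block ρ j f) p torusVol ≤
      ENNReal.ofReal (2 ^ (-(α * j))) * besovNorm ρ α p f := by
  have h1 : ENNReal.ofReal ((2 : ℝ) ^ (α * j)) * eLpNorm (block ρ j f) p torusVol ≤
      besovNorm ρ α p f :=
    (le_iSup (fun j : ℕ => ENNReal.ofReal ((2 : ℝ) ^ (α * j)) *
      eLpNorm (block ρ j f) p torusVol) j).trans le_add_self
  calc eLpNorm (block ρ j f) p torusVol
      = ENNReal.ofReal (2 ^ (-(α * j))) *
          (ENNReal.ofReal ((2 : ℝ) ^ (α * j)) * eLpNorm (block ρ j f) p torusVol) := by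
        rw [← mul_assoc, ← ENNReal.ofReal_mul (by positivity), ← Real.rpow_add two_pos]
        simp
    _ ≤ _ := by gcongr

lemma sum_geometric_le {δ : ℝ} (hδ : 0 < δ) (J : ℕ) :
    ∑ j ∈ Finset.range J, ENNReal.ofReal ((2 : ℝ) ^ (-(δ * j))) ≤
      ENNReal.ofReal (1 - 2 ^ (-δ))⁻¹ := by
  have h0 : (0 : ℝ) ≤ 2 ^ (-δ) := by positivity
  have h1 : (2 : ℝ) ^ (-δ) < 1 := Real.rpow_lt_one_of_one_lt_of_neg one_lt_two (by linarith)
  rw [← ENNReal.ofReal_sum_of_nonneg (fun _ _ => by positivity)]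
  refine ENNReal.ofReal_le_ofReal ?_
  have : ∀ j : ℕ, (2 : ℝ) ^ (-(δ * j)) = ((2 : ℝ) ^ (-δ)) ^ j := fun j => by
    rw [← Real.rpow_natCast, ← Real.rpow_mul two_pos.le]; ring_nf
  simp only [this]
  rw [← tsum_geometric_of_lt_one h0 h1]
  exact (summable_geometric_of_lt_one h0 h1).sum_le_tsum _ (fun _ _ => by positivity)

/-- Translation estimates for functions in a Besov space. -/
lemma exists_besov_bound {ρ : E3 → ℝ} (hρ : IsDyadicPartition ρ) {α β : ℝ} (hβ : 0 < β)
    (hβα : β < α) (hβ1 : β ≤ 1) {p : ℝ≥0∞} (hp : 1 ≤ p) (hp' : p ≠ ⊤) :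
    ∃ A : ℝ≥0, ∀ f : T3 → ℝ, Integrable f torusVol →
      eLpNorm (fun x => (f x : ℂ)) p torusVol ≤ A * besovNorm ρ α p f ∧
      HasModulus torusVol shift p β (A * besovNorm ρ α p f) fun x => (f x : ℂ) := by
  obtain ⟨R, hR, hlow, hblock⟩ := hρ.exists_bound
  obtain ⟨B, hB⟩ := exists_eLpNorm_shift_kconv_sub_le chiK hp hp' hβ.le hβ1
  have hIfin : ∫⁻ z, ‖chiK z‖ₑ ≠ ⊤ := chiK.integrable.2.ne
  set I := (∫⁻ z, ‖chiK z‖ₑ).toNNReal with hIdef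
  have hI : ∫⁻ z, ‖chiK z‖ₑ = I := (ENNReal.coe_toNNReal hIfin).symm
  -- Sums of the geometric series of 2^(-αj), for the norm, and of 2^(-(α-β)j), for the increments.
  -- The second one is where β < α is needed.
  set S₁ := (1 - (2 : ℝ) ^ (-α))⁻¹.toNNReal
  set S₂ := (1 - (2 : ℝ) ^ (-(α - β)))⁻¹.toNNReal
  set A₁ := I * (1 + S₁)
  set A₂ := I * (B * (R ^ β).toNNReal * (1 + S₂))
  refine ⟨A₁ + A₂, fun f hf => ?_⟩
  set N := besovNorm ρ α p f
  set fC : T3 → ℂ := fun x => (f x : ℂ)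
  have hfC : Integrable fC torusVol := hf.ofReal
  have hlowN : eLpNorm (blockLow ρ f) p torusVol ≤ N := le_self_add
  have hblockN : ∀ j : ℕ, eLpNorm (block ρ j f) p torusVol ≤
    ENNReal.ofReal (2 ^ (-(α * j))) * N := fun j => eLpNorm_block_le j
  have htl : blockLow ρ f = trigPoly (modes R) fun k => (lowCutoff ρ (freq k) : ℂ) * coeff f k :=
    multiplier_eq_trigPoly hlow f
  have htb : ∀ j, block ρ j f = trigPoly (modes (2 ^ j * R))
      fun k => (ρ (((2 : ℝ) ^ j)⁻¹ • freq k) : ℂ) * coeff f k :=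
    fun j => multiplier_eq_trigPoly (hblock j) f
  have hil : Integrable (blockLow ρ f) torusVol := by rw [htl]; exact integrable_trigPoly _ _
  have hib : ∀ j, Integrable (block ρ j f) torusVol := fun j => by
    rw [htb]; exact integrable_trigPoly _ _
  -- Bernstein's inequality: for spectrum in the ball of radius r, an increment by y costs the
  -- factor (r‖y‖)^β.
  have hB' : ∀ (r : ℝ) (a : (Fin 3 → ℤ) → ℂ) (y : E3), 0 < r →
      eLpNorm (fun x => trigPoly (modes r) a (shift y x) - trigPoly (modes r) a x) p torusVol ≤
        B * ENNReal.ofReal ((r * ‖y‖) ^ β) * eLpNorm (trigPoly (modes r) a) p torusVol := by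
    intro r a y hr
    have := hB r⁻¹ (inv_pos.2 hr) _ (integrable_trigPoly (modes r) a) y
    simpa only [kconv_chiK_eq_self hr, inv_inv] using this
  set c : ℕ → ℝ := fun n => 1 / ((n : ℝ) + 1)
  have hc : ∀ n, 0 < c n := fun n => by positivity
  -- As f is merely integrable, its truncations are known to converge in L¹ only; this suffices,
  -- since the L^p bounds are lower semicontinuous under such convergence.
  have hlim : Tendsto (fun n => eLpNorm (fun x => lowPass (c n) fC x - fC x) 1 torusVol)
      atTop (𝓝 0) := by
    have := tendsto_kconv_sub chiK.integrable (fun ξ hξ => by rw [fourier_chiK, chi_eq_one hξ])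
      tendsto_one_div_add_atTop_nhds_zero_nat hfC
    refine this.congr fun n => eLpNorm_congr_ae ?_
    filter_upwards [kconv_chiK_ae_eq (hc n) hfC] with x hx
    rw [← hx]
  have hmeas : ∀ (n : ℕ) (g : T3 → ℂ), AEStronglyMeasurable (lowPass (c n) g) torusVol :=
    fun n g => (continuous_trigPoly _ _).aestronglyMeasurable
  -- one block
  have hLP : ∀ n (g : T3 → ℂ), Integrable g torusVol →
      eLpNorm (lowPass (c n) g) p torusVol ≤ I * eLpNorm g p torusVol := by
    intro n g hg
    rw [← eLpNorm_congr_ae (kconv_chiK_ae_eq (hc n) hg), ← hI]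
    exact eLpNorm_kconv_le isShift_shift chiK.integrable _ hg.aestronglyMeasurable hp hp'
  have hLPy : ∀ n (g : T3 → ℂ) (y : E3), Integrable g torusVol →
      eLpNorm (fun x => lowPass (c n) g (shift y x) - lowPass (c n) g x) p torusVol ≤
        I * eLpNorm (fun x => g (shift y x) - g x) p torusVol := by
    intro n g y hg
    have h1 := kconv_chiK_ae_eq (hc n) hg
    have h2 := (measurePreserving_shift y).quasiMeasurePreserving.ae_eq_comp h1
    have : (fun x => lowPass (c n) g (shift y x) - lowPass (c n) g x) =ᵐ[torusVol]
        fun x => kconv chiK (c n) g (shift y x) - kconv chiK (c n) g x := by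
      filter_upwards [h1, h2] with x h1 h2
      simp only [Function.comp_apply] at h2
      rw [h1, h2]
    rw [eLpNorm_congr_ae this, ← hI]
    exact eLpNorm_kconv_sub_shift_le chiK hp hp' _ hg y
  constructor
  · refine eLpNorm_le_of_tendsto_eLpNorm_one (fun n => hmeas n fC) hfC.aestronglyMeasurable hlim
      fun n => ?_
    obtain ⟨J, hJ⟩ := lowPass_eq_sum_block hρ (c := c n) f
    have e : lowPass (c n) fC = lowPass (c n) (blockLow ρ f) +
        ∑ j ∈ Finset.range J, lowPass (c n) (block ρ j f) := by
      funext x; simp only [Pi.add_apply, Finset.sum_apply]; exact hJ x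
    rw [e]
    refine (eLpNorm_add_le (hmeas _ _)
      (Finset.aestronglyMeasurable_sum _ fun j _ => hmeas _ _) hp).trans ?_
    calc _ ≤ I * N + ∑ j ∈ Finset.range J, I * (ENNReal.ofReal (2 ^ (-(α * j))) * N) := by
          refine add_le_add ((hLP _ _ hil).trans (by gcongr)) ?_
          refine (eLpNorm_sum_le (fun j _ => hmeas _ _) hp).trans ?_
          gcongr with j _
          exact (hLP _ _ (hib j)).trans (by gcongr; exact hblockN j)
      _ = I * (1 + ∑ j ∈ Finset.range J, ENNReal.ofReal (2 ^ (-(α * j)))) * N := by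
          rw [← Finset.mul_sum, ← Finset.sum_mul]; ring
      _ ≤ I * (1 + S₁) * N := by
          gcongr
          exact sum_geometric_le (hβ.trans hβα) J
      _ ≤ ↑(A₁ + A₂) * N := by
          gcongr
          simp only [A₁]; push_cast; exact le_self_add
  · intro y
    have hmeasy : ∀ (n : ℕ) (g : T3 → ℂ), AEStronglyMeasurable
        (fun x => lowPass (c n) g (shift y x) - lowPass (c n) g x) torusVol := fun n g =>
      ((hmeas n g).comp_measurePreserving (measurePreserving_shift y)).sub (hmeas n g)
    have hfy : Integrable (fun x => fC (shift y x)) torusVol :=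
      (measurePreserving_shift y).integrable_comp_of_integrable hfC
    have hfd : AEStronglyMeasurable (fun x => fC (shift y x) - fC x) torusVol :=
      (hfy.sub hfC).aestronglyMeasurable
    refine eLpNorm_le_of_tendsto_eLpNorm_one (fun n => hmeasy n fC) hfd ?_ fun n => ?_
    · have h2 := hlim.add hlim
      rw [add_zero] at h2
      refine tendsto_of_tendsto_of_tendsto_of_le_of_le tendsto_const_nhds h2
        (fun _ => zero_le) fun n => ?_
      have hd : AEStronglyMeasurable (fun x => lowPass (c n) fC x - fC x) torusVol :=
        (hmeas n fC).sub hfC.aestronglyMeasurable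
      have hdy := hd.comp_measurePreserving (measurePreserving_shift y)
      have e : (fun x => lowPass (c n) fC (shift y x) - lowPass (c n) fC x -
            (fC (shift y x) - fC x)) =
          ((fun x => lowPass (c n) fC x - fC x) ∘ shift y) -
            fun x => lowPass (c n) fC x - fC x := by
        funext x; simp only [Pi.sub_apply, Function.comp_apply]; ring
      rw [e]
      refine (eLpNorm_sub_le hdy hd le_rfl).trans_eq ?_
      rw [eLpNorm_comp_measurePreserving hd (measurePreserving_shift y)]
    · obtain ⟨J, hJ⟩ := lowPass_eq_sum_block hρ (c := c n) f
      have e : (fun x => lowPass (c n) fC (shift y x) - lowPass (c n) fC x) =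
          (fun x => lowPass (c n) (blockLow ρ f) (shift y x) - lowPass (c n) (blockLow ρ f) x) +
          ∑ j ∈ Finset.range J,
            fun x => lowPass (c n) (block ρ j f) (shift y x) - lowPass (c n) (block ρ j f) x := by
        funext x
        simp only [Pi.add_apply, Finset.sum_apply, fC, hJ, Finset.sum_sub_distrib]
        ring
      rw [e]
      refine (eLpNorm_add_le (hmeasy _ _)
        (Finset.aestronglyMeasurable_sum _ fun j _ => hmeasy _ _) hp).trans ?_
      -- Block j has frequencies of size at most 2^j R and norm at most 2^(-αj) N, so its increment
      -- is of order 2^(-(α-β)j) ‖y‖^β N; the factor I is the cost of the truncation.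
      calc _ ≤ I * (B * ENNReal.ofReal ((R * ‖y‖) ^ β) * N) + ∑ j ∈ Finset.range J,
            I * (B * ENNReal.ofReal ((2 ^ j * R * ‖y‖) ^ β) *
              (ENNReal.ofReal (2 ^ (-(α * j))) * N)) := by
            refine add_le_add ((hLPy _ _ y hil).trans ?_) ?_
            · gcongr
              refine le_trans ?_ (mul_le_mul_right hlowN _)
              have := hB' R (fun k => (lowCutoff ρ (freq k) : ℂ) * coeff f k) y hR
              rwa [← htl] at this
            · refine (eLpNorm_sum_le (fun j _ => hmeasy _ _) hp).trans ?_
              gcongr with j _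
              refine (hLPy _ _ y (hib j)).trans ?_
              gcongr
              refine le_trans ?_ (mul_le_mul_right (hblockN j) _)
              have := hB' (2 ^ j * R)
                (fun k => (ρ (((2 : ℝ) ^ j)⁻¹ • freq k) : ℂ) * coeff f k) y (by positivity)
              rwa [← htb] at this
        _ = I * (B * ENNReal.ofReal (R ^ β) *
              (1 + ∑ j ∈ Finset.range J, ENNReal.ofReal (2 ^ (-((α - β) * j))))) * N *
              ENNReal.ofReal (‖y‖ ^ β) := by
            have e1 : ∀ j : ℕ, ENNReal.ofReal ((2 ^ j * R * ‖y‖) ^ β) *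
                ENNReal.ofReal (2 ^ (-(α * j))) = ENNReal.ofReal (R ^ β) *
                  ENNReal.ofReal (2 ^ (-((α - β) * j))) * ENNReal.ofReal (‖y‖ ^ β) := by
              intro j
              rw [← ENNReal.ofReal_mul (by positivity), ← ENNReal.ofReal_mul (by positivity),
                ← ENNReal.ofReal_mul (by positivity)]
              congr 1
              rw [Real.mul_rpow (by positivity) (by positivity),
                Real.mul_rpow (by positivity) (by positivity), ← Real.rpow_natCast,
                ← Real.rpow_mul two_pos.le,
                show -((α - β) * (j : ℝ)) = (j * β) + (-(α * j)) by ring,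
                Real.rpow_add two_pos]
              ring
            have e2 : ENNReal.ofReal ((R * ‖y‖) ^ β) =
                ENNReal.ofReal (R ^ β) * ENNReal.ofReal (‖y‖ ^ β) := by
              rw [← ENNReal.ofReal_mul (by positivity), Real.mul_rpow hR.le (by positivity)]
            have e3 : ∀ j : ℕ, I * (B * ENNReal.ofReal ((2 ^ j * R * ‖y‖) ^ β) *
              (ENNReal.ofReal (2 ^ (-(α * j))) * N)) =
                I * B * N * ENNReal.ofReal (R ^ β) * ENNReal.ofReal (‖y‖ ^ β) *
                  ENNReal.ofReal (2 ^ (-((α - β) * j))) := by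
              intro j
              calc _ = I * B * N * (ENNReal.ofReal ((2 ^ j * R * ‖y‖) ^ β) *
                ENNReal.ofReal (2 ^ (-(α * j)))) := by ring
                _ = _ := by rw [e1]; ring
            simp only [e2, e3]
            rw [← Finset.mul_sum]; ring
        _ ≤ I * (B * ENNReal.ofReal (R ^ β) * (1 + S₂)) * N * ENNReal.ofReal (‖y‖ ^ β) := by
            gcongr
            exact sum_geometric_le (by linarith) J
        _ ≤ ↑(A₁ + A₂) * N * ENNReal.ofReal (‖y‖ ^ β) := by
            gcongr
            simp only [A₂]; push_cast; exact le_add_self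

/-! ### Space-time increments of a velocity field -/

lemma eLpNorm_spaceTime_rpow {F : Type*} [NormedAddCommGroup F] {T : ℝ} {p : ℝ≥0∞} (hp : 1 ≤ p)
    (hp' : p ≠ ⊤) {g : ℝ × T3 → F} (hg : AEStronglyMeasurable g (spaceTime T)) :
    eLpNorm g p (spaceTime T) ^ p.toReal =
      ∫⁻ t in Ioo 0 T, eLpNorm (fun x => g (t, x)) p torusVol ^ p.toReal := by
  rw [eLpNorm_rpow_eq hp hp', lintegral_prod _ (hg.enorm.pow_const _)]
  simp only [eLpNorm_rpow_eq hp hp']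

/-- No measurability in time is asked of the majorant N, which will be a Besov norm of the time
slices. The finiteness of A is what allows it to leave the integral. -/
lemma eLpNorm_spaceTime_le {F : Type*} [NormedAddCommGroup F] {T : ℝ} {p : ℝ≥0∞} (hp : 1 ≤ p)
    (hp' : p ≠ ⊤) {g : ℝ × T3 → F} (hg : AEStronglyMeasurable g (spaceTime T))
    {N : ℝ → ℝ≥0∞} {A : ℝ≥0∞} (hA : A ≠ ⊤)
    (h : ∀ᵐ t ∂(volume : Measure ℝ).restrict (Ioo 0 T),
      eLpNorm (fun x => g (t, x)) p torusVol ≤ A * N t) :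
    eLpNorm g p (spaceTime T) ≤ A * (∫⁻ t in Ioo 0 T, N t ^ p.toReal) ^ (1 / p.toReal) := by
  have h1 := one_le_toReal hp hp'
  have h0 : 0 < p.toReal := by linarith
  rw [← ENNReal.rpow_le_rpow_iff h0, eLpNorm_spaceTime_rpow hp hp' hg,
    ENNReal.mul_rpow_of_nonneg _ _ h0.le, ← ENNReal.rpow_mul, one_div, inv_mul_cancel₀ h0.ne',
    ENNReal.rpow_one, ← lintegral_const_mul' _ _ (ENNReal.rpow_ne_top_of_nonneg h0.le hA)]
  refine lintegral_mono_ae (h.mono fun t ht => ?_)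
  rw [← ENNReal.mul_rpow_of_nonneg _ _ h0.le]
  exact ENNReal.rpow_le_rpow ht h0.le

/-- The components of a velocity field as complex functions on space-time. -/
def comp (u : ℝ → T3 → E3) (i : Fin 3) (p : ℝ × T3) : ℂ := (u p.1 p.2 i : ℂ)

lemma aestronglyMeasurable_comp {μ : Measure (ℝ × T3)} {u : ℝ → T3 → E3}
    (hu : AEStronglyMeasurable (fun p : ℝ × T3 => u p.1 p.2) μ) (i : Fin 3) :
    AEStronglyMeasurable (comp u i) μ := by
  have : Continuous fun v : E3 => ((v i : ℝ) : ℂ) := by fun_prop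
  exact this.comp_aestronglyMeasurable hu

/-- The only place where the Besov norm is used: the slice estimates are cubed and integrated in
time. The rest of the argument sees just the resulting modulus. -/
lemma MemL3Besov.exists_modulus {ρ : E3 → ℝ} (hρ : IsDyadicPartition ρ) {α T : ℝ}
    (hα : 1 / 3 < α) {u : ℝ → T3 → E3} (hB : MemL3Besov ρ α T u) :
    ∃ (β : ℝ) (C : ℝ≥0), 1 / 3 < β ∧ β ≤ 1 ∧ ∀ i, MemLp (comp u i) 3 (spaceTime T) ∧
      HasModulus (spaceTime T) stShift 3 β C (comp u i) := by
  -- β < α makes the sum over blocks converge, and β ≤ 1 allows the Lipschitz bound for kernels to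
  -- be weakened to an exponent β.
  obtain ⟨β, hβ1, hβ2⟩ := exists_between (lt_min hα (by norm_num : (1 / 3 : ℝ) < 1))
  have h3 : (1 : ℝ≥0∞) ≤ 3 := by norm_num
  have h3' : (3 : ℝ≥0∞) ≠ ⊤ := by norm_num
  obtain ⟨A, hA⟩ := exists_besov_bound hρ (α := α) (β := β) (by linarith)
    (hβ2.trans_le (min_le_left _ _)) (hβ2.le.trans (min_le_right _ _)) h3 h3'
  set N : Fin 3 → ℝ → ℝ≥0∞ := fun i t => besovNorm ρ α 3 (fun x => u t x i)
  set Q : Fin 3 → ℝ≥0∞ := fun i => (∫⁻ t in Ioo 0 T, N i t ^ (3 : ℝ≥0∞).toReal) ^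
    (1 / (3 : ℝ≥0∞).toReal)
  have hQ : ∀ i, Q i ≠ ⊤ := fun i => by
    refine ENNReal.rpow_ne_top_of_nonneg (by positivity) ?_
    have := hB.finite i
    have e3 : (3 : ℝ≥0∞).toReal = ((3 : ℕ) : ℝ) := by simp
    simp only [e3, ENNReal.rpow_natCast]
    exact this.ne
  have hint : ∀ i, ∀ᵐ t ∂(volume : Measure ℝ).restrict (Ioo 0 T),
      Integrable (fun x => u t x i) torusVol := fun i =>
    hB.integrable.mono fun t ht => (EuclideanSpace.proj (𝕜 := ℝ) i).integrable_comp ht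
  have hm : ∀ i, AEStronglyMeasurable (comp u i) (spaceTime T) :=
    aestronglyMeasurable_comp hB.meas
  refine ⟨β, A * ∑ i, (Q i).toNNReal, hβ1, hβ2.le.trans (min_le_right _ _), fun i => ⟨⟨hm i, ?_⟩,
    fun y => ?_⟩⟩
  · refine (eLpNorm_spaceTime_le h3 h3' (hm i) (N := N i) (A := A) ENNReal.coe_ne_top ?_).trans_lt
      (ENNReal.mul_lt_top ENNReal.coe_lt_top (hQ i).lt_top)
    filter_upwards [hint i] with t ht
    exact (hA _ ht).1
  · have hmy : AEStronglyMeasurable (fun p => comp u i (stShift y p) - comp u i p)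
        (spaceTime T) :=
      ((hm i).comp_measurePreserving (measurePreserving_stShift T y)).sub (hm i)
    have := eLpNorm_spaceTime_le h3 h3' hmy (N := N i)
      (A := A * ENNReal.ofReal (‖y‖ ^ β)) (ENNReal.mul_ne_top ENNReal.coe_ne_top (by simp)) (by
        filter_upwards [hint i] with t ht
        refine ((hA _ ht).2 y).trans_eq ?_
        ring)
    refine this.trans ?_
    have e : Q i ≤ ((∑ i, (Q i).toNNReal : ℝ≥0) : ℝ≥0∞) := by
      rw [← ENNReal.coe_toNNReal (hQ i)]
      exact_mod_cast Finset.single_le_sum (f := fun i => (Q i).toNNReal)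
        (fun _ _ => zero_le) (Finset.mem_univ i)
    calc _ = A * Q i * ENNReal.ofReal (‖y‖ ^ β) := by simp only [Q]; ring
      _ ≤ _ := by push_cast; gcongr; exact_mod_cast e

/-! ### The mollified defect -/

lemma norm_gradient_eq (f : E3 → ℝ) (x : E3) : ‖gradient f x‖ = ‖fderiv ℝ f x‖ :=
  LinearIsometryEquiv.norm_map _ _

lemma continuous_gradient {f : E3 → ℝ} (hf : ContDiff ℝ ∞ f) : Continuous (gradient f) :=
  (LinearIsometryEquiv.continuous _).comp (hf.continuous_fderiv (by simp))

lemma contDiff_rescale {φ : E3 → ℝ} (hφ : ContDiff ℝ ∞ φ) (ε : ℝ) :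
    ContDiff ℝ ∞ (rescale φ ε) := by
  unfold rescale
  exact contDiff_const.mul (hφ.comp (contDiff_const_smul _))

lemma fderiv_rescale {φ : E3 → ℝ} (hφ : ContDiff ℝ ∞ φ) (ε : ℝ) (ξ : E3) :
    fderiv ℝ (rescale φ ε) ξ = ((ε ^ 3)⁻¹ * ε⁻¹) • fderiv ℝ φ (ε⁻¹ • ξ) := by
  have h : DifferentiableAt ℝ (fun x : E3 => φ (ε⁻¹ • x)) ξ :=
    ((hφ.comp (contDiff_const_smul ε⁻¹)).differentiable (by simp)) ξ
  have e : rescale φ ε = fun x => (ε ^ 3)⁻¹ • φ (ε⁻¹ • x) := rfl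
  rw [e, fderiv_fun_const_smul h, fderiv_comp_smul, smul_smul]

/-- Scaling: ∇φ^ε(ξ) = ε⁻⁴ (∇φ)(ξ/ε), the volume element contributes ε³ and the weight ε^r, which
makes ε^(r-1) in total. -/
lemma lintegral_gradient_rescale {φ : E3 → ℝ} (hφ : ContDiff ℝ ∞ φ) {ε : ℝ} (hε : 0 < ε)
    {r : ℝ} :
    ∫⁻ ξ, ‖gradient (rescale φ ε) ξ‖ₑ * ENNReal.ofReal (‖ξ‖ ^ r) =
      ENNReal.ofReal (ε ^ (r - 1)) * ∫⁻ ξ, ‖fderiv ℝ φ ξ‖ₑ * ENNReal.ofReal (‖ξ‖ ^ r) := by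
  set f : E3 → ℝ≥0∞ := fun ξ => ‖fderiv ℝ φ ξ‖ₑ * ENNReal.ofReal (‖ξ‖ ^ r)
  have hf : Measurable f := by
    have h1 : Measurable fun ξ : E3 => ‖fderiv ℝ φ ξ‖ₑ :=
      (hφ.continuous_fderiv (by simp)).measurable.enorm
    have h2 : Measurable fun ξ : E3 => ENNReal.ofReal (‖ξ‖ ^ r) :=
      (measurable_norm.pow_const r).ennreal_ofReal
    exact h1.mul h2
  have e1 : ∀ ξ : E3, ‖gradient (rescale φ ε) ξ‖ₑ * ENNReal.ofReal (‖ξ‖ ^ r) =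
      ENNReal.ofReal ((ε ^ 3)⁻¹ * ε⁻¹ * ε ^ r) * f (ε⁻¹ • ξ) := by
    intro ξ
    rw [← ofReal_norm, norm_gradient_eq, fderiv_rescale hφ]
    simp only [f]
    rw [norm_smul, Real.norm_of_nonneg (by positivity), ← ofReal_norm,
      ← ENNReal.ofReal_mul (by positivity), ← ENNReal.ofReal_mul (by positivity),
      ← ENNReal.ofReal_mul (by positivity), norm_smul, Real.norm_of_nonneg (by positivity),
      Real.mul_rpow (by positivity) (by positivity), Real.inv_rpow hε.le]
    have : ε ^ r ≠ 0 := (Real.rpow_pos_of_pos hε r).ne'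
    congr 1
    field_simp
  have e2 : ∫⁻ ξ : E3, f (ε⁻¹ • ξ) = ENNReal.ofReal (ε ^ 3) * ∫⁻ ξ, f ξ := by
    have h := Measure.map_addHaar_smul (volume : Measure E3) (inv_ne_zero hε.ne')
    rw [← lintegral_map hf (measurable_const_smul ε⁻¹), h, lintegral_smul_measure]
    simp [abs_of_pos hε]
  simp only [e1]
  rw [lintegral_const_mul _ (by exact hf.comp (measurable_const_smul _)), e2, ← mul_assoc,
    ← ENNReal.ofReal_mul (by positivity)]
  congr 2
  rw [Real.rpow_sub_one hε.ne']
  field_simp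

lemma aestronglyMeasurable_increment {T : ℝ} {u : ℝ → T3 → E3}
    (hu : AEStronglyMeasurable (fun p : ℝ × T3 => u p.1 p.2) (spaceTime T)) :
    AEStronglyMeasurable (fun q : E3 × (ℝ × T3) => increment (u q.2.1) q.1 q.2.2)
      ((volume : Measure E3).prod (spaceTime T)) :=
  ((isShift_stShift T).aestronglyMeasurable measurable_id hu).sub hu.comp_snd

lemma aestronglyMeasurable_mollDefect_integrand {T : ℝ} {u : ℝ → T3 → E3}
    (hu : AEStronglyMeasurable (fun p : ℝ × T3 => u p.1 p.2) (spaceTime T)) {φ : E3 → ℝ}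
    (hφ : ContDiff ℝ ∞ φ) (ε : ℝ) :
    AEStronglyMeasurable (fun q : E3 × (ℝ × T3) =>
      inner ℝ (gradient (rescale φ ε) q.1) (increment (u q.2.1) q.1 q.2.2) *
        ‖increment (u q.2.1) q.1 q.2.2‖ ^ 2) ((volume : Measure E3).prod (spaceTime T)) := by
  have h := aestronglyMeasurable_increment hu
  have hg : AEStronglyMeasurable (fun q : E3 × (ℝ × T3) => gradient (rescale φ ε) q.1)
      ((volume : Measure E3).prod (spaceTime T)) :=
    ((continuous_gradient (contDiff_rescale hφ ε)).comp continuous_fst).aestronglyMeasurable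
  exact (hg.inner h).mul (h.norm.pow 2)

lemma eLpNorm_increment_le {T β : ℝ} {C : ℝ≥0} {u : ℝ → T3 → E3}
    (hm : ∀ i, AEStronglyMeasurable (comp u i) (spaceTime T))
    (hC : ∀ i, HasModulus (spaceTime T) stShift 3 β C (comp u i)) (y : E3) :
    eLpNorm (fun p : ℝ × T3 => increment (u p.1) y p.2) 3 (spaceTime T) ≤
      3 * C * ENNReal.ofReal (‖y‖ ^ β) := by
  have hmy : ∀ i, AEStronglyMeasurable (fun p => comp u i (stShift y p) - comp u i p)
      (spaceTime T) := fun i =>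
    ((hm i).comp_measurePreserving (measurePreserving_stShift T y)).sub (hm i)
  calc _ ≤ eLpNorm (∑ i, fun p => ‖comp u i (stShift y p) - comp u i p‖) 3 (spaceTime T) := by
        refine eLpNorm_mono_real fun p => ?_
        rw [Finset.sum_apply]
        have h1 : ∀ i, ‖comp u i (stShift y p) - comp u i p‖ = |increment (u p.1) y p.2 i| := by
          intro i
          simp only [comp, stShift, increment, ← Complex.ofReal_sub, Complex.norm_real,
            Real.norm_eq_abs, PiLp.sub_apply]
        simp only [h1]
        rw [EuclideanSpace.norm_eq]
        refine Real.sqrt_le_iff.2 ⟨Finset.sum_nonneg fun _ _ => abs_nonneg _, ?_⟩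
        simp only [Real.norm_eq_abs]
        exact Finset.sum_sq_le_sq_sum_of_nonneg fun _ _ => abs_nonneg _
    _ ≤ ∑ i, eLpNorm (fun p => ‖comp u i (stShift y p) - comp u i p‖) 3 (spaceTime T) :=
        eLpNorm_sum_le (fun i _ => (hmy i).norm) (by norm_num)
    _ ≤ ∑ _i : Fin 3, C * ENNReal.ofReal (‖y‖ ^ β) := by
        refine Finset.sum_le_sum fun i _ => ?_
        rw [eLpNorm_norm]
        exact hC i y
    _ = _ := by simp; ring

/-- The integrand is at most |∇φ^ε(ξ)| |δu(ξ)|³. By Tonelli the space-time integral of |δu(ξ)|³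
comes first and is of order |ξ|^(3β); the moment of order 3β of ∇φ^ε then gives ε^(3β-1). -/
lemma eLpNorm_mollDefect_le {T β : ℝ} {C : ℝ≥0} {u : ℝ → T3 → E3}
    (hu : AEStronglyMeasurable (fun p : ℝ × T3 => u p.1 p.2) (spaceTime T))
    (hC : ∀ i, HasModulus (spaceTime T) stShift 3 β C (comp u i)) {φ : E3 → ℝ}
    (hφ : ContDiff ℝ ∞ φ) {ε : ℝ} (hε : 0 < ε) :
    eLpNorm (fun p : ℝ × T3 => mollDefect φ ε (u p.1) p.2) 1 (spaceTime T) ≤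
      ENNReal.ofReal (ε ^ (β * 3 - 1)) * ((3 * C) ^ 3 *
        ∫⁻ ξ, ‖fderiv ℝ φ ξ‖ₑ * ENNReal.ofReal (‖ξ‖ ^ (β * 3))) := by
  have hm := aestronglyMeasurable_comp hu
  have hi := aestronglyMeasurable_increment hu
  have hg := continuous_gradient (contDiff_rescale hφ ε)
  rw [eLpNorm_one_eq_lintegral_enorm]
  have hmeas : AEMeasurable (fun q : (ℝ × T3) × E3 => ‖gradient (rescale φ ε) q.2‖ₑ *
      ‖increment (u q.1.1) q.2 q.1.2‖ₑ ^ 3) ((spaceTime T).prod volume) :=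
    ((hg.comp continuous_snd).aestronglyMeasurable.enorm).mul
      (hi.prod_swap.enorm.pow_const 3)
  calc ∫⁻ p : ℝ × T3, ‖mollDefect φ ε (u p.1) p.2‖ₑ ∂spaceTime T
      ≤ ∫⁻ p : ℝ × T3, (∫⁻ ξ, ‖gradient (rescale φ ε) ξ‖ₑ *
          ‖increment (u p.1) ξ p.2‖ₑ ^ 3) ∂spaceTime T := by
        refine lintegral_mono fun p => (enorm_integral_le_lintegral_enorm _).trans
          (lintegral_mono fun ξ => ?_)
        rw [enorm_mul, enorm_pow, enorm_norm, pow_succ' _ 2, ← mul_assoc]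
        gcongr
        rw [← ofReal_norm, ← ofReal_norm, ← ofReal_norm, ← ENNReal.ofReal_mul (norm_nonneg _)]
        exact ENNReal.ofReal_le_ofReal (norm_inner_le_norm _ _)
    _ = ∫⁻ ξ, ‖gradient (rescale φ ε) ξ‖ₑ *
          ∫⁻ p : ℝ × T3, ‖increment (u p.1) ξ p.2‖ₑ ^ 3 ∂spaceTime T := by
        rw [lintegral_lintegral_swap hmeas]
        refine lintegral_congr_ae ?_
        filter_upwards [hi.prodMk_left] with ξ hξ
        exact lintegral_const_mul'' _ (hξ.enorm.pow_const 3)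
    _ ≤ ∫⁻ ξ, ‖gradient (rescale φ ε) ξ‖ₑ * ENNReal.ofReal (‖ξ‖ ^ (β * 3)) * (3 * C) ^ 3 := by
        refine lintegral_mono fun ξ => ?_
        have h1 := eLpNorm_rpow_eq (ν := spaceTime T) (p := 3) (by norm_num) (by norm_num)
          (fun p : ℝ × T3 => increment (u p.1) ξ p.2)
        have h2 := ENNReal.rpow_le_rpow (eLpNorm_increment_le hm hC ξ)
          (z := (3 : ℝ≥0∞).toReal) (by simp)
        rw [h1] at h2
        have e3 : (3 : ℝ≥0∞).toReal = ((3 : ℕ) : ℝ) := by simp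
        simp only [e3, ENNReal.rpow_natCast] at h2
        rw [mul_pow, ← ENNReal.ofReal_pow (by positivity), ← Real.rpow_natCast,
          ← Real.rpow_mul (norm_nonneg _)] at h2
        rw [mul_assoc]
        gcongr
        refine h2.trans_eq ?_
        rw [mul_comm]; norm_cast
    _ = _ := by
        rw [lintegral_mul_const'' _, lintegral_gradient_rescale hφ hε]
        · ring
        · exact hg.aestronglyMeasurable.enorm.mul
            (measurable_norm.pow_const _).ennreal_ofReal.aemeasurable

lemma lintegral_fderiv_moment_ne_top {φ : E3 → ℝ} (hφ : ContDiff ℝ ∞ φ)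
    (hc : HasCompactSupport φ) {r : ℝ} (hr : 0 ≤ r) :
    ∫⁻ ξ, ‖fderiv ℝ φ ξ‖ₑ * ENNReal.ofReal (‖ξ‖ ^ r) ≠ ⊤ := by
  have h1 : Continuous fun ξ : E3 => ‖fderiv ℝ φ ξ‖ * ‖ξ‖ ^ r :=
    (hφ.continuous_fderiv (by simp)).norm.mul (continuous_norm.rpow_const fun _ => Or.inr hr)
  have h2 : HasCompactSupport fun ξ : E3 => ‖fderiv ℝ φ ξ‖ * ‖ξ‖ ^ r :=
    (hc.fderiv ℝ).norm.mul_right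
  have h3 := (h1.integrable_of_hasCompactSupport h2 (μ := volume)).lintegral_lt_top
  refine (lt_of_le_of_lt (lintegral_mono fun ξ => ?_) h3).ne
  rw [ENNReal.ofReal_mul (norm_nonneg _), ofReal_norm]

/-- The exponent 3β - 1 of ε is positive exactly because β > 1/3. -/
theorem defectVanishesL1_of_hasModulus {T β : ℝ} (hβ : 1 / 3 < β) {C : ℝ≥0} {u : ℝ → T3 → E3}
    (hu : AEStronglyMeasurable (fun p : ℝ × T3 => u p.1 p.2) (spaceTime T))
    (hC : ∀ i, HasModulus (spaceTime T) stShift 3 β C (comp u i)) : DefectVanishesL1 T u := by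
  intro φ hφ
  set M : ℝ≥0∞ := (3 * C) ^ 3 * ∫⁻ ξ, ‖fderiv ℝ φ ξ‖ₑ * ENNReal.ofReal (‖ξ‖ ^ (β * 3))
  have hM : M ≠ ⊤ := ENNReal.mul_ne_top (by simp [ENNReal.mul_eq_top])
    (lintegral_fderiv_moment_ne_top hφ.smooth hφ.compact (by linarith))
  refine ⟨fun ε hε => ?_, ?_⟩
  · rw [← memLp_one_iff_integrable]
    refine ⟨(aestronglyMeasurable_mollDefect_integrand hu hφ.smooth ε).prod_swap.integral_prod_right',
      (eLpNorm_mollDefect_le hu hC hφ.smooth hε).trans_lt (ENNReal.mul_lt_top (by simp) hM.lt_top)⟩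
  · have h1 : Tendsto (fun ε : ℝ => ENNReal.ofReal (ε ^ (β * 3 - 1)) * M) (𝓝[>] 0) (𝓝 0) := by
      have h2 : Tendsto (fun ε : ℝ => ε ^ (β * 3 - 1)) (𝓝[>] 0) (𝓝 0) := by
        have := (Real.continuousAt_rpow_const 0 (β * 3 - 1) (Or.inr (by linarith))).tendsto
        rw [Real.zero_rpow (by linarith)] at this
        exact this.mono_left nhdsWithin_le_nhds
      have h3 := ENNReal.Tendsto.mul_const (b := M) (ENNReal.tendsto_ofReal h2) (Or.inr hM)
      simpa using h3
    refine tendsto_of_tendsto_of_tendsto_of_le_of_le' tendsto_const_nhds h1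
      (Eventually.of_forall fun _ => zero_le) ?_
    filter_upwards [self_mem_nhdsWithin] with ε hε
    exact eLpNorm_mollDefect_le hu hC hφ.smooth hε

/-! ### Calculus on the torus -/

section Calculus

variable {F : Type*} [NormedAddCommGroup F] [NormedSpace ℝ F]

/-- The partial derivative of a vector valued function on the torus. -/
def tderiv (i : Fin 3) (f : T3 → F) (x : T3) : F :=
  deriv (fun h : ℝ => f (x + Pi.single i (h : UnitAddCircle))) 0

lemma pderiv_eq_tderiv (i : Fin 3) (f : T3 → ℝ) : pderiv i f = tderiv i f := rfl

/-- A function on the torus is smooth if its periodic lift is. -/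
def TSmooth (f : T3 → F) : Prop := ContDiff ℝ ∞ fun y : E3 => f (toTorus y)

lemma TSmooth.continuous {f : T3 → F} (hf : TSmooth f) : Continuous f :=
  isOpenQuotientMap_toTorus.isQuotientMap.continuous_iff.2 (ContDiff.continuous hf)

lemma hasDerivAt_line {f : T3 → F} (y : E3) (hf : DifferentiableAt ℝ (fun y : E3 => f (toTorus y)) y)
    (i : Fin 3) :
    HasDerivAt (fun h : ℝ => f (toTorus y + Pi.single i (h : UnitAddCircle)))
      (fderiv ℝ (fun y : E3 => f (toTorus y)) y (EuclideanSpace.single i 1)) 0 := by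
  have h1 : HasDerivAt (fun h : ℝ => y + h • (EuclideanSpace.single i (1 : ℝ) : E3))
      (EuclideanSpace.single i (1 : ℝ)) 0 := by
    simpa using ((hasDerivAt_id (0 : ℝ)).smul_const (EuclideanSpace.single i (1 : ℝ) : E3)).const_add y
  have h2 : HasFDerivAt (fun y : E3 => f (toTorus y)) (fderiv ℝ (fun y : E3 => f (toTorus y)) y)
      (y + (0 : ℝ) • (EuclideanSpace.single i (1 : ℝ) : E3)) := by
    simpa using hf.hasFDerivAt
  have h3 := h2.comp_hasDerivAt (0 : ℝ) h1
  refine h3.congr_of_eventuallyEq (Eventually.of_forall fun h => ?_)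
  simp only [Function.comp_apply, toTorus_add, toTorus_single]

lemma TSmooth.tderiv_toTorus {f : T3 → F} (hf : TSmooth f) (i : Fin 3) (y : E3) :
    tderiv i f (toTorus y) =
      fderiv ℝ (fun y : E3 => f (toTorus y)) y (EuclideanSpace.single i 1) :=
  (hasDerivAt_line y (ContDiff.differentiable hf (by simp) y) i).deriv

lemma TSmooth.hasDerivAt {f : T3 → F} (hf : TSmooth f) (i : Fin 3) (x : T3) :
    HasDerivAt (fun h : ℝ => f (x + Pi.single i (h : UnitAddCircle))) (tderiv i f x) 0 := by
  obtain ⟨y, rfl⟩ := surjective_toTorus x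
  rw [hf.tderiv_toTorus]
  exact hasDerivAt_line y (ContDiff.differentiable hf (by simp) y) i

lemma TSmooth.hasDerivAt' {f : T3 → F} (hf : TSmooth f) (i : Fin 3) (x : T3) (h : ℝ) :
    HasDerivAt (fun h : ℝ => f (x + Pi.single i (h : UnitAddCircle)))
      (tderiv i f (x + Pi.single i (h : UnitAddCircle))) h := by
  have h1 := hf.hasDerivAt i (x + Pi.single i (h : UnitAddCircle))
  have h2 : HasDerivAt (fun h' : ℝ => h' - h) 1 h := (hasDerivAt_id h).sub_const h
  have h3 := HasDerivAt.scomp h (h := fun h' : ℝ => h' - h)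
    (by simpa using h1) h2
  rw [one_smul] at h3
  refine h3.congr_of_eventuallyEq (Eventually.of_forall fun h' => ?_)
  simp only [Function.comp_apply]
  rw [add_assoc, ← Pi.single_add, ← AddCircle.coe_add]
  simp

lemma TSmooth.tderiv {f : T3 → F} (hf : TSmooth f) (i : Fin 3) : TSmooth (tderiv i f) := by
  unfold TSmooth
  simp only [hf.tderiv_toTorus]
  exact (ContDiff.fderiv_right hf (m := ∞) (by simp)).clm_apply contDiff_const

lemma tsmooth_const (c : F) : TSmooth fun _ : T3 => c := contDiff_const

lemma TSmooth.clm {G : Type*} [NormedAddCommGroup G] [NormedSpace ℝ G] {f : T3 → F}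
    (hf : TSmooth f) (L : F →L[ℝ] G) : TSmooth fun x => L (f x) := L.contDiff.comp hf

lemma TSmooth.tderiv_clm {G : Type*} [NormedAddCommGroup G] [NormedSpace ℝ G] {f : T3 → F}
    (hf : TSmooth f) (L : F →L[ℝ] G) (i : Fin 3) (x : T3) :
    FracNS.tderiv i (fun x => L (f x)) x = L (FracNS.tderiv i f x) :=
  (L.hasFDerivAt.comp_hasDerivAt (0 : ℝ) (hf.hasDerivAt i x)).deriv

lemma TSmooth.sum {ι : Type*} {s : Finset ι} {f : ι → T3 → F} (hf : ∀ j ∈ s, TSmooth (f j)) :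
    TSmooth fun x => ∑ j ∈ s, f j x := ContDiff.sum hf

lemma TSmooth.mul {f g : T3 → ℂ} (hf : TSmooth f) (hg : TSmooth g) :
    TSmooth fun x => f x * g x := ContDiff.mul hf hg

lemma TSmooth.tderiv_mul {f g : T3 → ℂ} (hf : TSmooth f) (hg : TSmooth g) (i : Fin 3) (x : T3) :
    FracNS.tderiv i (fun x => f x * g x) x =
      FracNS.tderiv i f x * g x + f x * FracNS.tderiv i g x := by
  have := (hf.hasDerivAt i x).mul (hg.hasDerivAt i x)
  have e := this.deriv
  simpa using! e

lemma TSmooth.tderiv_sum {ι : Type*} {s : Finset ι} {f : ι → T3 → F} (hf : ∀ j ∈ s, TSmooth (f j))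
    (i : Fin 3) (x : T3) :
    FracNS.tderiv i (fun x => ∑ j ∈ s, f j x) x = ∑ j ∈ s, FracNS.tderiv i (f j) x := by
  have := HasDerivAt.fun_sum fun j hj => (hf j hj).hasDerivAt i x
  exact this.deriv

lemma TSmooth.exists_bound {f : T3 → F} (hf : TSmooth f) : ∃ C, ∀ x, ‖f x‖ ≤ C := by
  obtain ⟨C, hC⟩ := isCompact_univ.exists_bound_of_continuousOn hf.continuous.continuousOn
  exact ⟨C, fun x => hC x (mem_univ x)⟩

lemma TSmooth.integrable {f : T3 → F} (hf : TSmooth f) : Integrable f torusVol :=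
  hf.continuous.integrable_of_hasCompactSupport (HasCompactSupport.of_compactSpace _)

/-- By translation invariance h ↦ ∫ f(x + h eᵢ) dx is constant, and its derivative at 0 is the
integral of the partial derivative. Integration by parts on the torus follows from this and the
product rule. -/
lemma TSmooth.integral_tderiv {f : T3 → F} (hf : TSmooth f) (i : Fin 3) :
    ∫ x, FracNS.tderiv i f x ∂torusVol = 0 := by
  obtain ⟨C, hC⟩ := (hf.tderiv i).exists_bound
  have hcont : ∀ (g : T3 → F), Continuous g → ∀ h : ℝ,
      AEStronglyMeasurable (fun x : T3 => g (x + Pi.single i (h : UnitAddCircle))) torusVol :=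
    fun g hg h => (hg.comp (continuous_add_const _)).aestronglyMeasurable
  have hint : Integrable (fun x : T3 => f (x + Pi.single i ((0 : ℝ) : UnitAddCircle))) torusVol := by
    simpa using hf.integrable
  have hbd : ∀ᵐ x ∂torusVol, ∀ h ∈ (univ : Set ℝ),
      ‖FracNS.tderiv i f (x + Pi.single i (h : UnitAddCircle))‖ ≤ C := ae_of_all _ fun x h _ => hC _
  have hder : ∀ᵐ x ∂torusVol, ∀ h ∈ (univ : Set ℝ),
      HasDerivAt (fun h : ℝ => f (x + Pi.single i (h : UnitAddCircle)))
        (FracNS.tderiv i f (x + Pi.single i (h : UnitAddCircle))) h :=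
    ae_of_all _ fun x h _ => hf.hasDerivAt' i x h
  have h1 := hasDerivAt_integral_of_dominated_loc_of_deriv_le (μ := torusVol) (x₀ := (0 : ℝ))
    univ_mem (Eventually.of_forall (hcont f hf.continuous)) hint
    (hcont _ (hf.tderiv i).continuous 0) hbd (integrable_const C) hder
  have h2 : (fun h : ℝ => ∫ x, f (x + Pi.single i (h : UnitAddCircle)) ∂torusVol) =
      fun _ => ∫ x, f x ∂torusVol := by
    funext h; exact integral_add_right_eq_self f _
  have h3 := h1.2
  rw [h2] at h3
  have := h3.unique (hasDerivAt_const _ _)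
  simpa using this

lemma TSmooth.integral_mul_tderiv {f g : T3 → ℂ} (hf : TSmooth f) (hg : TSmooth g) (i : Fin 3) :
    ∫ x, f x * FracNS.tderiv i g x ∂torusVol = -∫ x, FracNS.tderiv i f x * g x ∂torusVol := by
  have := (hf.mul hg).integral_tderiv i
  simp only [hf.tderiv_mul hg] at this
  rw [integral_add ((hf.tderiv i).mul hg).integrable (hf.mul (hg.tderiv i)).integrable] at this
  linear_combination this

end Calculus

lemma tsmooth_mFourier (k : Fin 3 → ℤ) : TSmooth (mFourier k : T3 → ℂ) := by
  unfold TSmooth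
  simp only [mFourier_toTorus, Real.fourierChar_apply]
  refine Complex.contDiff_exp.comp ?_
  refine ContDiff.mul ?_ contDiff_const
  refine Complex.ofRealCLM.contDiff.comp ?_
  exact contDiff_const.mul (contDiff_const.inner ℝ contDiff_id)

/-- The symbol of `∂ᵢ`. -/
def dsym (i : Fin 3) (k : Fin 3 → ℤ) : ℂ := 2 * Real.pi * Complex.I * k i

lemma tderiv_mFourier (i : Fin 3) (k : Fin 3 → ℤ) (x : T3) :
    tderiv i (mFourier k : T3 → ℂ) x = dsym i k * mFourier k x := by
  have e : (fun h : ℝ => mFourier k (x + Pi.single i (h : UnitAddCircle))) =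
      fun h : ℝ => mFourier k x * Complex.exp (dsym i k * h) := by
    funext h
    rw [mFourier_add_apply, ← toTorus_single, mFourier_toTorus, Real.fourierChar_apply]
    congr 2
    simp [freq, inner_smul_right, dsym, EuclideanSpace.inner_single_right]
    ring
  have h1 : HasDerivAt (fun h : ℝ => Complex.exp (dsym i k * h)) (dsym i k) 0 := by
    have h2 : HasDerivAt (fun h : ℝ => dsym i k * (h : ℂ)) (dsym i k) 0 := by
      simpa using (Complex.ofRealCLM.hasDerivAt (x := (0 : ℝ))).const_mul (dsym i k)
    simpa using h2.cexp
  unfold tderiv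
  rw [e, (h1.const_mul _).deriv, mul_comm]

lemma dsym_neg (i : Fin 3) (k : Fin 3 → ℤ) : dsym i (-k) = -dsym i k := by
  simp [dsym]

lemma tsmooth_trigPoly (S : Finset (Fin 3 → ℤ)) (a : (Fin 3 → ℤ) → ℂ) : TSmooth (trigPoly S a) :=
  TSmooth.sum fun k _ => (tsmooth_const (a k)).mul (tsmooth_mFourier k)

lemma tderiv_trigPoly (i : Fin 3) (S : Finset (Fin 3 → ℤ)) (a : (Fin 3 → ℤ) → ℂ) (x : T3) :
    tderiv i (trigPoly S a) x = trigPoly S (fun k => dsym i k * a k) x := by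
  unfold trigPoly
  rw [TSmooth.tderiv_sum fun k _ => (tsmooth_const (a k)).mul (tsmooth_mFourier k)]
  refine Finset.sum_congr rfl fun k _ => ?_
  rw [(tsmooth_const (a k)).tderiv_mul (tsmooth_mFourier k), tderiv_mFourier]
  have : tderiv i (fun _ : T3 => a k) x = 0 := by simp [tderiv]
  rw [this]; ring

lemma fc_tderiv {f : T3 → ℂ} (hf : TSmooth f) (i : Fin 3) (k : Fin 3 → ℤ) :
    fc (tderiv i f) k = dsym i k * fc f k := by
  unfold fc
  rw [(tsmooth_mFourier (-k)).integral_mul_tderiv hf]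
  simp only [tderiv_mFourier, dsym_neg]
  rw [← integral_neg, ← integral_const_mul]
  congr 1; ext x; ring

/-! ### Smooth functions on space-time -/

section SpaceTime

variable {F : Type*} [NormedAddCommGroup F] [NormedSpace ℝ F]

lemma SmoothST.tsmooth {ψ : ℝ → T3 → F} (h : SmoothST ψ) (t : ℝ) : TSmooth (ψ t) :=
  ContDiff.comp (g := fun p : ℝ × E3 => ψ p.1 (toTorus p.2)) h
    (contDiff_const.prodMk contDiff_id)

/-- Continuity descends along the covering ℝ × ℝ³ → ℝ × 𝕋³. Openness of the covering is used, as a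
product of quotient maps need not be a quotient map. -/
lemma SmoothST.continuous {ψ : ℝ → T3 → F} (h : SmoothST ψ) :
    Continuous fun p : ℝ × T3 => ψ p.1 p.2 := by
  have hq : IsOpenQuotientMap (Prod.map (id : ℝ → ℝ) toTorus) :=
    IsOpenQuotientMap.id.prodMap isOpenQuotientMap_toTorus
  exact hq.isQuotientMap.continuous_iff.2 (ContDiff.continuous h)

lemma SmoothST.hasDerivAt {ψ : ℝ → T3 → F} (h : SmoothST ψ) (t : ℝ) (x : T3) :
    HasDerivAt (fun τ => ψ τ x) (deriv (fun τ => ψ τ x) t) t := by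
  obtain ⟨y, rfl⟩ := surjective_toTorus x
  have : ContDiff ℝ ∞ fun τ => ψ τ (toTorus y) :=
    ContDiff.comp (g := fun p : ℝ × E3 => ψ p.1 (toTorus p.2)) h (contDiff_id.prodMk contDiff_const)
  exact (this.differentiable (by simp) t).hasDerivAt

lemma SmoothST.dt {ψ : ℝ → T3 → F} (h : SmoothST ψ) :
    SmoothST fun t x => deriv (fun τ => ψ τ x) t := by
  have e : ∀ p : ℝ × E3, deriv (fun τ => ψ τ (toTorus p.2)) p.1 =
      fderiv ℝ (fun p : ℝ × E3 => ψ p.1 (toTorus p.2)) p (1, 0) := by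
    intro p
    have h1 : HasFDerivAt (fun p : ℝ × E3 => ψ p.1 (toTorus p.2))
        (fderiv ℝ (fun p : ℝ × E3 => ψ p.1 (toTorus p.2)) p) (p.1, p.2) :=
      (ContDiff.differentiable h (by simp) p).hasFDerivAt
    have h2 : HasDerivAt (fun τ : ℝ => (τ, p.2)) ((1 : ℝ), (0 : E3)) p.1 :=
      (hasDerivAt_id p.1).prodMk (hasDerivAt_const _ _)
    exact (h1.comp_hasDerivAt p.1 h2).deriv
  unfold SmoothST
  simp only [e]
  exact (ContDiff.fderiv_right h (m := ∞) (by simp)).clm_apply contDiff_const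

lemma SmoothST.tderiv {ψ : ℝ → T3 → F} (h : SmoothST ψ) (i : Fin 3) :
    SmoothST fun t x => tderiv i (ψ t) x := by
  have e : ∀ p : ℝ × E3, FracNS.tderiv i (ψ p.1) (toTorus p.2) =
      fderiv ℝ (fun p : ℝ × E3 => ψ p.1 (toTorus p.2)) p (0, EuclideanSpace.single i 1) := by
    intro p
    rw [(h.tsmooth p.1).tderiv_toTorus]
    have h1 : HasFDerivAt (fun p : ℝ × E3 => ψ p.1 (toTorus p.2))
        (fderiv ℝ (fun p : ℝ × E3 => ψ p.1 (toTorus p.2)) p) (p.1, p.2) :=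
      (ContDiff.differentiable h (by simp) p).hasFDerivAt
    have h2 : HasFDerivAt (fun y : E3 => (p.1, y)) (ContinuousLinearMap.inr ℝ ℝ E3) p.2 :=
      hasFDerivAt_prodMk_right _ _
    have h3 : fderiv ℝ (fun y : E3 => ψ p.1 (toTorus y)) p.2 = _ := (h1.comp p.2 h2).fderiv
    rw [h3]; rfl
  unfold SmoothST
  simp only [e]
  exact (ContDiff.fderiv_right h (m := ∞) (by simp)).clm_apply contDiff_const

lemma SmoothST.exists_bound {ψ : ℝ → T3 → F} (h : SmoothST ψ) (a b : ℝ) :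
    ∃ C : ℝ≥0, ∀ t ∈ Icc a b, ∀ x, ‖ψ t x‖ ≤ C := by
  obtain ⟨C, hC⟩ := (isCompact_Icc.prod isCompact_univ :
    IsCompact (Icc a b ×ˢ (univ : Set T3))).exists_bound_of_continuousOn h.continuous.continuousOn
  exact ⟨C.toNNReal, fun t ht x => (hC (t, x) ⟨ht, mem_univ x⟩).trans (Real.le_coe_toNNReal C)⟩

lemma SmoothST.hasDerivAt_integral_mul {ψ : ℝ → T3 → ℂ} (h : SmoothST ψ) {g : T3 → ℂ}
    (hg : Continuous g) (t : ℝ) :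
    HasDerivAt (fun τ => ∫ x, ψ τ x * g x ∂torusVol)
      (∫ x, deriv (fun τ => ψ τ x) t * g x ∂torusVol) t := by
  obtain ⟨C, hC⟩ := h.dt.exists_bound (t - 1) (t + 1)
  have hgi : Integrable g torusVol :=
    hg.integrable_of_hasCompactSupport (HasCompactSupport.of_compactSpace _)
  have hmem : Icc (t - 1) (t + 1) ∈ 𝓝 t := Icc_mem_nhds (by linarith) (by linarith)
  refine (hasDerivAt_integral_of_dominated_loc_of_deriv_le (μ := torusVol)
    (bound := fun x => C * ‖g x‖) hmem
    (Eventually.of_forall fun τ => ((h.tsmooth τ).continuous.mul hg).aestronglyMeasurable)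
    (((h.tsmooth t).continuous.mul hg).integrable_of_hasCompactSupport
      (HasCompactSupport.of_compactSpace _))
    ((h.dt.tsmooth t).continuous.mul hg).aestronglyMeasurable
    (ae_of_all _ fun x τ hτ => ?_) (hgi.norm.const_mul _)
    (ae_of_all _ fun x τ _ => (h.hasDerivAt τ x).mul_const (g x))).2
  rw [norm_mul]
  gcongr
  exact hC τ hτ x

lemma SmoothST.continuous_integral_mul {ψ : ℝ → T3 → ℂ} (h : SmoothST ψ) {g : T3 → ℂ}
    (hg : Continuous g) : Continuous fun t => ∫ x, ψ t x * g x ∂torusVol :=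
  continuous_iff_continuousAt.2 fun t => (h.hasDerivAt_integral_mul hg t).continuousAt

end SpaceTime

/-! ### Weak derivatives of functions of time -/

/-- Real test functions of time, supported in `(0,T)`. -/
def TestTime (T : ℝ) (θ : ℝ → ℝ) : Prop :=
  ContDiff ℝ ∞ θ ∧ ∃ a b : ℝ, 0 < a ∧ b < T ∧ ∀ t, (t ≤ a ∨ b ≤ t) → θ t = 0

/-- `G` is the weak derivative of `y` on `(0,T)`. -/
def HasWeakDeriv {F : Type*} [NormedAddCommGroup F] [NormedSpace ℝ F] (T : ℝ) (y G : ℝ → F) :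
    Prop :=
  ∀ θ, TestTime T θ → ∫ t in Ioo 0 T, deriv θ t • y t = -∫ t in Ioo 0 T, θ t • G t

lemma setIntegral_Ioo_eq {F : Type*} [NormedAddCommGroup F] [NormedSpace ℝ F] {T : ℝ}
    (hT : 0 ≤ T) (f : ℝ → F) : ∫ t in Ioo 0 T, f t = ∫ t in (0 : ℝ)..T, f t := by
  rw [intervalIntegral.integral_of_le hT, integral_Ioc_eq_integral_Ioo]

/-- Test functions of mean zero are derivatives of test functions, the device behind the du
Bois-Reymond argument below. -/
lemma TestTime.integral_primitive {T : ℝ} {χ : ℝ → ℝ} (h : TestTime T χ)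
    (h0 : ∫ t in (0 : ℝ)..T, χ t = 0) :
    TestTime T (fun t => ∫ s in (0 : ℝ)..t, χ s) ∧
      deriv (fun t => ∫ s in (0 : ℝ)..t, χ s) = χ := by
  obtain ⟨hs, a, b, ha, hb, hab⟩ := h
  have hd : ∀ t, HasDerivAt (fun t => ∫ s in (0 : ℝ)..t, χ s) (χ t) t := fun t =>
    intervalIntegral.integral_hasDerivAt_right (hs.continuous.intervalIntegrable _ _)
      (hs.continuous.stronglyMeasurableAtFilter _ _) hs.continuous.continuousAt
  have hd' : deriv (fun t => ∫ s in (0 : ℝ)..t, χ s) = χ := funext fun t => (hd t).deriv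
  refine ⟨⟨?_, a, b, ha, hb, fun t ht => ?_⟩, hd'⟩
  · rw [contDiff_infty_iff_deriv, hd']
    exact ⟨fun t => (hd t).differentiableAt, hs⟩
  · rcases ht with ht | ht
    · refine (intervalIntegral.integral_congr (g := fun _ => (0 : ℝ)) fun s hs => ?_).trans (by simp)
      refine hab s (Or.inl ?_)
      rcases mem_uIcc.1 hs with h | h <;> linarith [h.1, h.2]
    -- To the right of the support the primitive equals the full integral, which is zero.
    · have e : ∫ s in t..T, χ s = 0 := by
        refine (intervalIntegral.integral_congr (g := fun _ => (0 : ℝ)) fun s hs => ?_).trans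
          (by simp)
        refine hab s (Or.inr ?_)
        rcases mem_uIcc.1 hs with h | h <;> linarith [h.1, h.2]
      have := intervalIntegral.integral_add_adjacent_intervals
        (hs.continuous.intervalIntegrable (μ := volume) 0 t)
        (hs.continuous.intervalIntegrable (μ := volume) t T)
      rw [e, h0, add_zero] at this
      exact this

lemma exists_testTime_integral_one {T : ℝ} (hT : 0 < T) :
    ∃ θ, TestTime T θ ∧ ∫ t in (0 : ℝ)..T, θ t = 1 := by
  set f : ContDiffBump (T / 2) := ⟨T / 8, T / 4, by linarith, by linarith⟩
  have hz : ∀ t, (t ≤ T / 4 ∨ 3 * T / 4 ≤ t) → f.normed volume t = 0 := by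
    intro t ht
    have : t ∉ Function.support (f.normed volume) := by
      rw [f.support_normed_eq, Metric.mem_ball, Real.dist_eq, not_lt]
      change T / 4 ≤ _
      rcases ht with ht | ht
      · rw [abs_sub_comm]; exact le_trans (by linarith) (le_abs_self _)
      · exact le_trans (by linarith) (le_abs_self _)
    simpa using this
  refine ⟨f.normed volume, ⟨f.contDiff_normed, T / 4, 3 * T / 4, by linarith, by linarith, hz⟩, ?_⟩
  rw [← f.integral_normed (μ := volume), intervalIntegral.integral_of_le hT.le]
  refine setIntegral_eq_integral_of_forall_compl_eq_zero fun t ht => hz t ?_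
  simp only [mem_Ioc, not_and_or, not_lt, not_le] at ht
  rcases ht with ht | ht
  · left; linarith
  · right; linarith

lemma testTime_of_tsupport {T : ℝ} {g : ℝ → ℝ} (hT : 0 < T) (hg : ContDiff ℝ ∞ g)
    (hc : HasCompactSupport g) (hs : tsupport g ⊆ Ioo 0 T) : TestTime T g := by
  rcases (tsupport g).eq_empty_or_nonempty with he | hne
  · have : ∀ t, g t = 0 := fun t => image_eq_zero_of_notMem_tsupport (by simp [he])
    exact ⟨hg, T / 2, T / 2, by linarith, by linarith, fun t _ => this t⟩
  · obtain ⟨m, hm, hmin⟩ := hc.isCompact.exists_isLeast hne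
    obtain ⟨M, hM, hmax⟩ := hc.isCompact.exists_isGreatest hne
    have h1 := (hs hm).1
    have h2 := (hs hM).2
    refine ⟨hg, m / 2, (M + T) / 2, by linarith, by linarith, fun t ht => ?_⟩
    refine image_eq_zero_of_notMem_tsupport fun h => ?_
    have h3 := hmin h
    have h4 := hmax h
    rcases ht with ht | ht <;> linarith

/-- A function with an integrable weak derivative is almost everywhere equal to a primitive of
this derivative. -/
lemma HasWeakDeriv.exists_ae_eq {T : ℝ} (hT : 0 < T) {y G : ℝ → ℝ}
    (hy : IntegrableOn y (Ioo 0 T)) (hG : IntegrableOn G (Ioo 0 T)) (h : HasWeakDeriv T y G) :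
    ∃ c, ∀ᵐ t ∂(volume : Measure ℝ).restrict (Ioo 0 T), y t = c + ∫ s in (0 : ℝ)..t, G s := by
  have hGi : IntervalIntegrable G volume 0 T := by
    rw [intervalIntegrable_iff_integrableOn_Ioo_of_le hT.le]; exact hG
  have hyi : IntervalIntegrable y volume 0 T := by
    rw [intervalIntegrable_iff_integrableOn_Ioo_of_le hT.le]; exact hy
  set Φ : ℝ → ℝ := fun t => ∫ s in (0 : ℝ)..t, G s
  have hΦ : AbsolutelyContinuousOnInterval Φ 0 T :=
    hGi.absolutelyContinuousOnInterval_intervalIntegral (by simp)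
  have hΦd : ∀ᵐ t, t ∈ uIcc 0 T → HasDerivAt Φ (G t) t := by
    filter_upwards [hGi.ae_hasDerivAt_integral] with t ht ht'
    exact ht ht' 0 (by simp)
  set w : ℝ → ℝ := fun t => y t - Φ t
  have hΦi : IntervalIntegrable Φ volume 0 T := hΦ.continuousOn.intervalIntegrable
  have hwi : IntervalIntegrable w volume 0 T := hyi.sub hΦi
  -- The primitive Φ is absolutely continuous, so integration by parts shows that it has weak
  -- derivative G; the difference w = y - Φ has weak derivative zero.
  have hw : ∀ θ, TestTime T θ → ∫ t in (0 : ℝ)..T, deriv θ t * w t = 0 := by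
    intro θ hθ
    have h1 := h θ hθ
    simp only [smul_eq_mul] at h1
    rw [setIntegral_Ioo_eq hT.le, setIntegral_Ioo_eq hT.le] at h1
    obtain ⟨hs, a, b, ha, hb, hab⟩ := hθ
    have hθac : AbsolutelyContinuousOnInterval θ 0 T :=
      (hs.of_le (by simp)).contDiffOn.absolutelyContinuousOnInterval
    have h2 := hθac.integral_mul_deriv_eq_deriv_mul hΦ
    have h3 : ∫ t in (0 : ℝ)..T, θ t * deriv Φ t = ∫ t in (0 : ℝ)..T, θ t * G t := by
      refine intervalIntegral.integral_congr_ae ?_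
      filter_upwards [hΦd] with t ht ht'
      rw [(ht (uIoc_subset_uIcc ht')).deriv]
    rw [h3, hab 0 (Or.inl ha.le), hab T (Or.inr hb.le)] at h2
    have hdc : Continuous (deriv θ) := hs.continuous_deriv (by simp)
    simp only [w, mul_sub]
    rw [intervalIntegral.integral_sub (hyi.continuousOn_mul hdc.continuousOn)
      (hΦi.continuousOn_mul hdc.continuousOn), h1]
    linarith
  obtain ⟨θ₀, hθ₀, hθ₁⟩ := exists_testTime_integral_one hT
  set c := ∫ t in (0 : ℝ)..T, θ₀ t * w t
  -- Du Bois-Reymond: subtracting from χ a multiple of the normalised θ₀ leaves mean zero, hence the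
  -- derivative of a test function, which w annihilates.
  have hwc : ∀ χ, TestTime T χ → ∫ t in (0 : ℝ)..T, χ t * (w t - c) = 0 := by
    intro χ hχ
    set I := ∫ t in (0 : ℝ)..T, χ t
    have hη : TestTime T (fun t => χ t - I * θ₀ t) := by
      obtain ⟨hs, a, b, ha, hb, hab⟩ := hχ
      obtain ⟨hs', a', b', ha', hb', hab'⟩ := hθ₀
      refine ⟨hs.sub (contDiff_const.mul hs'), min a a', max b b', lt_min ha ha', max_lt hb hb',
        fun t ht => ?_⟩
      have h1 : t ≤ a ∨ b ≤ t := ht.imp (fun h => h.trans (min_le_left _ _))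
        (fun h => (le_max_left _ _).trans h)
      have h2 : t ≤ a' ∨ b' ≤ t := ht.imp (fun h => h.trans (min_le_right _ _))
        (fun h => (le_max_right _ _).trans h)
      simp [hab t h1, hab' t h2]
    have hχc := hχ.1.continuous
    have hθc := hθ₀.1.continuous
    have hη0 : ∫ t in (0 : ℝ)..T, (χ t - I * θ₀ t) = 0 := by
      rw [intervalIntegral.integral_sub (hχc.intervalIntegrable _ _)
        ((hθc.intervalIntegrable _ _).const_mul _), intervalIntegral.integral_const_mul, hθ₁]
      simp [I]
    obtain ⟨h1, h2⟩ := hη.integral_primitive hη0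
    have h3 := hw _ h1
    rw [h2] at h3
    have e : ∀ t, (χ t - I * θ₀ t) * w t = χ t * w t - I * (θ₀ t * w t) := fun t => by ring
    simp only [e] at h3
    rw [intervalIntegral.integral_sub (hwi.continuousOn_mul hχc.continuousOn)
      ((hwi.continuousOn_mul hθc.continuousOn).const_mul _),
      intervalIntegral.integral_const_mul] at h3
    simp only [mul_sub]
    rw [intervalIntegral.integral_sub (hwi.continuousOn_mul hχc.continuousOn)
      ((hχc.intervalIntegrable _ _).mul_const _), intervalIntegral.integral_mul_const]
    linarith
  have hloc : LocallyIntegrableOn (fun t => w t - c) (Ioo 0 T) := by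
    refine IntegrableOn.locallyIntegrableOn ?_
    have := hwi.sub (intervalIntegrable_const (c := c) (μ := volume) (a := 0) (b := T))
    rwa [intervalIntegrable_iff_integrableOn_Ioo_of_le hT.le] at this
  have hae := isOpen_Ioo.ae_eq_zero_of_integral_contDiff_smul_eq_zero hloc (fun g hg hgc hgs => by
    rw [← hwc g (testTime_of_tsupport hT hg hgc hgs), ← setIntegral_Ioo_eq hT.le]
    symm
    refine setIntegral_eq_integral_of_forall_compl_eq_zero fun t ht => ?_
    rw [image_eq_zero_of_notMem_tsupport fun h => ht (hgs h), zero_mul])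
  refine ⟨c, ?_⟩
  rw [ae_restrict_iff' measurableSet_Ioo]
  filter_upwards [hae] with t ht ht'
  have := ht ht'
  simp only [w, Φ] at this
  linarith

/-- After replacing y and z by absolutely continuous representatives Y and Z, the integrand is the
derivative of θYZ almost everywhere, and θYZ vanishes at both ends. The test function is only C¹
with zero boundary values, because it will be a spatial integral of a space-time test function. -/
lemma HasWeakDeriv.integral_mul_mul_real {T : ℝ} (hT : 0 < T) {y z G H : ℝ → ℝ}
    (hy : IntegrableOn y (Ioo 0 T)) (hz : IntegrableOn z (Ioo 0 T))
    (hG : IntegrableOn G (Ioo 0 T)) (hH : IntegrableOn H (Ioo 0 T))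
    (hyG : HasWeakDeriv T y G) (hzH : HasWeakDeriv T z H) {θ : ℝ → ℝ} (hθ : ContDiff ℝ 1 θ)
    (h0 : θ 0 = 0) (h1 : θ T = 0) :
    ∫ t in Ioo 0 T, (deriv θ t * (y t * z t) + θ t * (G t * z t + y t * H t)) = 0 ∧
    IntegrableOn (fun t => deriv θ t * (y t * z t)) (Ioo 0 T) ∧
    IntegrableOn (fun t => θ t * (G t * z t + y t * H t)) (Ioo 0 T) := by
  obtain ⟨c, hc⟩ := hyG.exists_ae_eq hT hy hG
  obtain ⟨d, hd⟩ := hzH.exists_ae_eq hT hz hH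
  have hGi : IntervalIntegrable G volume 0 T := by
    rw [intervalIntegrable_iff_integrableOn_Ioo_of_le hT.le]; exact hG
  have hHi : IntervalIntegrable H volume 0 T := by
    rw [intervalIntegrable_iff_integrableOn_Ioo_of_le hT.le]; exact hH
  set Y : ℝ → ℝ := fun t => c + ∫ s in (0 : ℝ)..t, G s
  set Z : ℝ → ℝ := fun t => d + ∫ s in (0 : ℝ)..t, H s
  have hconst : ∀ e : ℝ, AbsolutelyContinuousOnInterval (fun _ : ℝ => e) 0 T := fun e =>
    contDiffOn_const.absolutelyContinuousOnInterval
  have hY : AbsolutelyContinuousOnInterval Y 0 T :=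
    (hconst c).add (hGi.absolutelyContinuousOnInterval_intervalIntegral (by simp))
  have hZ : AbsolutelyContinuousOnInterval Z 0 T :=
    (hconst d).add (hHi.absolutelyContinuousOnInterval_intervalIntegral (by simp))
  have hYd : ∀ᵐ t, t ∈ uIcc 0 T → HasDerivAt Y (G t) t := by
    filter_upwards [hGi.ae_hasDerivAt_integral] with t ht ht'
    exact (ht ht' 0 (by simp)).const_add c
  have hZd : ∀ᵐ t, t ∈ uIcc 0 T → HasDerivAt Z (H t) t := by
    filter_upwards [hHi.ae_hasDerivAt_integral] with t ht ht'
    exact (ht ht' 0 (by simp)).const_add d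
  have hθac : AbsolutelyContinuousOnInterval θ 0 T := hθ.contDiffOn.absolutelyContinuousOnInterval
  have hdc : Continuous (deriv θ) := hθ.continuous_deriv (by simp)
  have hYc := hY.continuousOn
  have hZc := hZ.continuousOn
  have I1 : IntervalIntegrable (fun t => deriv θ t * (Y t * Z t)) volume 0 T :=
    ((hdc.continuousOn (s := uIcc 0 T)).mul (hYc.mul hZc)).intervalIntegrable
  have I2 : IntervalIntegrable (fun t => θ t * (G t * Z t + Y t * H t)) volume 0 T :=
    ((hGi.mul_continuousOn hZc).add (hHi.continuousOn_mul hYc)).continuousOn_mul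
      hθ.continuous.continuousOn
  rw [intervalIntegrable_iff_integrableOn_Ioo_of_le hT.le] at I1 I2
  refine ⟨?_, I1.congr_fun_ae ?_, I2.congr_fun_ae ?_⟩
  · have key := (AbsolutelyContinuousOnInterval.mul hθac
      (AbsolutelyContinuousOnInterval.mul hY hZ)).integral_deriv_eq_sub
    have e0 : (θ * (Y * Z)) T - (θ * (Y * Z)) 0 = 0 := by simp [h0, h1]
    rw [e0, ← setIntegral_Ioo_eq hT.le] at key
    refine Eq.trans (integral_congr_ae ?_) key
    filter_upwards [hc, hd, ae_restrict_of_ae hYd, ae_restrict_of_ae hZd,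
      self_mem_ae_restrict measurableSet_Ioo] with t h1 h2 h3 h4 h5
    have h6 : t ∈ uIcc 0 T := by rw [uIcc_of_le hT.le]; exact Ioo_subset_Icc_self h5
    have h8 : HasDerivAt θ (deriv θ t) t := (hθ.differentiable (by simp) t).hasDerivAt
    have h7 := h8.mul ((h3 h6).mul (h4 h6))
    rw [h7.deriv, h1, h2]
    rfl
  · filter_upwards [hc, hd] with t h1 h2
    simp only [h1, h2, Y, Z]
  · filter_upwards [hc, hd] with t h1 h2
    simp only [h1, h2, Y, Z]

/-- The real part (`j = 0`) and the imaginary part (`j = 1`) of a complex number. -/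
def cpart (j : Fin 2) (z : ℂ) : ℝ := if j = 0 then z.re else z.im

lemma sum_cpart (z : ℂ) : ∑ j : Fin 2, Complex.I ^ (j : ℕ) * (cpart j z : ℂ) = z := by
  simp only [Fin.sum_univ_two, cpart]
  simpa [mul_comm] using! Complex.re_add_im z

/-- `cpart` as a continuous linear map. -/
def cpartL (j : Fin 2) : ℂ →L[ℝ] ℝ := if j = 0 then Complex.reCLM else Complex.imCLM

lemma cpartL_apply (j : Fin 2) (z : ℂ) : cpartL j z = cpart j z := by
  unfold cpartL cpart; split_ifs <;> rfl

lemma integrableOn_continuous_smul {F : Type*} [NormedAddCommGroup F] [NormedSpace ℝ F] {T : ℝ}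
    {y : ℝ → F} (hy : IntegrableOn y (Ioo 0 T)) {θ : ℝ → ℝ} (hθ : Continuous θ) :
    IntegrableOn (fun t => θ t • y t) (Ioo 0 T) := by
  obtain ⟨C, hC⟩ := isCompact_Icc.exists_bound_of_continuousOn
    (hθ.continuousOn (s := Icc (0 : ℝ) T))
  refine Integrable.bdd_smul hy C hθ.aestronglyMeasurable ?_
  filter_upwards [self_mem_ae_restrict measurableSet_Ioo] with t ht
  exact hC t (Ioo_subset_Icc_self ht)

lemma HasWeakDeriv.cpart {T : ℝ} {y G : ℝ → ℂ} (hy : IntegrableOn y (Ioo 0 T))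
    (hG : IntegrableOn G (Ioo 0 T)) (h : HasWeakDeriv T y G) (j : Fin 2) :
    HasWeakDeriv T (fun t => FracNS.cpart j (y t)) (fun t => FracNS.cpart j (G t)) := by
  intro θ hθ
  have h1 := integrableOn_continuous_smul hy (hθ.1.continuous_deriv (by simp))
  have h2 := integrableOn_continuous_smul hG hθ.1.continuous
  have h3 := congrArg (cpartL j) (h θ hθ)
  rw [map_neg, ← ContinuousLinearMap.integral_comp_comm _ h1,
    ← ContinuousLinearMap.integral_comp_comm _ h2] at h3
  simpa only [map_smul, cpartL_apply] using h3

/-- The product rule for weak derivatives, tested against a continuously differentiable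
function. -/
lemma HasWeakDeriv.integral_mul_mul {T : ℝ} (hT : 0 < T) {y z G H : ℝ → ℂ}
    (hy : IntegrableOn y (Ioo 0 T)) (hz : IntegrableOn z (Ioo 0 T))
    (hG : IntegrableOn G (Ioo 0 T)) (hH : IntegrableOn H (Ioo 0 T))
    (hyG : HasWeakDeriv T y G) (hzH : HasWeakDeriv T z H) {θ θ' : ℝ → ℂ}
    (hθ : ∀ t, HasDerivAt θ (θ' t) t) (hθ' : Continuous θ')
    (h0 : θ 0 = 0) (h1 : θ T = 0) :
    ∫ t in Ioo 0 T, (θ' t * (y t * z t) + θ t * (G t * z t + y t * H t)) = 0 ∧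
    IntegrableOn (fun t => θ' t * (y t * z t)) (Ioo 0 T) ∧
    IntegrableOn (fun t => θ t * (G t * z t + y t * H t)) (Ioo 0 T) := by
  have hd : ∀ c t, HasDerivAt (fun t => FracNS.cpart c (θ t)) (FracNS.cpart c (θ' t)) t := by
    intro c t
    have := (cpartL c).hasFDerivAt.comp_hasDerivAt t (hθ t)
    simpa only [Function.comp_def, cpartL_apply] using this
  have hdd : ∀ c, deriv (fun t => FracNS.cpart c (θ t)) = fun t => FracNS.cpart c (θ' t) :=
    fun c => funext fun t => (hd c t).deriv
  have hC1 : ∀ c, ContDiff ℝ 1 fun t => FracNS.cpart c (θ t) := by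
    intro c
    rw [contDiff_one_iff_deriv]
    refine ⟨fun t => (hd c t).differentiableAt, ?_⟩
    rw [hdd]
    simp only [← cpartL_apply]
    exact (cpartL c).continuous.comp hθ'
  have hint : ∀ {f : ℝ → ℂ}, IntegrableOn f (Ioo 0 T) → ∀ j,
      IntegrableOn (fun t => FracNS.cpart j (f t)) (Ioo 0 T) := by
    intro f hf j
    simp only [← cpartL_apply]
    exact (cpartL j).integrable_comp hf
  have key := fun a b c : Fin 2 => HasWeakDeriv.integral_mul_mul_real hT (hint hy a) (hint hz b)
    (hint hG a) (hint hH b) (hyG.cpart hy hG a) (hzH.cpart hz hH b) (hC1 c)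
    (by simp [h0, FracNS.cpart]) (by simp [h1, FracNS.cpart])
  simp only [hdd] at key
  -- The expressions are trilinear, so they split into the eight choices of real and imaginary
  -- parts, weighted by powers of i; each choice is an instance of the real product rule.
  have e1 : ∀ t, θ' t * (y t * z t) = ∑ a : Fin 2, ∑ b : Fin 2, ∑ c : Fin 2,
      Complex.I ^ (a + b + c : ℕ) * ((FracNS.cpart c (θ' t) *
        (FracNS.cpart a (y t) * FracNS.cpart b (z t)) : ℝ) : ℂ) := by
    intro t
    conv_lhs => rw [← sum_cpart (y t), ← sum_cpart (z t), ← sum_cpart (θ' t)]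
    simp only [Fin.sum_univ_two]; push_cast; ring
  have e2 : ∀ t, θ t * (G t * z t + y t * H t) = ∑ a : Fin 2, ∑ b : Fin 2, ∑ c : Fin 2,
      Complex.I ^ (a + b + c : ℕ) * ((FracNS.cpart c (θ t) *
        (FracNS.cpart a (G t) * FracNS.cpart b (z t) +
          FracNS.cpart a (y t) * FracNS.cpart b (H t)) : ℝ) : ℂ) := by
    intro t
    conv_lhs => rw [← sum_cpart (y t), ← sum_cpart (z t), ← sum_cpart (θ t), ← sum_cpart (G t),
      ← sum_cpart (H t)]
    simp only [Fin.sum_univ_two]; push_cast; ring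
  have i1 : ∀ a b c : Fin 2, IntegrableOn (fun t => Complex.I ^ (a + b + c : ℕ) *
      ((FracNS.cpart c (θ' t) * (FracNS.cpart a (y t) * FracNS.cpart b (z t)) : ℝ) : ℂ))
      (Ioo 0 T) := fun a b c => (key a b c).2.1.ofReal.const_mul _
  have i2 : ∀ a b c : Fin 2, IntegrableOn (fun t => Complex.I ^ (a + b + c : ℕ) *
      ((FracNS.cpart c (θ t) * (FracNS.cpart a (G t) * FracNS.cpart b (z t) +
          FracNS.cpart a (y t) * FracNS.cpart b (H t)) : ℝ) : ℂ))
      (Ioo 0 T) := fun a b c => (key a b c).2.2.ofReal.const_mul _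
  refine ⟨?_, ?_, ?_⟩
  · simp only [e1, e2, ← Finset.sum_add_distrib, ← mul_add, ← Complex.ofReal_add]
    have i3 : ∀ a b c : Fin 2, IntegrableOn (fun t => Complex.I ^ (a + b + c : ℕ) *
        ((FracNS.cpart c (θ' t) * (FracNS.cpart a (y t) * FracNS.cpart b (z t)) +
          FracNS.cpart c (θ t) * (FracNS.cpart a (G t) * FracNS.cpart b (z t) +
          FracNS.cpart a (y t) * FracNS.cpart b (H t)) : ℝ) : ℂ))
        (Ioo 0 T) := fun a b c =>
      (((key a b c).2.1.add (key a b c).2.2).ofReal (𝕜 := ℂ)).const_mul _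
    rw [integral_finsetSum _ fun a _ => integrable_finsetSum _ fun b _ =>
      integrable_finsetSum _ fun c _ => i3 a b c]
    refine Finset.sum_eq_zero fun a _ => ?_
    rw [integral_finsetSum _ fun b _ => integrable_finsetSum _ fun c _ => i3 a b c]
    refine Finset.sum_eq_zero fun b _ => ?_
    rw [integral_finsetSum _ fun c _ => i3 a b c]
    refine Finset.sum_eq_zero fun c _ => ?_
    rw [integral_const_mul, integral_complex_ofReal, (key a b c).1]
    simp
  · simp only [e1]
    exact integrable_finsetSum _ fun a _ => integrable_finsetSum _ fun b _ =>
      integrable_finsetSum _ fun c _ => i1 a b c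
  · simp only [e2]
    exact integrable_finsetSum _ fun a _ => integrable_finsetSum _ fun b _ =>
      integrable_finsetSum _ fun c _ => i2 a b c

open scoped ComplexConjugate

/-! ### The fractional Laplacian in Fourier variables -/

/-- The symbol `|2πk|^{2σ}` of `A^σ`. -/
def wt (σ : ℝ) (k : Fin 3 → ℤ) : ℝ := (2 * Real.pi * ‖freq k‖) ^ (2 * σ)

lemma wt_nonneg (σ : ℝ) (k : Fin 3 → ℤ) : 0 ≤ wt σ k := by unfold wt; positivity

lemma fracCoeff_eq (σ : ℝ) (f : T3 → ℝ) (k : Fin 3 → ℤ) :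
    fracCoeff σ f k = (wt σ k : ℂ) * coeff f k := rfl

lemma freq_neg (k : Fin 3 → ℤ) : freq (-k) = -freq k := by ext i; simp [freq]

lemma freq_add (k l : Fin 3 → ℤ) : freq (k + l) = freq k + freq l := by ext i; simp [freq]

lemma wt_neg (σ : ℝ) (k : Fin 3 → ℤ) : wt σ (-k) = wt σ k := by simp [wt, freq_neg]

lemma coeff_neg (f : T3 → ℝ) (k : Fin 3 → ℤ) : coeff f (-k) = conj (coeff f k) := by
  unfold coeff
  rw [← integral_conj]
  congr 1; ext x
  rw [map_mul, ← UnitAddTorus.mFourier_neg, Complex.conj_ofReal]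

lemma fc_conj (f : T3 → ℂ) (k : Fin 3 → ℤ) : fc (fun x => conj (f x)) k = conj (fc f (-k)) := by
  unfold fc
  rw [← integral_conj]
  congr 1; ext x
  rw [map_mul, ← UnitAddTorus.mFourier_neg, neg_neg]

lemma Lp_ext_fc {f g : Lp ℂ 2 torusVol} (h : ∀ k, fc f k = fc g k) : f = g := by
  refine (UnitAddTorus.mFourierBasis (d := Fin 3)).repr.injective ?_
  ext k
  exact (UnitAddTorus.mFourierBasis_repr f k).trans
    ((h k).trans (UnitAddTorus.mFourierBasis_repr g k).symm)

lemma fc_fracLapL2 {σ : ℝ} {f : T3 → ℝ} (hf : Memℓp (fracCoeff σ f) 2) (k : Fin 3 → ℤ) :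
    fc (fracLapL2 σ f) k = fracCoeff σ f k := by
  have h := UnitAddTorus.mFourierBasis_repr (d := Fin 3) (fracLapL2 σ f) k
  rw [fracLapL2, dif_pos hf] at h ⊢
  rw [LinearIsometryEquiv.apply_symm_apply] at h
  exact h.symm

lemma fracLapL2_zero (σ : ℝ) : fracLapL2 σ (fun _ => 0) = 0 := by
  unfold fracLapL2
  split_ifs with h
  · have : (⟨fracCoeff σ fun _ => 0, h⟩ : lp (fun _ : Fin 3 → ℤ => ℂ) 2) = 0 := by
      ext l
      simp [fracCoeff, coeff]
    rw [this, map_zero]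
  · rfl

/-- The weight is even and the coefficients of a real function are Hermitian, so `fracLapL2 σ f` and
its conjugate have the same Fourier coefficients. Taking real parts in `fracLap` therefore loses
nothing. -/
lemma fracLapL2_im_ae {σ : ℝ} {f : T3 → ℝ} (hf : Memℓp (fracCoeff σ f) 2) :
    ∀ᵐ x ∂torusVol, (fracLapL2 σ f x : ℂ) = ((fracLapL2 σ f x).re : ℂ) := by
  set F := fracLapL2 σ f
  have hF : MemLp F 2 torusVol := Lp.memLp F
  have hc : MemLp (fun x => conj (F x)) 2 torusVol := hF.star
  have e : F = hc.toLp _ := by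
    refine Lp_ext_fc fun k => ?_
    rw [fc_congr hc.coeFn_toLp, fc_conj, fc_fracLapL2 hf, fc_fracLapL2 hf, fracCoeff_eq,
      fracCoeff_eq, wt_neg, coeff_neg, map_mul, Complex.conj_ofReal, Complex.conj_conj]
  have h2 := hc.coeFn_toLp
  rw [← e] at h2
  filter_upwards [h2] with x hx
  exact (Complex.conj_eq_iff_re.1 hx.symm).symm

lemma memLp_fracLapL2_re (σ : ℝ) (f : T3 → ℝ) :
    MemLp (fun x => (fracLapL2 σ f x).re) 2 torusVol := (Lp.memLp (fracLapL2 σ f)).re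

lemma integrable_fracLapL2_mul (σ : ℝ) (f g : T3 → ℝ) :
    Integrable (fun x => (fracLapL2 σ f x).re * (fracLapL2 σ g x).re) torusVol :=
  (memLp_fracLapL2_re σ f).integrable_mul (memLp_fracLapL2_re σ g)

/-- Parseval's identity for the fractional Laplacian. -/
lemma hasSum_fracLapL2_mul {σ : ℝ} {f g : T3 → ℝ} (hf : Memℓp (fracCoeff σ f) 2)
    (hg : Memℓp (fracCoeff σ g) 2) :
    HasSum (fun k => conj (fracCoeff σ f k) * fracCoeff σ g k)
      ((∫ x, (fracLapL2 σ f x).re * (fracLapL2 σ g x).re ∂torusVol : ℝ) : ℂ) := by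
  have h := UnitAddTorus.hasSum_prod_mFourierCoeff (d := Fin 3) (fracLapL2 σ f) (fracLapL2 σ g)
  have e1 : ∀ k, UnitAddTorus.mFourierCoeff (fracLapL2 σ f) k = fracCoeff σ f k :=
    fun k => fc_fracLapL2 hf k
  have e2 : ∀ k, UnitAddTorus.mFourierCoeff (fracLapL2 σ g) k = fracCoeff σ g k :=
    fun k => fc_fracLapL2 hg k
  simp only [e1, e2] at h
  have e3 : ((∫ x, (fracLapL2 σ f x).re * (fracLapL2 σ g x).re ∂torusVol : ℝ) : ℂ) =
      ∫ x, conj (fracLapL2 σ f x : ℂ) * (fracLapL2 σ g x : ℂ) ∂torusVol := by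
    rw [← integral_complex_ofReal]
    refine integral_congr_ae ?_
    filter_upwards [fracLapL2_im_ae hf, fracLapL2_im_ae hg] with x h1 h2
    rw [h1, h2]; simp
  rw [e3]
  exact h

/-- Parseval's identity for real functions. -/
lemma hasSum_coeff_mul {f g : T3 → ℝ} (hf : MemLp f 2 torusVol) (hg : MemLp g 2 torusVol) :
    HasSum (fun k => conj (coeff f k) * coeff g k) ((∫ x, f x * g x ∂torusVol : ℝ) : ℂ) := by
  have hf' : MemLp (fun x => (f x : ℂ)) 2 torusVol := hf.ofReal
  have hg' : MemLp (fun x => (g x : ℂ)) 2 torusVol := hg.ofReal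
  have h := UnitAddTorus.hasSum_prod_mFourierCoeff (d := Fin 3) (hf'.toLp _) (hg'.toLp _)
  have e1 : ∀ k, UnitAddTorus.mFourierCoeff (hf'.toLp _) k = coeff f k :=
    fun k => fc_congr hf'.coeFn_toLp k
  have e2 : ∀ k, UnitAddTorus.mFourierCoeff (hg'.toLp _) k = coeff g k :=
    fun k => fc_congr hg'.coeFn_toLp k
  simp only [e1, e2] at h
  have e3 : ((∫ x, f x * g x ∂torusVol : ℝ) : ℂ) =
      ∫ x, conj (hf'.toLp _ x : ℂ) * (hg'.toLp _ x : ℂ) ∂torusVol := by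
    rw [← integral_complex_ofReal]
    refine integral_congr_ae ?_
    filter_upwards [hf'.coeFn_toLp, hg'.coeFn_toLp] with x h1 h2
    rw [h1, h2]; simp
  rw [e3]
  exact h

/-- Pairing with a trigonometric polynomial whose frequencies all have the same modulus. -/
lemma integral_fracLapL2_mul_of_spectrum {σ : ℝ} {f g : T3 → ℝ} (hf : Memℓp (fracCoeff σ f) 2)
    (hf2 : MemLp f 2 torusVol) (hg2 : MemLp g 2 torusVol) {S : Finset (Fin 3 → ℤ)}
    (hS : ∀ l ∉ S, coeff g l = 0) {k : Fin 3 → ℤ} (hk : ∀ l ∈ S, wt σ l = wt σ k) :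
    ∫ x, (fracLapL2 σ f x).re * (fracLapL2 σ g x).re ∂torusVol =
      wt σ k ^ 2 * ∫ x, f x * g x ∂torusVol := by
  have hg : Memℓp (fracCoeff σ g) 2 := by
    refine (memℓp_zero ?_).of_exponent_ge zero_le
    refine S.finite_toSet.subset fun l hl => ?_
    by_contra h
    exact hl (by rw [fracCoeff_eq, hS l h, mul_zero])
  have h1 := hasSum_fracLapL2_mul hf hg
  have h2 := (hasSum_coeff_mul hf2 hg2).mul_left ((wt σ k : ℂ) ^ 2)
  have e : (fun l => conj (fracCoeff σ f l) * fracCoeff σ g l) =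
      fun l => (wt σ k : ℂ) ^ 2 * (conj (coeff f l) * coeff g l) := by
    funext l
    by_cases hl : l ∈ S
    · rw [fracCoeff_eq, fracCoeff_eq, hk l hl, map_mul, Complex.conj_ofReal]; ring
    · rw [fracCoeff_eq, fracCoeff_eq, hS l hl]; simp
  rw [e] at h1
  have := h1.unique h2
  exact_mod_cast this

/-! ### Sobolev weights -/

/-- The weight `(1 + |2πk|²)^{s/2}`. -/
def jap (s : ℝ) (k : Fin 3 → ℤ) : ℝ := (1 + (2 * Real.pi * ‖freq k‖) ^ 2) ^ (s / 2)

lemma jap_pos (s : ℝ) (k : Fin 3 → ℤ) : 0 < jap s k := by unfold jap; positivity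

lemma jap_neg (s : ℝ) (k : Fin 3 → ℤ) : jap s (-k) = jap s k := by simp [jap, freq_neg]

lemma wt_le_jap {s : ℝ} (hs : 0 ≤ s) (k : Fin 3 → ℤ) : wt (s / 2) k ≤ jap s k := by
  unfold wt jap
  set x := 2 * Real.pi * ‖freq k‖
  have hx : 0 ≤ x := by positivity
  have e : x ^ (2 * (s / 2)) = (x ^ 2) ^ (s / 2) := by
    rw [Real.rpow_mul hx]; norm_num
  rw [e]
  exact Real.rpow_le_rpow (by positivity) (by linarith) (by linarith)

/-- Peetre's inequality, from 1 + (a + b)² ≤ 2(1 + a²)(1 + b²). -/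
lemma jap_add_le {s : ℝ} (hs : 0 ≤ s) (k l : Fin 3 → ℤ) :
    jap s (k + l) ≤ 2 ^ (s / 2) * jap s k * jap s l := by
  unfold jap
  rw [← Real.mul_rpow (by norm_num) (by positivity), ← Real.mul_rpow (by positivity) (by positivity)]
  refine Real.rpow_le_rpow (by positivity) ?_ (by linarith)
  rw [freq_add]
  set a := 2 * Real.pi * ‖freq k‖
  set b := 2 * Real.pi * ‖freq l‖
  have h : 2 * Real.pi * ‖freq k + freq l‖ ≤ a + b := by
    have := norm_add_le (freq k) (freq l)
    simp only [a, b]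
    nlinarith [Real.pi_pos]
  have h0 : 0 ≤ 2 * Real.pi * ‖freq k + freq l‖ := by positivity
  nlinarith [sq_nonneg (a - b), mul_nonneg (sq_nonneg a) (sq_nonneg b), sq_nonneg a, sq_nonneg b]

lemma sobolevSq_eq (s : ℝ) (f : T3 → ℝ) :
    sobolevSq s f = ∑' k, ENNReal.ofReal (jap s k * ‖coeff f k‖) ^ 2 := by
  unfold sobolevSq
  refine tsum_congr fun k => ?_
  rw [ENNReal.ofReal_mul (jap_pos s k).le, mul_pow (ENNReal.ofReal _), ofReal_norm,
    ← ENNReal.ofReal_pow (jap_pos s k).le]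
  congr 2
  rw [jap, ← Real.rpow_mul_natCast (by positivity)]
  congr 1; push_cast; ring

lemma memℓp_fracCoeff_of_tsum {s : ℝ} (hs : 0 ≤ s) {f : T3 → ℝ}
    (h : ∑' k, ENNReal.ofReal (jap s k * ‖coeff f k‖) ^ 2 ≠ ⊤) :
    Memℓp (fracCoeff (s / 2) f) 2 := by
  refine memℓp_gen ?_
  have h2 : ∀ k, 0 ≤ (jap s k * ‖coeff f k‖) ^ 2 := fun k => by positivity
  have h3 : Summable fun k => (jap s k * ‖coeff f k‖) ^ 2 := by
    have := ENNReal.summable_toReal h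
    refine this.congr fun k => ?_
    rw [ENNReal.toReal_pow, ENNReal.toReal_ofReal (mul_nonneg (jap_pos s k).le (norm_nonneg _))]
  refine h3.of_nonneg_of_le (fun k => by positivity) fun k => ?_
  rw [ENNReal.toReal_ofNat, Real.rpow_ofNat]
  refine pow_le_pow_left₀ (norm_nonneg _) ?_ 2
  rw [fracCoeff_eq, norm_mul, Complex.norm_real, Real.norm_of_nonneg (wt_nonneg _ _)]
  gcongr
  exact wt_le_jap hs k

/-! ### Products with smooth functions -/

/-- Expand ψ in its absolutely convergent Fourier series and integrate term by term against f, which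
needs to be only integrable. -/
lemma hasSum_fc_mul {ψ f : T3 → ℂ} (hψ : Continuous ψ) (hs : Summable fun k => ‖fc ψ k‖)
    (hf : Integrable f torusVol) (k : Fin 3 → ℤ) :
    HasSum (fun l => fc ψ l * fc f (k - l)) (fc (fun x => ψ x * f x) k) := by
  have hser : ∀ x, HasSum (fun l => fc ψ l * mFourier l x) (ψ x) := fun x =>
    UnitAddTorus.hasSum_mFourier_series_apply_of_summable (f := ⟨ψ, hψ⟩) hs.of_norm x
  have hF : ∀ l, Integrable (fun x => fc ψ l * (mFourier (-(k - l)) x * f x)) torusVol :=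
    fun l => (integrable_mFourier_mul hf _).const_mul _
  have h := hasSum_integral_of_summable_integral_norm hF (by
    refine (hs.mul_right (∫ x, ‖f x‖ ∂torusVol)).congr fun l => ?_
    rw [← integral_const_mul]
    congr 1; ext x
    rw [norm_mul, norm_mul, norm_mFourier_apply, one_mul])
  have e : ∀ x, ∑' l, fc ψ l * (mFourier (-(k - l)) x * f x) = mFourier (-k) x * (ψ x * f x) := by
    intro x
    have : ∀ l, fc ψ l * (mFourier (-(k - l)) x * f x) =
        (fc ψ l * mFourier l x) * (mFourier (-k) x * f x) := by
      intro l
      rw [show -(k - l) = -k + l by abel, UnitAddTorus.mFourier_add]; ring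
    simp only [this]
    rw [tsum_mul_right, (hser x).tsum_eq]; ring
  simp only [e, integral_const_mul] at h
  exact h

lemma dsym_sq_sum (k : Fin 3 → ℤ) :
    ∑ i, dsym i k * dsym i k = -(((2 * Real.pi * ‖freq k‖) ^ 2 : ℝ) : ℂ) := by
  have : ‖freq k‖ ^ 2 = ∑ i, (k i : ℝ) ^ 2 := by
    rw [EuclideanSpace.norm_sq_eq]; simp [freq]
  rw [mul_pow, this]
  push_cast
  rw [Finset.mul_sum, ← Finset.sum_neg_distrib]
  refine Finset.sum_congr rfl fun i _ => ?_
  simp only [dsym]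
  linear_combination (4 * (Real.pi : ℂ) ^ 2 * (k i : ℂ) ^ 2) * Complex.I_sq

/-- The operator `1 - Δ`. -/
def helm (f : T3 → ℂ) (x : T3) : ℂ := f x + ∑ i, -(tderiv i (tderiv i f) x)

lemma fc_helm {f : T3 → ℂ} (hf : TSmooth f) (k : Fin 3 → ℤ) :
    fc (helm f) k = ((1 + (2 * Real.pi * ‖freq k‖) ^ 2 : ℝ) : ℂ) * fc f k := by
  have hi : ∀ i, Integrable (fun x => -(tderiv i (tderiv i f) x)) torusVol := fun i =>
    ((hf.tderiv i).tderiv i).integrable.neg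
  have e1 : ∀ i, fc (fun x => -(tderiv i (tderiv i f) x)) k = -(dsym i k * dsym i k) * fc f k := by
    intro i
    have : fc (fun x => -(tderiv i (tderiv i f) x)) k = -fc (tderiv i (tderiv i f)) k := by
      have := fc_const_mul (-1) (tderiv i (tderiv i f)) k
      simpa using this
    rw [this, fc_tderiv (hf.tderiv i), fc_tderiv hf]; ring
  have e2 : fc (helm f) k = fc f k + fc (fun x => ∑ i, -(tderiv i (tderiv i f) x)) k :=
    fc_add hf.integrable (integrable_finsetSum _ fun i _ => hi i) k
  have e3 : fc (fun x => ∑ i, -(tderiv i (tderiv i f) x)) k =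
      ∑ i, fc (fun x => -(tderiv i (tderiv i f) x)) k := by
    simp only [fc, Finset.mul_sum]
    exact integral_finsetSum _ fun i _ => integrable_mFourier_mul (hi i) _
  rw [e2, e3]
  simp only [e1]
  rw [← Finset.sum_mul, Finset.sum_neg_distrib, dsym_sq_sum]
  push_cast; ring

lemma SmoothST.helm {ψ : ℝ → T3 → ℂ} (h : SmoothST ψ) : SmoothST fun t => helm (ψ t) := by
  refine ContDiff.add h (ContDiff.sum fun i _ => ContDiff.neg ?_)
  exact (h.tderiv i).tderiv i

/-- Each application of 1 - Δ multiplies the k-th coefficient by 1 + |2πk|² and preserves smoothness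
in space-time, so one may induct on M. Uniformity in time comes from compactness of [a, b] × 𝕋³. -/
lemma SmoothST.exists_norm_fc_le {ψ : ℝ → T3 → ℂ} (h : SmoothST ψ) (a b : ℝ) (M : ℕ) :
    ∃ C : ℝ≥0, ∀ t ∈ Icc a b, ∀ k,
      (1 + (2 * Real.pi * ‖freq k‖) ^ 2) ^ M * ‖fc (ψ t) k‖ ≤ C := by
  induction M generalizing ψ with
  | zero =>
    obtain ⟨C, hC⟩ := h.exists_bound a b
    refine ⟨C, fun t ht k => ?_⟩
    rw [pow_zero, one_mul]
    refine (norm_integral_le_of_norm_le_const (C := C) (ae_of_all _ fun x => ?_)).trans ?_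
    · rw [norm_mul, norm_mFourier_apply, one_mul]; exact hC t ht x
    · simp
  | succ M ih =>
    obtain ⟨C, hC⟩ := ih h.helm
    refine ⟨C, fun t ht k => ?_⟩
    have := hC t ht k
    rw [fc_helm (h.tsmooth t), norm_mul, Complex.norm_real, Real.norm_of_nonneg (by positivity)]
      at this
    rw [pow_succ, mul_assoc]; exact this

/-- The cube of 1 + |2πk|² dominates the product of the three factors 1 + kᵢ², so the sum over ℤ³ is
bounded by a product of three convergent sums over ℤ. -/
lemma summable_weight : Summable fun k : Fin 3 → ℤ =>
    ((1 + (2 * Real.pi * ‖freq k‖) ^ 2) ^ 3)⁻¹ := by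
  set g : ℤ → ℝ := fun n => (1 + (n : ℝ) ^ 2)⁻¹
  have hg0 : ∀ n, 0 ≤ g n := fun n => by positivity
  have hg : Summable g := by
    have h := Real.summable_one_div_int_pow.2 (one_lt_two)
    refine h.of_norm_bounded_eventually ?_
    have : ∀ᶠ n : ℤ in cofinite, n ≠ 0 :=
      (Set.finite_singleton (0 : ℤ)).compl_mem_cofinite
    filter_upwards [this] with n hn
    rw [Real.norm_of_nonneg (hg0 n), one_div]
    have : 0 < (n : ℝ) ^ 2 := by positivity
    exact inv_anti₀ this (by linarith)
  have h2 : Summable fun q : (ℤ × ℤ) × ℤ => g q.1.1 * g q.1.2 * g q.2 :=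
    (hg.mul_of_nonneg hg hg0 hg0).mul_of_nonneg hg (fun q => mul_nonneg (hg0 _) (hg0 _)) hg0
  have h3 : Function.Injective fun k : Fin 3 → ℤ => ((k 0, k 1), k 2) := by
    intro k l h
    simp only [Prod.mk.injEq] at h
    funext i; fin_cases i
    · exact h.1.1
    · exact h.1.2
    · exact h.2
  refine (h2.comp_injective h3).of_nonneg_of_le (fun k => by positivity) fun k => ?_
  have hk : ∀ i, 1 + (k i : ℝ) ^ 2 ≤ 1 + (2 * Real.pi * ‖freq k‖) ^ 2 := by
    intro i
    have h1 : ‖freq k‖ ^ 2 = ∑ i, (k i : ℝ) ^ 2 := by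
      rw [EuclideanSpace.norm_sq_eq]; simp [freq]
    have h2 : (k i : ℝ) ^ 2 ≤ ‖freq k‖ ^ 2 := by
      rw [h1]
      exact Finset.single_le_sum (f := fun i => (k i : ℝ) ^ 2) (fun _ _ => sq_nonneg _)
        (Finset.mem_univ i)
    have h4 : (1 : ℝ) ≤ (2 * Real.pi) ^ 2 := by nlinarith [Real.pi_gt_three]
    rw [mul_pow]
    nlinarith [sq_nonneg ‖freq k‖]
  simp only [Function.comp_apply, g]
  rw [← mul_inv, ← mul_inv]
  refine inv_anti₀ (by positivity) ?_
  rw [show ∀ x : ℝ, x ^ 3 = x * x * x from fun x => by ring]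
  exact mul_le_mul (mul_le_mul (hk 0) (hk 1) (by positivity) (by positivity)) (hk 2)
    (by positivity) (by positivity)

/-- Rapid decay of the Fourier coefficients of smooth functions, uniformly in time. -/
lemma SmoothST.exists_summable_bound {ψ : ℝ → T3 → ℂ} (h : SmoothST ψ) (a b s : ℝ) :
    ∃ A : (Fin 3 → ℤ) → ℝ, (∀ k, 0 ≤ A k) ∧ Summable A ∧ (∀ k, A (-k) = A k) ∧
      ∀ t ∈ Icc a b, ∀ k, jap s k * ‖fc (ψ t) k‖ ≤ A k := by
  obtain ⟨M, hM⟩ := exists_nat_ge (s / 2)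
  -- M powers absorb the Sobolev weight, since M ≥ s/2; three more make the bound summable over ℤ³.
  obtain ⟨C, hC⟩ := h.exists_norm_fc_le a b (M + 3)
  refine ⟨fun k => C * ((1 + (2 * Real.pi * ‖freq k‖) ^ 2) ^ 3)⁻¹, fun k => by positivity,
    summable_weight.mul_left _, fun k => by simp [freq_neg], fun t ht k => ?_⟩
  have h1 := hC t ht k
  set x := 1 + (2 * Real.pi * ‖freq k‖) ^ 2 with hx
  have hx1 : 1 ≤ x := by rw [hx]; linarith [sq_nonneg (2 * Real.pi * ‖freq k‖)]
  have h2 : jap s k ≤ x ^ M := by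
    unfold jap
    rw [← hx, ← Real.rpow_natCast]
    exact Real.rpow_le_rpow_of_exponent_le hx1 hM
  change _ ≤ C * (x ^ 3)⁻¹
  rw [← div_eq_mul_inv, le_div_iff₀ (by positivity)]
  calc jap s k * ‖fc (ψ t) k‖ * x ^ 3 ≤ x ^ M * ‖fc (ψ t) k‖ * x ^ 3 := by gcongr
    _ = x ^ (M + 3) * ‖fc (ψ t) k‖ := by rw [pow_add]; ring
    _ ≤ C := h1

lemma one_le_jap {s : ℝ} (hs : 0 ≤ s) (k : Fin 3 → ℤ) : 1 ≤ jap s k := by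
  unfold jap
  exact Real.one_le_rpow (by linarith [sq_nonneg (2 * Real.pi * ‖freq k‖)]) (by linarith)

/-- Multiplication by a smooth function preserves Sobolev regularity. -/
lemma tsum_jap_mul_ne_top {s : ℝ} (hs : 0 ≤ s) {ψ : T3 → ℂ} {f : T3 → ℂ} (hψ : Continuous ψ)
    (hf : Integrable f torusVol) {A : (Fin 3 → ℤ) → ℝ} (hA : Summable A)
    (hψA : ∀ k, jap s k * ‖fc ψ k‖ ≤ A k)
    (h : ∑' k, ENNReal.ofReal (jap s k * ‖fc f k‖) ^ 2 ≠ ⊤) :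
    ∑' k, ENNReal.ofReal (jap s k * ‖fc (fun x => ψ x * f x) k‖) ^ 2 ≠ ⊤ := by
  set X : (Fin 3 → ℤ) → ℝ≥0∞ := fun k => ENNReal.ofReal (jap s k * ‖fc f k‖)
  set a : (Fin 3 → ℤ) → ℝ≥0∞ := fun k => ENNReal.ofReal (A k)
  have hA0 : ∀ k, 0 ≤ A k := fun k =>
    (mul_nonneg (jap_pos s k).le (norm_nonneg _)).trans (hψA k)
  have ha : ∑' k, a k ≠ ⊤ := hA.tsum_ofReal_ne_top
  have hsum : Summable fun k => ‖fc ψ k‖ := hA.of_nonneg_of_le (fun _ => norm_nonneg _) fun k =>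
    (le_mul_of_one_le_left (norm_nonneg _) (one_le_jap hs k)).trans (hψA k)
  set c := ENNReal.ofReal ((2 : ℝ) ^ (s / 2))
  -- Peetre's inequality for k = l + (k - l) distributes the weight over both factors of the
  -- convolution.
  have key : ∀ k, ENNReal.ofReal (jap s k * ‖fc (fun x => ψ x * f x) k‖) ≤
      c * ∑' l, a l * X (k - l) := by
    intro k
    rw [← (hasSum_fc_mul hψ hsum hf k).tsum_eq, ENNReal.ofReal_mul (jap_pos s k).le, ofReal_norm,
      ← ENNReal.tsum_mul_left]
    refine (mul_le_mul_right (enorm_tsum_le_tsum_enorm) _).trans ?_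
    rw [← ENNReal.tsum_mul_left]
    refine ENNReal.tsum_le_tsum fun l => ?_
    simp only [c, a, X]
    rw [← ofReal_norm, norm_mul, ← ENNReal.ofReal_mul (jap_pos s k).le,
      ← ENNReal.ofReal_mul (hA0 l), ← ENNReal.ofReal_mul (by positivity)]
    refine ENNReal.ofReal_le_ofReal ?_
    have h1 := jap_add_le hs l (k - l)
    rw [add_sub_cancel] at h1
    calc jap s k * (‖fc ψ l‖ * ‖fc f (k - l)‖)
        ≤ (2 ^ (s / 2) * jap s l * jap s (k - l)) * (‖fc ψ l‖ * ‖fc f (k - l)‖) := by gcongr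
      _ = 2 ^ (s / 2) * ((jap s l * ‖fc ψ l‖) * (jap s (k - l) * ‖fc f (k - l)‖)) := by ring
      _ ≤ _ := by
          have := (jap_pos s (k - l)).le
          gcongr
          exact hψA l
  -- Cauchy–Schwarz with weight a. Summed over k it bounds the convolution of an ℓ¹ with an ℓ²
  -- sequence in ℓ².
  have young : ∀ k, (∑' l, a l * X (k - l)) ^ 2 ≤ (∑' l, a l) * ∑' l, a l * X (k - l) ^ 2 := by
    intro k
    have := lintegral_mul_rpow_le (μ := (Measure.count : Measure (Fin 3 → ℤ))) (p := 2)
      (by norm_num) (k := a) (h := fun l => X (k - l)) (measurable_of_countable _).aemeasurable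
      (measurable_of_countable _).aemeasurable
    simp only [lintegral_count, show (2 : ℝ) - 1 = 1 by norm_num, ENNReal.rpow_one,
      ENNReal.rpow_two] at this
    exact this
  have total : ∑' k, ENNReal.ofReal (jap s k * ‖fc (fun x => ψ x * f x) k‖) ^ 2 ≤
      c ^ 2 * ((∑' l, a l) * ((∑' l, a l) * ∑' k, X k ^ 2)) := by
    calc _ ≤ ∑' k, c ^ 2 * ((∑' l, a l) * ∑' l, a l * X (k - l) ^ 2) := by
          refine ENNReal.tsum_le_tsum fun k => ?_
          refine (pow_le_pow_left₀ zero_le (key k) 2).trans ?_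
          rw [mul_pow]
          exact mul_le_mul_right (young k) _
      _ = c ^ 2 * ((∑' l, a l) * ∑' l, ∑' k, a l * X (k - l) ^ 2) := by
          rw [ENNReal.tsum_mul_left, ENNReal.tsum_mul_left, ENNReal.tsum_comm]
      _ = _ := by
          congr 2
          have : ∀ l, ∑' k, a l * X (k - l) ^ 2 = a l * ∑' k, X k ^ 2 := fun l => by
            rw [ENNReal.tsum_mul_left]
            congr 1
            exact (Equiv.subRight l).tsum_eq fun k => X k ^ 2
          simp only [this]
          rw [ENNReal.tsum_mul_right]
  refine (total.trans_lt ?_).ne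
  refine ENNReal.mul_lt_top (by simp [c]) (ENNReal.mul_lt_top ha.lt_top
    (ENNReal.mul_lt_top ha.lt_top h.lt_top))

/-! ### The equations in Fourier variables -/

/-- The Fourier coefficients of the time slices of a function on space-time. -/
def fct (F : ℝ × T3 → ℂ) (k : Fin 3 → ℤ) (t : ℝ) : ℂ := fc (fun x => F (t, x)) k

lemma aestronglyMeasurable_fct {T : ℝ} {F : ℝ × T3 → ℂ}
    (hF : AEStronglyMeasurable F (spaceTime T)) (k : Fin 3 → ℤ) :
    AEStronglyMeasurable (fct F k) ((volume : Measure ℝ).restrict (Ioo 0 T)) := by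
  have : AEStronglyMeasurable (fun p : ℝ × T3 => mFourier (-k) p.2 * F p) (spaceTime T) :=
    (((mFourier (-k)).continuous.comp continuous_snd).aestronglyMeasurable).mul hF
  exact this.integral_prod_right'

lemma integrable_continuous_mul {T : ℝ} {E : Type*} [NormedRing E] {F : ℝ × T3 → E}
    [SecondCountableTopology E]
    (hF : Integrable F (spaceTime T)) {g : ℝ × T3 → E} (hg : Continuous g) {C : ℝ}
    (hC : ∀ p, ‖g p‖ ≤ C) : Integrable (fun p => g p * F p) (spaceTime T) :=
  hF.bdd_mul hg.aestronglyMeasurable (ae_of_all _ hC)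

lemma integrableOn_fct {T : ℝ} {F : ℝ × T3 → ℂ} (hF : Integrable F (spaceTime T))
    (k : Fin 3 → ℤ) : IntegrableOn (fct F k) (Ioo 0 T) :=
  (integrable_continuous_mul hF ((mFourier (-k)).continuous.comp continuous_snd) (C := 1)
    fun p => (norm_mFourier_apply (-k) p.2).le).integral_prod_left

lemma IsLerayHopf.ae_memLp {ν s T : ℝ} {u₀ : T3 → E3} {u : ℝ → T3 → E3} {P : ℝ → T3 → ℝ}
    (hu : IsLerayHopf ν s T u₀ u P) :
    ∀ᵐ t ∂(volume : Measure ℝ).restrict (Ioo 0 T), MemLp (u t) 2 torusVol := by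
  obtain ⟨M, hM⟩ := hu.bounded
  filter_upwards [hM, hu.meas.prodMk_left] with t h1 h2
  exact ⟨h2, h1.trans_lt ENNReal.coe_lt_top⟩

lemma memLp_coord {p : ℝ≥0∞} {v : T3 → E3} (h : MemLp v p torusVol) (i : Fin 3) :
    MemLp (fun x => v x i) p torusVol :=
  (EuclideanSpace.proj (𝕜 := ℝ) i).comp_memLp' h

lemma IsLerayHopf.aemeasurable_sobolevSq {ν s T : ℝ} {u₀ : T3 → E3} {u : ℝ → T3 → E3}
    {P : ℝ → T3 → ℝ} (hu : IsLerayHopf ν s T u₀ u P) (i : Fin 3) :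
    AEMeasurable (fun t => sobolevSq s (fun x => u t x i))
      ((volume : Measure ℝ).restrict (Ioo 0 T)) := by
  refine AEMeasurable.tsum fun k => AEMeasurable.const_mul ?_ _
  exact ((aestronglyMeasurable_fct (aestronglyMeasurable_comp hu.meas i) k).enorm).pow_const 2

lemma IsLerayHopf.ae_sobolevSq_lt_top {ν s T : ℝ} {u₀ : T3 → E3} {u : ℝ → T3 → E3}
    {P : ℝ → T3 → ℝ} (hu : IsLerayHopf ν s T u₀ u P) :
    ∀ᵐ t ∂(volume : Measure ℝ).restrict (Ioo 0 T), ∀ i, sobolevSq s (fun x => u t x i) < ⊤ :=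
  ae_all_iff.2 fun i => ae_lt_top' (hu.aemeasurable_sobolevSq i) (hu.sobolev i).ne

lemma spaceTime_mono {T' T : ℝ} (h : T' ≤ T) : spaceTime T' ≤ spaceTime T :=
  Measure.prod_mono (Measure.restrict_mono (Ioo_subset_Ioo_right h) le_rfl) le_rfl

lemma TSmooth.memLp {F : Type*} [NormedAddCommGroup F] [NormedSpace ℝ F]
    [SecondCountableTopology F] {b : T3 → F} (hb : TSmooth b) (p : ℝ≥0∞) : MemLp b p torusVol := by
  obtain ⟨C, hC⟩ := hb.exists_bound
  exact MemLp.of_bound hb.continuous.aestronglyMeasurable C (ae_of_all _ hC)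

/-- The spatial tests of the momentum equation by `b eᵢ`, where the spectrum of `b` lies in a
sphere. -/
lemma IsLerayHopf.hasWeakDeriv_integral_mul {ν s T : ℝ} {u₀ : T3 → E3} {u : ℝ → T3 → E3}
    {P : ℝ → T3 → ℝ} (hu : IsLerayHopf ν s T u₀ u P) (hs : 0 ≤ s) {T' : ℝ} (hT' : T' < T)
    (hu2 : ∀ i, MemLp (fun p : ℝ × T3 => u p.1 p.2 i) 2 (spaceTime T))
    {b : T3 → ℝ} (hb : TSmooth b) {S : Finset (Fin 3 → ℤ)} (hS : ∀ l ∉ S, coeff b l = 0)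
    {k : Fin 3 → ℤ} (hk : ∀ l ∈ S, wt (s / 2) l = wt (s / 2) k) (i : Fin 3) :
    HasWeakDeriv T' (fun t => ∫ x, b x * u t x i ∂torusVol)
      (fun t => -ν * (wt (s / 2) k ^ 2 * ∫ x, b x * u t x i ∂torusVol)
        + ∑ j, ∫ x, tderiv j b x * (u t x j * u t x i) ∂torusVol
        + ∫ x, tderiv i b x * P t x ∂torusVol) := by
  intro θ hθ
  obtain ⟨hθs, a, b', ha, hb', hab⟩ := hθ
  -- Separated test field θ(t) b(x) eᵢ. As θ vanishes near 0, the initial datum does not appear.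
  set ψ : ℝ → T3 → E3 := fun t x => (θ t * b x) • EuclideanSpace.single i 1 with hψ
  have hψj : ∀ t x j, ψ t x j = (θ t * if j = i then 1 else 0) * b x := by
    intro t x j
    simp only [hψ, PiLp.smul_apply, PiLp.single_apply, smul_eq_mul]
    split_ifs <;> ring
  have hsm : SmoothST ψ := by
    refine ContDiff.smul (ContDiff.mul (𝔸 := ℝ) ?_ ?_) contDiff_const
    · exact hθs.comp contDiff_fst
    · exact (show ContDiff ℝ ∞ fun y : E3 => b (toTorus y) from hb).comp contDiff_snd
  have hθ0 : ∀ t, t ∉ Ioo 0 T' → θ t = 0 := fun t ht => hab t (by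
    by_contra h
    push Not at h
    exact ht ⟨ha.trans h.1, h.2.trans hb'⟩)
  have hθ'0 : ∀ t, t ∉ Ioo 0 T' → deriv θ t = 0 := by
    intro t ht
    have : θ =ᶠ[𝓝 t] fun _ => 0 := by
      rcases not_and_or.1 ht with h | h
      · filter_upwards [Iio_mem_nhds (show t < a by linarith)] with r hr
        exact hab r (Or.inl (le_of_lt hr))
      · filter_upwards [Ioi_mem_nhds (show b' < t by linarith)] with r hr
        exact hab r (Or.inr (le_of_lt hr))
    rw [this.deriv_eq, deriv_const]
  have hw := hu.weak ψ ⟨hsm, b', hb'.trans hT', fun t ht x => by simp [hψ, hab t (Or.inr ht)]⟩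
  have hz : ∀ x, ψ 0 x = 0 := fun x => by simp [hψ, hab 0 (Or.inl ha.le)]
  simp only [hz, inner_zero_right, integral_zero, neg_zero] at hw
  set Y : ℝ → ℝ := fun t => ∫ x, b x * u t x i ∂torusVol with hY
  set G : ℝ → ℝ := fun t => -ν * (wt (s / 2) k ^ 2 * ∫ x, b x * u t x i ∂torusVol)
        + ∑ j, ∫ x, tderiv j b x * (u t x j * u t x i) ∂torusVol
        + ∫ x, tderiv i b x * P t x ∂torusVol with hG
  have hpd : ∀ t j j' x, pderiv j (fun y => ψ t y j') x =
      (θ t * if j' = i then 1 else 0) * tderiv j b x := by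
    intro t j j' x
    have e : (fun y => ψ t y j') = fun y => 
        ContinuousLinearMap.mul ℝ ℝ (θ t * if j' = i then 1 else 0) (b y) := by
      funext y; rw [hψj]; rfl
    rw [pderiv_eq_tderiv, e, hb.tderiv_clm]; rfl
  have hdt : ∀ t x, deriv (fun τ => ψ τ x) t = (deriv θ t * b x) • EuclideanSpace.single i 1 := by
    intro t x
    have hd : HasDerivAt θ (deriv θ t) t :=
      (hθs.differentiable (by simp)).differentiableAt.hasDerivAt
    exact ((hd.mul_const (b x)).smul_const (EuclideanSpace.single i (1 : ℝ))).deriv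
  -- The pressure is integrable only away from the final time, hence the restriction to (0, T').
  have hPint : ∀ᵐ t ∂(volume : Measure ℝ).restrict (Ioo 0 T), t ∈ Ioo 0 T' →
      Integrable (P t) torusVol := by
    have h1 := (hu.pressure T' hT').prod_right_ae
    have h2 := (ae_restrict_iff' measurableSet_Ioo).1 h1
    exact ae_restrict_of_ae h2
  obtain ⟨Cb, hCb⟩ := hb.exists_bound
  have hslice : ∀ᵐ t ∂(volume : Measure ℝ).restrict (Ioo 0 T), t ∈ Ioo 0 T' →
      ∫ x, weakIntegrand ν s u P ψ t x ∂torusVol = deriv θ t * Y t + θ t * G t := by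
    filter_upwards [hPint, hu.ae_memLp, hu.ae_sobolevSq_lt_top] with t hP hm hsob ht
    have hui := fun j => memLp_coord hm j
    have i1 : Integrable (fun x => b x * u t x i) torusVol :=
      (hb.memLp 2).integrable_mul (hui i)
    have i2 : ∀ j, Integrable (fun x => tderiv j b x * (u t x j * u t x i)) torusVol := by
      intro j
      obtain ⟨C, hC⟩ := (hb.tderiv j).exists_bound
      exact ((hui j).integrable_mul (hui i)).bdd_mul
        (hb.tderiv j).continuous.aestronglyMeasurable (ae_of_all _ hC)
    have i3 : Integrable (fun x => tderiv i b x * P t x) torusVol := by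
      obtain ⟨C, hC⟩ := (hb.tderiv i).exists_bound
      exact (hP ht).bdd_mul (hb.tderiv i).continuous.aestronglyMeasurable (ae_of_all _ hC)
    have e : ∀ x, weakIntegrand ν s u P ψ t x = deriv θ t * (b x * u t x i)
        - ν * ∑ j, (fracLapL2 (s / 2) (fun y => u t y j) x).re *
            (fracLapL2 (s / 2) (fun y => ψ t y j) x).re
        + θ t * ∑ j, tderiv j b x * (u t x j * u t x i) + θ t * (tderiv i b x * P t x) := by
      intro x
      have e1 : inner ℝ (u t x) (deriv (fun τ => ψ τ x) t) = deriv θ t * (b x * u t x i) := by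
        rw [hdt, inner_smul_right, EuclideanSpace.inner_single_right]; simp [mul_assoc]
      have e2 : inner ℝ (fracLap (s / 2) (u t) x) (fracLap (s / 2) (ψ t) x) =
          ∑ j, (fracLapL2 (s / 2) (fun y => u t y j) x).re *
            (fracLapL2 (s / 2) (fun y => ψ t y j) x).re := by
        simp only [PiLp.inner_apply, fracLap]
        exact Finset.sum_congr rfl fun j _ => mul_comm _ _
      have e3 : ∑ i', ∑ j, u t x i' * u t x j * pderiv i' (fun y => ψ t y j) x =
          θ t * ∑ j, tderiv j b x * (u t x j * u t x i) := by
        rw [Finset.mul_sum]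
        refine Finset.sum_congr rfl fun j _ => ?_
        simp only [hpd]
        rw [Finset.sum_eq_single i (fun j' _ h => by simp [h]) (by simp)]
        simp; ring
      have e4 : P t x * divg (ψ t) x = θ t * (tderiv i b x * P t x) := by
        unfold divg
        simp only [hpd]
        rw [Finset.sum_eq_single i (fun j' _ h => by simp [h]) (by simp)]
        simp; ring
      rw [weakIntegrand, e1, e2, e3, e4]
    have iv : ∀ j, Integrable (fun x => (fracLapL2 (s / 2) (fun y => u t y j) x).re *
            (fracLapL2 (s / 2) (fun y => ψ t y j) x).re) torusVol :=
      fun j => integrable_fracLapL2_mul _ _ _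
    -- On the spectrum of b the symbol of A^(s/2) is constant, so the viscous pairing is a multiple
    -- of the plain pairing of b with the i-th component of u.
    have ev : ∑ j, ∫ x, (fracLapL2 (s / 2) (fun y => u t y j) x).re *
            (fracLapL2 (s / 2) (fun y => ψ t y j) x).re ∂torusVol =
        θ t * (wt (s / 2) k ^ 2 * Y t) := by
      have : ∀ j, ∫ x, (fracLapL2 (s / 2) (fun y => u t y j) x).re *
            (fracLapL2 (s / 2) (fun y => ψ t y j) x).re ∂torusVol =
            (θ t * if j = i then 1 else 0) * (wt (s / 2) k ^ 2 * ∫ x, b x * u t x j ∂torusVol) := by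
        intro j
        have ej : (fun y => ψ t y j) = fun y => (θ t * if j = i then 1 else 0) * b y :=
          funext fun y => hψj t y j
        rw [ej]
        have hfr : Memℓp (fracCoeff (s / 2) fun y => u t y j) 2 := by
          refine memℓp_fracCoeff_of_tsum hs ?_
          rw [← sobolevSq_eq]; exact (hsob j).ne
        rw [integral_fracLapL2_mul_of_spectrum (S := S) (k := k) hfr (hui j) ((hb.memLp 2).const_mul _) ?_ hk]
        · rw [show (fun x => u t x j * ((θ t * if j = i then 1 else 0) * b x)) =
            fun x => (θ t * if j = i then 1 else 0) * (b x * u t x j) from funext fun x => by ring,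
            integral_const_mul]
          ring
        · intro l hl
          have := fc_const_mul ((θ t * if j = i then 1 else 0 : ℝ) : ℂ) (fun x => (b x : ℂ)) l
          rw [← coeff_eq_fc, hS l hl, mul_zero] at this
          rw [← this, coeff_eq_fc]
          simp only [Complex.ofReal_mul]
      simp only [this]
      rw [Finset.sum_eq_single i (fun j' _ h => by simp [h]) (by simp)]
      simp [Y]
    simp only [e]
    rw [integral_add, integral_add, integral_sub, integral_const_mul, integral_const_mul,
      integral_const_mul, integral_const_mul, integral_finsetSum _ fun j _ => iv j,
      integral_finsetSum _ fun j _ => i2 j, ev]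
    · simp only [hG, hY]; ring
    · exact i1.const_mul _
    · exact (integrable_finsetSum _ fun j _ => iv j).const_mul _
    · exact (i1.const_mul _).sub ((integrable_finsetSum _ fun j _ => iv j).const_mul _)
    · exact (integrable_finsetSum _ fun j _ => i2 j).const_mul _
    · exact ((i1.const_mul _).sub ((integrable_finsetSum _ fun j _ => iv j).const_mul _)).add
        ((integrable_finsetSum _ fun j _ => i2 j).const_mul _)
    · exact i3.const_mul _
  have hsub : Ioo 0 T' ⊆ Ioo 0 T := Ioo_subset_Ioo_right hT'.le
  have hrestr : ∫ t in Ioo 0 T, ∫ x, weakIntegrand ν s u P ψ t x ∂torusVol =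
      ∫ t in Ioo 0 T', ∫ x, weakIntegrand ν s u P ψ t x ∂torusVol := by
    refine setIntegral_eq_of_subset_of_forall_sdiff_eq_zero measurableSet_Ioo hsub ?_
    rintro t ⟨-, ht⟩
    have e0 : ∀ x, ψ t x = 0 := fun x => by simp [hψ, hθ0 t ht]
    have e0' : ψ t = fun _ => 0 := funext e0
    have : ∀ x, weakIntegrand ν s u P ψ t x = 0 := by
      intro x
      have e1 : fracLap (s / 2) (ψ t) x = 0 := by
        ext j
        simp only [fracLap, e0']
        simp [fracLapL2_zero]
      have e2 : deriv (fun τ => ψ τ x) t = 0 := by rw [hdt, hθ'0 t ht]; simp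
      have e4 : divg (ψ t) x = 0 := by
        unfold divg
        simp [hpd, hθ0 t ht]
      rw [weakIntegrand, e1, e2, e4]
      simp [hpd, hθ0 t ht]
    simp only [this, integral_zero]
  have hslice' : ∀ᵐ t ∂(volume : Measure ℝ).restrict (Ioo 0 T'),
      ∫ x, weakIntegrand ν s u P ψ t x ∂torusVol = deriv θ t * Y t + θ t * G t := by
    have h1 := ae_restrict_of_ae_restrict_of_subset hsub hslice
    filter_upwards [h1, ae_restrict_mem measurableSet_Ioo] with t h1 h2 using h1 h2
  rw [hrestr, integral_congr_ae hslice'] at hw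
  have hu2' : ∀ j, MemLp (fun p : ℝ × T3 => u p.1 p.2 j) 2 (spaceTime T') := fun j =>
    (hu2 j).mono_measure (spaceTime_mono hT'.le)
  have hYi : IntegrableOn Y (Ioo 0 T') := by
    refine (integrable_continuous_mul ((hu2' i).integrable one_le_two)
      (hb.continuous.comp continuous_snd) (C := Cb) fun p => hCb p.2).integral_prod_left
  have hGi : IntegrableOn G (Ioo 0 T') := by
    refine Integrable.add (Integrable.add ((hYi.const_mul _).const_mul _) ?_) ?_
    · refine integrable_finsetSum _ fun j _ => ?_
      obtain ⟨C, hC⟩ := (hb.tderiv j).exists_bound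
      exact (integrable_continuous_mul ((hu2' j).integrable_mul (hu2' i))
        ((hb.tderiv j).continuous.comp continuous_snd) (C := C) fun p => hC p.2).integral_prod_left
    · obtain ⟨C, hC⟩ := (hb.tderiv i).exists_bound
      exact (integrable_continuous_mul (hu.pressure T' hT')
        ((hb.tderiv i).continuous.comp continuous_snd) (C := C) fun p => hC p.2).integral_prod_left
  rw [integral_add] at hw
  · simp only [smul_eq_mul]; linarith
  · exact integrableOn_continuous_smul hYi (hθs.continuous_deriv (by simp))
  · exact integrableOn_continuous_smul hGi hθs.continuous

lemma HasWeakDeriv.of_cpart {T : ℝ} {y G : ℝ → ℂ} (hy : IntegrableOn y (Ioo 0 T))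
    (hG : IntegrableOn G (Ioo 0 T))
    (h : ∀ m, HasWeakDeriv T (fun t => FracNS.cpart m (y t)) fun t => FracNS.cpart m (G t)) :
    HasWeakDeriv T y G := by
  intro θ hθ
  have key : ∀ m, cpartL m (∫ t in Ioo 0 T, deriv θ t • y t) =
      cpartL m (-∫ t in Ioo 0 T, θ t • G t) := by
    intro m
    have h1 := h m θ hθ
    rw [map_neg, ← (cpartL m).integral_comp_comm
      (integrableOn_continuous_smul hy (hθ.1.continuous_deriv (by simp))),
      ← (cpartL m).integral_comp_comm (integrableOn_continuous_smul hG hθ.1.continuous)]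
    simpa only [map_smul, cpartL_apply] using h1
  rw [← sum_cpart (∫ t in Ioo 0 T, deriv θ t • y t), ← sum_cpart (-∫ t in Ioo 0 T, θ t • G t)]
  simp only [← cpartL_apply, key]

lemma HasWeakDeriv.congr {F : Type*} [NormedAddCommGroup F] [NormedSpace ℝ F] {T : ℝ}
    {y y' G G' : ℝ → F} (h : HasWeakDeriv T y G)
    (hy : ∀ᵐ t ∂(volume : Measure ℝ).restrict (Ioo 0 T), y t = y' t)
    (hG : ∀ᵐ t ∂(volume : Measure ℝ).restrict (Ioo 0 T), G t = G' t) : HasWeakDeriv T y' G' := by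
  intro θ hθ
  have e1 : ∫ t in Ioo 0 T, deriv θ t • y' t = ∫ t in Ioo 0 T, deriv θ t • y t :=
    integral_congr_ae (by filter_upwards [hy] with t ht; rw [ht])
  have e2 : ∫ t in Ioo 0 T, θ t • G' t = ∫ t in Ioo 0 T, θ t • G t :=
    integral_congr_ae (by filter_upwards [hG] with t ht; rw [ht])
  rw [e1, e2]
  exact h θ hθ

/-- The fundamental lemma of the calculus of variations. It converts identities between
distributions in time into identities at almost every time. -/
lemma HasWeakDeriv.ae_eq_zero {F : Type*} [NormedAddCommGroup F] [NormedSpace ℝ F]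
    [CompleteSpace F] {T : ℝ}
    {G : ℝ → F} (hG : IntegrableOn G (Ioo 0 T)) (h : HasWeakDeriv T (fun _ => 0) G) :
    ∀ᵐ t ∂(volume : Measure ℝ).restrict (Ioo 0 T), G t = 0 := by
  rcases le_or_gt T 0 with hT | hT
  · simp [Ioo_eq_empty (not_lt.2 hT)]
  refine (ae_restrict_iff' measurableSet_Ioo).2 ?_
  refine isOpen_Ioo.ae_eq_zero_of_integral_contDiff_smul_eq_zero hG.locallyIntegrableOn ?_
  intro g hg hc hs
  have := h g (testTime_of_tsupport hT hg hc hs)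
  simp only [smul_zero, integral_zero] at this
  rw [← setIntegral_eq_integral_of_forall_compl_eq_zero (s := Ioo 0 T)]
  · exact neg_eq_zero.1 this.symm
  · intro t ht
    rw [image_eq_zero_of_notMem_tsupport fun h => ht (hs h), zero_smul]

/-- A part of a character has its spectrum in `{k, -k}`. -/
lemma coeff_cpart_mFourier (m : Fin 2) (k l : Fin 3 → ℤ) (h1 : l ≠ k) (h2 : l ≠ -k) :
    coeff (fun x => cpart m (mFourier k x)) l = 0 := by
  have hz : fc (fun x => mFourier k x) l = 0 :=
    (integral_mFourier_mul l k).trans (if_neg (Ne.symm h1))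
  have hz' : fc (fun x => conj (mFourier k x)) l = 0 := by
    rw [fc_conj]
    have : fc (fun x => mFourier k x) (-l) = 0 :=
      (integral_mFourier_mul (-l) k).trans (if_neg fun h => h2 (by rw [h, neg_neg]))
    rw [this, map_zero]
  have hi : Integrable (fun x => conj (mFourier k x)) torusVol :=
    (integrable_mFourier k).norm.mono' (Complex.continuous_conj.comp
      (mFourier k).continuous).aestronglyMeasurable (ae_of_all _ fun x => by simp)
  obtain ⟨a, b, hab⟩ : ∃ a b : ℂ, ∀ z : ℂ, (cpart m z : ℂ) = a * z + b * conj z := by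
    unfold cpart
    fin_cases m
    · refine ⟨1 / 2, 1 / 2, fun z => ?_⟩
      simp only [Fin.zero_eta, if_true]
      rw [Complex.re_eq_add_conj]; ring
    · refine ⟨1 / (2 * Complex.I), -(1 / (2 * Complex.I)), fun z => ?_⟩
      simp only [Fin.mk_one, one_ne_zero, if_false]
      rw [Complex.im_eq_sub_conj]; ring
  rw [coeff_eq_fc]
  simp only [hab]
  rw [fc_add ((integrable_mFourier k).const_mul _) (hi.const_mul _), fc_const_mul, fc_const_mul,
    hz, hz']
  simp

lemma cpart_integral_mul (m : Fin 2) {e : T3 → ℂ} {f : T3 → ℝ} (he : TSmooth e)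
    (hf : Integrable f torusVol) :
    cpart m (∫ x, e x * (f x : ℂ) ∂torusVol) = ∫ x, cpart m (e x) * f x ∂torusVol := by
  obtain ⟨C, hC⟩ := he.exists_bound
  have hi : Integrable (fun x => e x * (f x : ℂ)) torusVol :=
    hf.ofReal.bdd_mul he.continuous.aestronglyMeasurable (ae_of_all _ hC)
  rw [← cpartL_apply, ← (cpartL m).integral_comp_comm hi]
  congr 1; ext x
  rw [mul_comm, ← Complex.real_smul, map_smul, cpartL_apply, smul_eq_mul, mul_comm]

/-- The pressure as a complex function on space-time. -/
def pres (P : ℝ → T3 → ℝ) (p : ℝ × T3) : ℂ := (P p.1 p.2 : ℂ)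

lemma integral_tderiv_mFourier_mul (j : Fin 3) (k : Fin 3 → ℤ) (f : T3 → ℂ) :
    ∫ x, tderiv j (mFourier (-k) : T3 → ℂ) x * f x ∂torusVol = -dsym j k * fc f k := by
  unfold fc
  rw [← integral_const_mul]
  congr 1; ext x
  rw [tderiv_mFourier, dsym_neg]; ring

section

variable {ν s T : ℝ} {u₀ : T3 → E3} {u : ℝ → T3 → E3} {P : ℝ → T3 → ℝ}

lemma IsLerayHopf.integrable_pres (hu : IsLerayHopf ν s T u₀ u P) {T' : ℝ} (hT' : T' < T) :
    Integrable (pres P) (spaceTime T') := (hu.pressure T' hT').ofReal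

lemma memLp_comp_mul {p q r : ℝ≥0∞} [ENNReal.HolderTriple p q r] {μ : Measure (ℝ × T3)}
    {f g : ℝ × T3 → ℂ} (hf : MemLp f p μ) (hg : MemLp g q μ) :
    MemLp (fun x => f x * g x) r μ := hg.mul hf

/-- The momentum equation in Fourier variables. -/
lemma IsLerayHopf.hasWeakDeriv_fct (hu : IsLerayHopf ν s T u₀ u P) (hs : 0 ≤ s) {T' : ℝ}
    (hT' : T' < T) (hu2 : ∀ i, MemLp (comp u i) 2 (spaceTime T)) (i : Fin 3) (k : Fin 3 → ℤ) :
    IntegrableOn (fun t => -(ν * wt (s / 2) k ^ 2 : ℝ) * fct (comp u i) k t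
        - ∑ j, dsym j k * fct (fun p => comp u j p * comp u i p) k t
        - dsym i k * fct (pres P) k t) (Ioo 0 T') ∧
    HasWeakDeriv T' (fct (comp u i) k)
      (fun t => -(ν * wt (s / 2) k ^ 2 : ℝ) * fct (comp u i) k t
        - ∑ j, dsym j k * fct (fun p => comp u j p * comp u i p) k t
        - dsym i k * fct (pres P) k t) := by
  have hu2' : ∀ j, MemLp (comp u j) 2 (spaceTime T') := fun j =>
    (hu2 j).mono_measure (spaceTime_mono hT'.le)
  have hui : Integrable (comp u i) (spaceTime T') := (hu2' i).integrable one_le_two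
  have huu : ∀ j, Integrable (fun p => comp u j p * comp u i p) (spaceTime T') := fun j =>
    (hu2' j).integrable_mul (hu2' i)
  have hyi := integrableOn_fct hui k
  have hGi : IntegrableOn (fun t => -(ν * wt (s / 2) k ^ 2 : ℝ) * fct (comp u i) k t
        - ∑ j, dsym j k * fct (fun p => comp u j p * comp u i p) k t
        - dsym i k * fct (pres P) k t) (Ioo 0 T') := by
    refine Integrable.sub (Integrable.sub (hyi.const_mul _) ?_) ?_
    · exact integrable_finsetSum _ fun j _ => (integrableOn_fct (huu j) k).const_mul _
    · exact (integrableOn_fct (hu.integrable_pres hT') k).const_mul _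
  refine ⟨hGi, HasWeakDeriv.of_cpart hyi hGi fun m => ?_⟩
  have he := tsmooth_mFourier (-k)
  set b : T3 → ℝ := fun x => cpart m (mFourier (-k) x)
  have hbe : b = fun x => cpartL m (mFourier (-k) x) := funext fun x => (cpartL_apply m _).symm
  have hb : TSmooth b := by rw [hbe]; exact he.clm _
  have hdb : ∀ j x, tderiv j b x = cpart m (tderiv j (mFourier (-k) : T3 → ℂ) x) := by
    intro j x
    rw [hbe, he.tderiv_clm, cpartL_apply]
  have hre : ∀ j, MemLp (fun p : ℝ × T3 => u p.1 p.2 j) 2 (spaceTime T) := fun j => (hu2 j).re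
  -- Test fields must be real, so a character is tested through its real and imaginary parts. Their
  -- spectrum is contained in {k, -k}, on which the even symbol is constant.
  have hw := hu.hasWeakDeriv_integral_mul hs hT' hre hb (S := {k, -k}) (k := k) (fun l hl => by
    simp only [Finset.mem_insert, Finset.mem_singleton, not_or] at hl
    exact coeff_cpart_mFourier m (-k) l hl.2 (by rw [neg_neg]; exact hl.1)) (fun l hl => by
    simp only [Finset.mem_insert, Finset.mem_singleton] at hl
    rcases hl with rfl | rfl
    · rfl
    · exact wt_neg _ _) i
  have hm := ae_restrict_of_ae_restrict_of_subset (Ioo_subset_Ioo_right hT'.le) hu.ae_memLp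
  have hP := (hu.pressure T' hT').prod_right_ae
  refine hw.congr ?_ ?_
  · filter_upwards [hm] with t ht
    exact (cpart_integral_mul m he ((memLp_coord ht i).integrable one_le_two)).symm
  · filter_upwards [hm, hP] with t ht hPt
    have hui := fun j => memLp_coord ht j
    have e1 : ∫ x, b x * u t x i ∂torusVol = cpart m (fct (comp u i) k t) :=
      (cpart_integral_mul m he ((hui i).integrable one_le_two)).symm
    have e2 : ∀ j, ∫ x, tderiv j b x * (u t x j * u t x i) ∂torusVol =
        cpart m (-dsym j k * fct (fun p => comp u j p * comp u i p) k t) := by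
      intro j
      have := cpart_integral_mul m (he.tderiv j) ((hui j).integrable_mul (hui i))
      rw [integral_tderiv_mFourier_mul] at this
      simp only [hdb]
      refine this.symm.trans ?_
      simp [fct, comp]
    have e3 : ∫ x, tderiv i b x * P t x ∂torusVol = cpart m (-dsym i k * fct (pres P) k t) := by
      have := cpart_integral_mul m (he.tderiv i) hPt
      rw [integral_tderiv_mFourier_mul] at this
      simp only [hdb]
      exact this.symm
    rw [e1, e3]
    simp only [e2, ← cpartL_apply]
    rw [sub_eq_add_neg, sub_eq_add_neg, map_add, map_add, ← Finset.sum_neg_distrib, map_sum]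
    congr 1
    · congr 1
      · rw [← Complex.ofReal_neg, ← Complex.real_smul, map_smul, smul_eq_mul]; ring
      · exact Finset.sum_congr rfl fun j _ => by rw [neg_mul]
    · rw [neg_mul]

/-- Incompressibility in Fourier variables. -/
lemma IsLerayHopf.ae_sum_dsym_mul_fct (hu : IsLerayHopf ν s T u₀ u P)
    (hu2 : ∀ i, MemLp (comp u i) 2 (spaceTime T)) :
    ∀ᵐ t ∂(volume : Measure ℝ).restrict (Ioo 0 T), ∀ k,
      ∑ i, dsym i k * fct (comp u i) k t = 0 := by
  refine ae_all_iff.2 fun k => ?_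
  have hui : ∀ i, Integrable (comp u i) (spaceTime T) := fun i => (hu2 i).integrable one_le_two
  have hZ : IntegrableOn (fun t => ∑ i, dsym i k * fct (comp u i) k t) (Ioo 0 T) :=
    integrable_finsetSum _ fun i _ => (integrableOn_fct (hui i) k).const_mul _
  -- Distributional incompressibility, tested on θ(t) times a part of a character, says that the
  -- divergence coefficient is a weak derivative of the zero function.
  refine HasWeakDeriv.ae_eq_zero hZ (HasWeakDeriv.of_cpart (by simp) hZ fun m θ hθ => ?_)
  have he := tsmooth_mFourier (-k)
  set b : T3 → ℝ := fun x => cpart m (mFourier (-k) x)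
  have hbe : b = fun x => cpartL m (mFourier (-k) x) := funext fun x => (cpartL_apply m _).symm
  have hb : TSmooth b := by rw [hbe]; exact he.clm _
  have hdb : ∀ j x, tderiv j b x = cpart m (tderiv j (mFourier (-k) : T3 → ℂ) x) := by
    intro j x
    rw [hbe, he.tderiv_clm, cpartL_apply]
  have hre : ∀ j, MemLp (fun p : ℝ × T3 => u p.1 p.2 j) 2 (spaceTime T) := fun j => (hu2 j).re
  obtain ⟨hθs, a, b', ha, hb', hab⟩ := hθ
  have hdiv := hu.divFree (fun t x => θ t * b x)
    ⟨ContDiff.mul (hθs.comp contDiff_fst)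
      ((show ContDiff ℝ ∞ fun y : E3 => b (toTorus y) from hb).comp contDiff_snd),
      a, b', ha, hb', fun t ht x => by simp [hab t ht]⟩
  have hpd : ∀ t j x, pderiv j (fun y => θ t * b y) x = θ t * tderiv j b x := by
    intro t j x
    exact hb.tderiv_clm (ContinuousLinearMap.mul ℝ ℝ (θ t)) j x
  have e : ∀ p : ℝ × T3, inner ℝ (u p.1 p.2) (grad (fun x => θ p.1 * b x) p.2) =
      θ p.1 * ∑ j, tderiv j b p.2 * u p.1 p.2 j := by
    intro p
    simp only [PiLp.inner_apply, grad, hpd, Finset.mul_sum]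
    refine Finset.sum_congr rfl fun j _ => ?_
    simp; ring
  have hint : ∀ j, Integrable (fun p : ℝ × T3 => tderiv j b p.2 * u p.1 p.2 j) (spaceTime T) := by
    intro j
    obtain ⟨C, hC⟩ := (hb.tderiv j).exists_bound
    exact integrable_continuous_mul ((hre j).integrable one_le_two)
      ((hb.tderiv j).continuous.comp continuous_snd) (C := C) fun p => hC p.2
  have hsum := integrable_finsetSum Finset.univ fun j _ => hint j
  obtain ⟨Cθ, hCθ⟩ : ∃ C, ∀ t, ‖θ t‖ ≤ C := by
    obtain ⟨C, hC⟩ := (isCompact_Icc (a := a) (b := b')).exists_bound_of_continuousOn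
      hθs.continuous.continuousOn
    refine ⟨max C 0, fun t => ?_⟩
    by_cases ht : t ∈ Icc a b'
    · exact (hC t ht).trans (le_max_left _ _)
    · rw [hab t (by
        by_contra h
        push Not at h
        exact ht ⟨h.1.le, h.2.le⟩)]; simp
  have hprod : Integrable (fun p : ℝ × T3 => θ p.1 * ∑ j, tderiv j b p.2 * u p.1 p.2 j)
      (spaceTime T) :=
    integrable_continuous_mul hsum (hθs.continuous.comp continuous_fst) (C := Cθ) fun p => hCθ p.1
  simp only [e] at hdiv
  rw [integral_prod _ hprod] at hdiv
  have hz : FracNS.cpart m 0 = 0 := by rw [← cpartL_apply, map_zero]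
  simp only [hz, mul_zero, integral_zero, smul_eq_mul]
  rw [eq_comm, neg_eq_zero, ← neg_eq_zero, ← integral_neg]
  refine Eq.trans ?_ hdiv
  refine integral_congr_ae ?_
  filter_upwards [hu.ae_memLp] with t ht
  have hui := fun j => memLp_coord ht j
  rw [integral_const_mul, integral_finsetSum]
  · rw [← mul_neg]
    congr 1
    rw [← cpartL_apply, ← map_neg, ← Finset.sum_neg_distrib, map_sum]
    refine Finset.sum_congr rfl fun j _ => ?_
    have := cpart_integral_mul m (he.tderiv j) ((hui j).integrable one_le_two)
    rw [integral_tderiv_mFourier_mul] at this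
    simp only [hdb]
    rw [cpartL_apply, ← neg_mul]
    exact this
  · intro j _
    obtain ⟨C, hC⟩ := (hb.tderiv j).exists_bound
    exact ((hui j).integrable one_le_two).bdd_mul
        (hb.tderiv j).continuous.aestronglyMeasurable (ae_of_all _ hC)

/-- The equation for the pressure in Fourier variables. -/
lemma IsLerayHopf.ae_pressure_eq (hu : IsLerayHopf ν s T u₀ u P) (hs : 0 ≤ s) {T' : ℝ}
    (hT' : T' < T) (hu2 : ∀ i, MemLp (comp u i) 2 (spaceTime T)) :
    ∀ᵐ t ∂(volume : Measure ℝ).restrict (Ioo 0 T'), ∀ k,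
      (((2 * Real.pi * ‖freq k‖) ^ 2 : ℝ) : ℂ) * fct (pres P) k t =
        ∑ i, ∑ j, dsym i k * dsym j k * fct (fun p => comp u j p * comp u i p) k t := by
  refine ae_all_iff.2 fun k => ?_
  have hdiv := ae_restrict_of_ae_restrict_of_subset (Ioo_subset_Ioo_right hT'.le)
    (hu.ae_sum_dsym_mul_fct hu2)
  have h := fun i => hu.hasWeakDeriv_fct hs hT' hu2 i k
  set G : Fin 3 → ℝ → ℂ := fun i t => -(ν * wt (s / 2) k ^ 2 : ℝ) * fct (comp u i) k t
        - ∑ j, dsym j k * fct (fun p => comp u j p * comp u i p) k t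
        - dsym i k * fct (pres P) k t with hG
  have hyi : ∀ i, IntegrableOn (fct (comp u i) k) (Ioo 0 T') := fun i =>
    integrableOn_fct (((hu2 i).mono_measure (spaceTime_mono hT'.le)).integrable one_le_two) k
  have hSi : IntegrableOn (fun t => ∑ i, dsym i k * G i t) (Ioo 0 T') :=
    integrable_finsetSum _ fun i _ => (h i).1.const_mul _
  -- Divergence of the momentum equation. Its left side vanishes at almost every time by
  -- incompressibility, so its weak derivative vanishes too; the viscous term drops for the same
  -- reason, and only the pressure and the quadratic term remain.
  have hS : HasWeakDeriv T' (fun t => ∑ i, dsym i k * fct (comp u i) k t)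
      (fun t => ∑ i, dsym i k * G i t) := by
    intro θ hθ
    have h1 := fun i => (h i).2 θ hθ
    have hθ' : Continuous (deriv θ) := hθ.1.continuous_deriv (by simp)
    simp only [Finset.smul_sum]
    rw [integral_finsetSum, integral_finsetSum, ← Finset.sum_neg_distrib]
    · refine Finset.sum_congr rfl fun i _ => ?_
      simp only [← mul_smul_comm]
      rw [integral_const_mul, integral_const_mul, h1, mul_neg]
    · exact fun i _ => integrableOn_continuous_smul ((h i).1.const_mul _) hθ.1.continuous
    · exact fun i _ => integrableOn_continuous_smul ((hyi i).const_mul _) hθ'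
  have h0 := HasWeakDeriv.ae_eq_zero hSi (hS.congr (y' := fun _ => 0)
    (by filter_upwards [hdiv] with t ht using ht k) (ae_of_all _ fun _ => rfl))
  filter_upwards [h0, hdiv] with t h0 hd
  have hd := hd k
  simp only [hG, mul_sub, Finset.sum_sub_distrib] at h0
  have e1 : ∑ i, dsym i k * (-(ν * wt (s / 2) k ^ 2 : ℝ) * fct (comp u i) k t) = 0 := by
    have : ∀ i, dsym i k * (-(ν * wt (s / 2) k ^ 2 : ℝ) * fct (comp u i) k t) =
      -(ν * wt (s / 2) k ^ 2 : ℝ) * (dsym i k * fct (comp u i) k t) := fun i => by ring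
    simp only [this, ← Finset.mul_sum, hd, mul_zero]
  have e3 : ∑ i, dsym i k * (dsym i k * fct (pres P) k t) =
      -(((2 * Real.pi * ‖freq k‖) ^ 2 : ℝ) : ℂ) * fct (pres P) k t := by
    rw [← dsym_sq_sum, Finset.sum_mul]
    exact Finset.sum_congr rfl fun i _ => by ring
  rw [e1, e3] at h0
  have e2 : ∑ i, dsym i k * ∑ j, dsym j k * fct (fun p => comp u j p * comp u i p) k t =
      ∑ i, ∑ j, dsym i k * dsym j k * fct (fun p => comp u j p * comp u i p) k t := by
    refine Finset.sum_congr rfl fun i _ => ?_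
    rw [Finset.mul_sum]
    exact Finset.sum_congr rfl fun j _ => by ring
  rw [e2] at h0
  linear_combination h0

end

/-! ### Mollification in space-time -/

instance : ENNReal.HolderTriple 3 3 (3 / 2) := ⟨by
  rw [ENNReal.inv_div (by simp) (by simp), ← two_mul, ENNReal.div_eq_inv_mul, mul_comm]⟩

instance : ENNReal.HolderTriple 3 (3 / 2) 1 := ⟨by
  rw [ENNReal.inv_div (by simp) (by simp), ← one_div, ENNReal.div_add_div_same, inv_one,
    show (1 : ℝ≥0∞) + 2 = 3 by norm_num, ENNReal.div_self (by simp) (by simp)]⟩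

instance : ENNReal.HolderTriple (3 / 2) 3 1 := ENNReal.HolderTriple.symm

lemma one_le_three_halves : (1 : ℝ≥0∞) ≤ 3 / 2 := by
  rw [ENNReal.le_div_iff_mul_le (by simp) (by simp)]; norm_num

lemma three_halves_ne_top : (3 / 2 : ℝ≥0∞) ≠ ⊤ := ENNReal.div_ne_top (by simp) (by simp)

/-- Rescaled convolution in the space variable. -/
def stConv (K : E3 → ℂ) (c : ℝ) (F : ℝ × T3 → ℂ) (p : ℝ × T3) : ℂ :=
  ∫ z, K z * F (stShift (-(c • z)) p)

lemma stConv_apply (K : E3 → ℂ) (c : ℝ) (F : ℝ × T3 → ℂ) (t : ℝ) (x : T3) :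
    stConv K c F (t, x) = kconv K c (fun x => F (t, x)) x := rfl

lemma aestronglyMeasurable_stConv {T : ℝ} {K : E3 → ℂ} (hK : Integrable K) (c : ℝ)
    {F : ℝ × T3 → ℂ} (hF : AEStronglyMeasurable F (spaceTime T)) :
    AEStronglyMeasurable (stConv K c F) (spaceTime T) :=
  aestronglyMeasurable_kconv (isShift_stShift T) hK c hF

/-- Tonelli applied to |F - G|; the joint measurability of both functions is what turns equality on
almost every slice into equality almost everywhere. -/
lemma ae_eq_spaceTime {T : ℝ} {F G : ℝ × T3 → ℂ} (hF : AEStronglyMeasurable F (spaceTime T))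
    (hG : AEStronglyMeasurable G (spaceTime T))
    (h : ∀ᵐ t ∂(volume : Measure ℝ).restrict (Ioo 0 T), ∀ᵐ x ∂torusVol, F (t, x) = G (t, x)) :
    F =ᵐ[spaceTime T] G := by
  have hm : AEMeasurable (fun p => ‖F p - G p‖ₑ) (spaceTime T) := (hF.sub hG).enorm
  have h0 : ∫⁻ p, ‖F p - G p‖ₑ ∂spaceTime T = 0 := by
    rw [lintegral_prod _ hm]
    refine lintegral_eq_zero_of_ae_eq_zero ?_
    filter_upwards [h] with t ht
    refine lintegral_eq_zero_of_ae_eq_zero ?_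
    filter_upwards [ht] with x hx
    simp [hx]
  filter_upwards [(lintegral_eq_zero_iff' hm).1 h0] with p hp
  exact sub_eq_zero.1 (enorm_eq_zero.1 hp)

lemma tendsto_eLpNorm_one_spaceTime {T : ℝ} {F : ℕ → ℝ × T3 → ℂ}
    (hF : ∀ n, AEStronglyMeasurable (F n) (spaceTime T))
    {N : ℝ → ℝ≥0∞} (hN : ∫⁻ t in Ioo 0 T, N t ≠ ⊤)
    (hle : ∀ n, ∀ᵐ t ∂(volume : Measure ℝ).restrict (Ioo 0 T),
      eLpNorm (fun x => F n (t, x)) 1 torusVol ≤ N t)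
    (h : ∀ᵐ t ∂(volume : Measure ℝ).restrict (Ioo 0 T),
      Tendsto (fun n => eLpNorm (fun x => F n (t, x)) 1 torusVol) atTop (𝓝 0)) :
    Tendsto (fun n => eLpNorm (F n) 1 (spaceTime T)) atTop (𝓝 0) := by
  have e : ∀ n, eLpNorm (F n) 1 (spaceTime T) =
      ∫⁻ t in Ioo 0 T, eLpNorm (fun x => F n (t, x)) 1 torusVol := by
    intro n
    simpa using eLpNorm_spaceTime_rpow le_rfl ENNReal.one_ne_top (hF n)
  simp only [e]
  rw [show (0 : ℝ≥0∞) = ∫⁻ _ in Ioo 0 T, 0 by simp]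
  refine tendsto_lintegral_of_dominated_convergence' N (fun n => ?_) hle hN h
  simp only [eLpNorm_one_eq_lintegral_enorm]
  exact (hF n).enorm.lintegral_prod_right'

lemma tendsto_stConv_sub {T : ℝ} {c : ℕ → ℝ} (hc : Tendsto c atTop (𝓝 0)) {F : ℝ × T3 → ℂ}
    (hF : Integrable F (spaceTime T)) :
    Tendsto (fun n => eLpNorm (fun p => stConv chiK (c n) F p - F p) 1 (spaceTime T))
      atTop (𝓝 0) := by
  have hK : Integrable (chiK : E3 → ℂ) := chiK.integrable
  set A := ∫⁻ z, ‖chiK z‖ₑ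
  have hA : A ≠ ⊤ := hK.2.ne
  have hs := hF.prod_right_ae
  have h1 : ∫⁻ t in Ioo 0 T, eLpNorm (fun x => F (t, x)) 1 torusVol ≠ ⊤ := by
    have := eLpNorm_spaceTime_rpow le_rfl ENNReal.one_ne_top hF.1
    simp only [ENNReal.toReal_one, ENNReal.rpow_one] at this
    rw [← this]
    exact (memLp_one_iff_integrable.2 hF).2.ne
  refine tendsto_eLpNorm_one_spaceTime
    (N := fun t => (A + 1) * eLpNorm (fun x => F (t, x)) 1 torusVol)
    (fun n => (aestronglyMeasurable_stConv hK _ hF.1).sub hF.1) ?_ (fun n => ?_) ?_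
  · rw [lintegral_const_mul' _ _ (by finiteness)]
    finiteness
  · filter_upwards [hs] with t ht
    simp only [stConv_apply]
    have hm : AEStronglyMeasurable (kconv chiK (c n) fun x => F (t, x)) torusVol :=
      aestronglyMeasurable_kconv isShift_shift hK (c n) ht.1
    have hb : eLpNorm (kconv chiK (c n) fun x => F (t, x)) 1 torusVol ≤
        A * eLpNorm (fun x => F (t, x)) 1 torusVol :=
      eLpNorm_kconv_le isShift_shift hK (c n) ht.1 le_rfl ENNReal.one_ne_top
    rw [add_mul, one_mul]
    have h3 := eLpNorm_sub_le hm ht.1 le_rfl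
    exact h3.trans (add_le_add hb le_rfl)
  · filter_upwards [hs] with t ht
    have h1 : ∀ ξ : E3, ‖ξ‖ ≤ 1 → 𝓕 (chiK : E3 → ℂ) ξ = 1 := fun ξ hξ => by
      rw [fourier_chiK, chi_eq_one hξ]
    have h2 := tendsto_kconv_sub (K := (chiK : E3 → ℂ)) hK h1 hc ht
    simpa only [stConv_apply] using h2

/-- The dyadic scales. -/
def scale (n : ℕ) : ℝ := 2 * (1 / 2) ^ n

lemma scale_pos (n : ℕ) : 0 < scale n := by unfold scale; positivity

lemma scale_succ (n : ℕ) : scale n = 2 * scale (n + 1) := by unfold scale; rw [pow_succ]; ring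

lemma tendsto_scale : Tendsto scale atTop (𝓝 0) := by
  have := (tendsto_pow_atTop_nhds_zero_of_lt_one (r := (1 / 2 : ℝ)) (by norm_num)
    (by norm_num)).const_mul 2
  rw [mul_zero] at this
  exact this

lemma scale_succ_rpow (n : ℕ) (β : ℝ) : scale (n + 1) ^ β = 2 ^ (-(β * n)) := by
  have : scale (n + 1) = 2 ^ (-(n : ℝ)) := by
    rw [scale, pow_succ, Real.rpow_neg (by norm_num), Real.rpow_natCast, one_div, inv_pow]; ring
  rw [this, ← Real.rpow_mul (by norm_num)]
  congr 1; ring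

/-! ### Moduli of continuity of products and mollifications -/

/-- Leibniz rule for increments, δ(fg) = δf · g(· + y) + f · δg, and Hölder with 1/3 + 1/3 = 2/3. -/
lemma HasModulus.mul {T β : ℝ} {C : ℝ≥0∞} {f g : ℝ × T3 → ℂ}
    (hf : MemLp f 3 (spaceTime T)) (hg : MemLp g 3 (spaceTime T))
    (hfC : HasModulus (spaceTime T) stShift 3 β C f)
    (hgC : HasModulus (spaceTime T) stShift 3 β C g) :
    HasModulus (spaceTime T) stShift (3 / 2) β
      (C * (eLpNorm g 3 (spaceTime T) + eLpNorm f 3 (spaceTime T))) fun p => f p * g p := by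
  intro y
  have hy := measurePreserving_stShift T y
  have hf' : MemLp (fun p => f (stShift y p)) 3 (spaceTime T) := hf.comp_measurePreserving hy
  have hg' : MemLp (fun p => g (stShift y p)) 3 (spaceTime T) := hg.comp_measurePreserving hy
  have e : (fun p => f (stShift y p) * g (stShift y p) - f p * g p) = fun p =>
      (f (stShift y p) - f p) • g (stShift y p) + f p • (g (stShift y p) - g p) := by
    funext p; simp only [smul_eq_mul]; ring
  rw [e]
  refine (eLpNorm_add_le ((hf'.sub hf).1.smul hg'.1) (hf.1.smul (hg'.sub hg).1)
    one_le_three_halves).trans ?_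
  have h1 := eLpNorm_smul_le_mul_eLpNorm (p := 3) (q := 3) (r := 3 / 2) hg'.1 (hf'.sub hf).1
  have h2 := eLpNorm_smul_le_mul_eLpNorm (p := 3) (q := 3) (r := 3 / 2) (hg'.sub hg).1 hf.1
  have e3 : eLpNorm (fun p => g (stShift y p)) 3 (spaceTime T) = eLpNorm g 3 (spaceTime T) :=
    eLpNorm_comp_measurePreserving hg.1 hy
  rw [e3] at h1
  calc _ ≤ (C * ENNReal.ofReal (‖y‖ ^ β)) * eLpNorm g 3 (spaceTime T) +
        eLpNorm f 3 (spaceTime T) * (C * ENNReal.ofReal (‖y‖ ^ β)) :=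
        add_le_add (h1.trans (mul_le_mul_left (hfC y) _)) (h2.trans (mul_le_mul_right (hgC y) _))
    _ = _ := by ring

lemma ae_stConv_sub {T : ℝ} (K : 𝓢(E3, ℂ)) (c : ℝ) {F : ℝ × T3 → ℂ}
    (hF : Integrable F (spaceTime T)) :
    ∀ᵐ p ∂spaceTime T, ∫ z, K z * (F (stShift (-(c • z)) p) - F p) =
      stConv K c F p - 𝓕 (K : E3 → ℂ) 0 * F p := by
  filter_upwards [ae_integrable_kconv (isShift_stShift T) (K.integrable (μ := volume)) c hF]
    with p hp
  simp only [mul_sub]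
  rw [integral_sub hp (K.integrable.mul_const _), integral_mul_const, ← integral_kernel (K := K)]
  rfl

/-- Convolution with a mean zero kernel gains a power of the scale. -/
lemma exists_eLpNorm_stConv_le (K : 𝓢(E3, ℂ)) {p : ℝ≥0∞} (hp : 1 ≤ p) (hp' : p ≠ ⊤) {β : ℝ}
    (hβ : 0 ≤ β) :
    ∃ A : ℝ≥0, ∀ {T : ℝ} {F : ℝ × T3 → ℂ} {C : ℝ≥0∞} (c : ℝ), 0 ≤ c →
      Integrable F (spaceTime T) → HasModulus (spaceTime T) stShift p β C F →
      eLpNorm (fun q => stConv K c F q - 𝓕 (K : E3 → ℂ) 0 * F q) p (spaceTime T) ≤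
        A * C * ENNReal.ofReal (c ^ β) := by
  obtain ⟨A, hA⟩ := exists_modulus_bound K hp hp' hβ
  refine ⟨A, fun {T F C} c hc hF hC => ?_⟩
  rw [← eLpNorm_congr_ae (ae_stConv_sub K c hF)]
  exact hA (isShift_stShift T) c hc hF.1 hC

/-! ### The pressure -/

/-- The symbol localised in an annulus that recovers a dyadic piece of the pressure. -/
def presSym (i j : Fin 3) (ξ : E3) : ℂ :=
  -(chi ξ - chi ((2 : ℝ) • ξ)) * ((ξ i * ξ j / ‖ξ‖ ^ 2 : ℝ) : ℂ)

lemma presSym_eq_zero_of_norm_le (i j : Fin 3) {ξ : E3} (h : ‖ξ‖ ≤ 1 / 2) : presSym i j ξ = 0 := by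
  have h1 : chi ξ = 1 := chi_eq_one (by linarith)
  have h2 : chi ((2 : ℝ) • ξ) = 1 := chi_eq_one (by rw [norm_smul]; norm_num; linarith)
  simp [presSym, h1, h2]

lemma presSym_eq_zero_of_le_norm (i j : Fin 3) {ξ : E3} (h : 2 ≤ ‖ξ‖) : presSym i j ξ = 0 := by
  have h1 : chi ξ = 0 := chi_eq_zero h
  have h2 : chi ((2 : ℝ) • ξ) = 0 := chi_eq_zero (by rw [norm_smul]; norm_num; linarith)
  simp [presSym, h1, h2]

lemma hasCompactSupport_presSym (i j : Fin 3) : HasCompactSupport (presSym i j) :=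
  HasCompactSupport.intro (isCompact_closedBall (0 : E3) 2) fun ξ hξ =>
    presSym_eq_zero_of_le_norm i j (by
      rw [Metric.mem_closedBall, dist_zero_right, not_le] at hξ
      exact hξ.le)

/-- The symbol ξᵢξⱼ/|ξ|² is singular only at the origin, and the difference of the two cut-offs
vanishes on the ball of radius 1/2. -/
lemma contDiff_presSym (i j : Fin 3) : ContDiff ℝ ∞ (presSym i j) := by
  rw [contDiff_iff_contDiffAt]
  intro ξ
  rcases eq_or_ne ξ 0 with rfl | h
  · have : presSym i j =ᶠ[𝓝 0] fun _ => 0 := by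
      filter_upwards [Metric.closedBall_mem_nhds (0 : E3) (show (0 : ℝ) < 1 / 2 by norm_num)]
        with ξ hξ
      rw [Metric.mem_closedBall, dist_zero_right] at hξ
      exact presSym_eq_zero_of_norm_le i j hξ
    exact contDiffAt_const.congr_of_eventuallyEq this
  · have h1 : ContDiffAt ℝ ∞ (fun ξ : E3 => ξ i * ξ j / ‖ξ‖ ^ 2) ξ := by
      have hi : ∀ i, ContDiff ℝ ∞ fun ξ : E3 => ξ i := fun i =>
        (EuclideanSpace.proj (𝕜 := ℝ) i : E3 →L[ℝ] ℝ).contDiff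
      exact ((hi i).mul (hi j)).contDiffAt.div (contDiff_norm_sq ℝ).contDiffAt (by positivity)
    have h2 : ContDiff ℝ ∞ fun ξ : E3 => -(chi ξ - chi ((2 : ℝ) • ξ)) :=
      (contDiff_chi.sub (contDiff_chi.comp (contDiff_const_smul 2))).neg
    exact h2.contDiffAt.mul (Complex.ofRealCLM.contDiff.contDiffAt.comp ξ h1)

def presK (i j : Fin 3) : 𝓢(E3, ℂ) :=
  (exists_kernel (hasCompactSupport_presSym i j) (contDiff_presSym i j)).choose

lemma fourier_presK (i j : Fin 3) (ξ : E3) : 𝓕 (presK i j : E3 → ℂ) ξ = presSym i j ξ :=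
  (exists_kernel (hasCompactSupport_presSym i j) (contDiff_presSym i j)).choose_spec ξ

/-- The symbol ξᵢξⱼ/|ξ|² is homogeneous of degree zero, so the scale c survives only in the
cut-offs; the minus sign in `presSym` matches (2πi)² = -4π². The identity is multiplied by |2πk|²
and thus also holds at k = 0. -/
lemma presSym_smul_freq (i j : Fin 3) {c : ℝ} (hc : 0 < c) (k : Fin 3 → ℤ) :
    (((2 * Real.pi * ‖freq k‖) ^ 2 : ℝ) : ℂ) * presSym i j (c • freq k) =
      (chi (c • freq k) - chi ((2 * c) • freq k)) * (dsym i k * dsym j k) := by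
  rcases eq_or_ne (freq k) 0 with h | h
  · simp [h]
  have hn : ‖freq k‖ ≠ 0 := norm_ne_zero_iff.2 h
  have e : (c • freq k) i * (c • freq k) j / ‖c • freq k‖ ^ 2 = k i * k j / ‖freq k‖ ^ 2 := by
    rw [norm_smul, Real.norm_of_nonneg hc.le]
    simp only [PiLp.smul_apply, smul_eq_mul, freq] at hn ⊢
    field_simp
  rw [presSym, e, smul_smul]
  have e2 : (2 * Real.pi * ‖freq k‖) ^ 2 * (k i * k j / ‖freq k‖ ^ 2) =
      4 * Real.pi ^ 2 * k i * k j := by field_simp; ring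
  have e3 : dsym i k * dsym j k = -((4 * Real.pi ^ 2 * k i * k j : ℝ) : ℂ) := by
    simp only [dsym]; push_cast
    linear_combination (4 * (Real.pi : ℂ) ^ 2 * k i * k j) * Complex.I_sq
  rw [e3, ← e2]
  push_cast; ring

lemma trigOp_apply (S : Finset (Fin 3 → ℤ)) (a : (Fin 3 → ℤ) → ℂ) (f : T3 → ℂ) (x : T3) :
    trigOp S a f x = ∑ k ∈ S, a k * fc f k * mFourier k x := rfl

section

variable {ν s T : ℝ} {u₀ : T3 → E3} {u : ℝ → T3 → E3} {P : ℝ → T3 → ℝ}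

/-- A dyadic piece of the pressure is a singular integral of the quadratic term. -/
lemma IsLerayHopf.ae_stConv_pres_sub (hu : IsLerayHopf ν s T u₀ u P) (hs : 0 ≤ s) {T' : ℝ}
    (hT' : T' < T) (hu2 : ∀ i, MemLp (comp u i) 2 (spaceTime T)) {c : ℝ} (hc : 0 < c) :
    (fun p => stConv chiK c (pres P) p - stConv chiK (2 * c) (pres P) p) =ᵐ[spaceTime T']
      fun p => ∑ i, ∑ j, stConv (presK i j) c (fun p => comp u j p * comp u i p) p := by
  have hP := hu.integrable_pres hT'
  have hu2' : ∀ j, MemLp (comp u j) 2 (spaceTime T') := fun j =>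
    (hu2 j).mono_measure (spaceTime_mono hT'.le)
  have huu : ∀ i j, Integrable (fun p => comp u j p * comp u i p) (spaceTime T') := fun i j =>
    (hu2' j).integrable_mul (hu2' i)
  have hm := fun i j => aestronglyMeasurable_stConv (presK i j).integrable c (huu i j).1
  refine ae_eq_spaceTime ((aestronglyMeasurable_stConv chiK.integrable c hP.1).sub
    (aestronglyMeasurable_stConv chiK.integrable (2 * c) hP.1))
    (Finset.aestronglyMeasurable_fun_sum _ fun i _ =>
      Finset.aestronglyMeasurable_fun_sum _ fun j _ => hm i j) ?_
  have hsl : ∀ᵐ t ∂(volume : Measure ℝ).restrict (Ioo 0 T'), ∀ i j,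
      Integrable (fun x => comp u j (t, x) * comp u i (t, x)) torusVol :=
    ae_all_iff.2 fun i => ae_all_iff.2 fun j => (huu i j).prod_right_ae
  filter_upwards [hP.prod_right_ae, hsl, hu.ae_pressure_eq hs hT' hu2] with t h1 h2 h3
  -- The finer of the two scales fixes a set of modes that serves both truncations, with r = 1 and r
  -- = 2.
  have hz : ∀ k ∉ modes (2 / c), ∀ r, 1 ≤ r → chi ((r * c) • freq k) = 0 := by
    intro k hk r hr
    refine chi_eq_zero ?_
    have := two_lt_of_notMem_modes hc hk
    rw [mul_smul, norm_smul, Real.norm_of_nonneg (by linarith)]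
    nlinarith [norm_nonneg (c • freq k)]
  have k1 := kconv_ae_eq_trigOp (K := chiK) chiK.integrable c (F := modes (2 / c))
    (fun k hk => by rw [fourier_chiK]; simpa using hz k hk 1 le_rfl) h1
  have k2 := kconv_ae_eq_trigOp (K := chiK) chiK.integrable (2 * c) (F := modes (2 / c))
    (fun k hk => by rw [fourier_chiK]; exact hz k hk 2 one_le_two) h1
  have k3 : ∀ᵐ x ∂torusVol, ∀ i j, _ = _ := ae_all_iff.2 fun i => ae_all_iff.2 fun j =>
    kconv_ae_eq_trigOp (K := presK i j) (presK i j).integrable c (F := modes (2 / c))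
      (fun k hk => by
        rw [fourier_presK]
        exact presSym_eq_zero_of_le_norm i j (two_lt_of_notMem_modes hc hk).le) (h2 i j)
  filter_upwards [k1, k2, k3] with x k1 k2 k3
  simp only [stConv_apply]
  rw [k1, k2]
  simp only [k3, trigOp_apply, fourier_chiK, fourier_presK]
  rw [← Finset.sum_sub_distrib]
  have e : ∀ i, ∑ j, ∑ k ∈ modes (2 / c), presSym i j (c • freq k) *
      fc (fun x => comp u j (t, x) * comp u i (t, x)) k * mFourier k x =
      ∑ k ∈ modes (2 / c), ∑ j, presSym i j (c • freq k) *
      fc (fun x => comp u j (t, x) * comp u i (t, x)) k * mFourier k x := fun i =>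
    Finset.sum_comm
  simp only [e]
  rw [Finset.sum_comm]
  refine Finset.sum_congr rfl fun k _ => ?_
  simp only [← Finset.sum_mul]
  rw [← sub_mul, ← sub_mul]
  congr 1
  -- At frequency zero the pressure equation carries no information, but the two cut-offs cancel
  -- there and `presSym` vanishes. Elsewhere |2πk|² can be cancelled.
  rcases eq_or_ne (freq k) 0 with h | h
  · rw [h]
    have : ∀ i j, presSym i j 0 = 0 := fun i j => presSym_eq_zero_of_norm_le i j (by simp)
    simp [this]
  have hn : (((2 * Real.pi * ‖freq k‖) ^ 2 : ℝ) : ℂ) ≠ 0 := by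
    rw [Complex.ofReal_ne_zero]
    have := norm_pos_iff.2 h
    positivity
  refine mul_left_cancel₀ hn ?_
  have h3 := h3 k
  simp only [fct, pres] at h3 ⊢
  rw [mul_left_comm, h3, Finset.mul_sum, Finset.mul_sum]
  refine Finset.sum_congr rfl fun i _ => ?_
  rw [Finset.mul_sum, Finset.mul_sum]
  refine Finset.sum_congr rfl fun j _ => ?_
  rw [← mul_assoc _ (presSym i j _), presSym_smul_freq i j hc]
  ring

end

lemma HasModulus.mono {T T' β : ℝ} {p C : ℝ≥0∞} {f : ℝ × T3 → ℂ} (hT : T' ≤ T)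
    (h : HasModulus (spaceTime T) stShift p β C f) : HasModulus (spaceTime T') stShift p β C f :=
  fun y => (eLpNorm_mono_measure _ (spaceTime_mono hT)).trans (h y)

lemma one_le_norm_freq {k : Fin 3 → ℤ} (hk : k ≠ 0) : 1 ≤ ‖freq k‖ := by
  obtain ⟨i, hi⟩ := Function.ne_iff.1 hk
  have h1 : (1 : ℝ) ≤ |(k i : ℝ)| := by exact_mod_cast Int.one_le_abs hi
  exact h1.trans (by simpa [freq] using PiLp.norm_apply_le (freq k) i)

lemma freq_zero : freq 0 = 0 := by ext; simp [freq]

/-- The scales start at 2 so that the first cut-off removes every nonzero integer frequency, leaving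
exactly the mean. -/
lemma lowPass_scale_zero (f : T3 → ℂ) (x : T3) : lowPass (scale 0) f x = fc f 0 := by
  have e : scale 0 = 2 := by simp [scale]
  rw [lowPass, trigOp_apply, Finset.sum_eq_single 0]
  · rw [freq_zero, smul_zero, chi_eq_one (by simp), UnitAddTorus.mFourier_zero]
    simp
  · intro k _ hk
    rw [chi_eq_zero, zero_mul, zero_mul]
    rw [e, norm_smul]
    have := one_le_norm_freq hk
    norm_num; linarith
  · intro h
    exact absurd (mem_modes.2 (by simp [freq_zero, e])) h

lemma ae_stConv_scale_zero {T : ℝ} {F : ℝ × T3 → ℂ} (hF : Integrable F (spaceTime T)) :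
    stConv chiK (scale 0) F =ᵐ[spaceTime T] fun p => fct F 0 p.1 := by
  refine ae_eq_spaceTime (aestronglyMeasurable_stConv chiK.integrable _ hF.1)
    (aestronglyMeasurable_fct hF.1 0).comp_fst ?_
  filter_upwards [hF.prod_right_ae] with t ht
  filter_upwards [kconv_chiK_ae_eq (scale_pos 0) ht] with x hx
  rw [stConv_apply, hx, lowPass_scale_zero]
  rfl

section

variable {ν s T β : ℝ} {u₀ : T3 → E3} {u : ℝ → T3 → E3} {P : ℝ → T3 → ℝ} {C : ℝ≥0}

/-- Up to its mean the pressure is the limit of its mollifications in `L^{3/2}`. -/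
lemma IsLerayHopf.memLp_pres_and_tendsto (hu : IsLerayHopf ν s T u₀ u P) (hs : 0 ≤ s) {T' : ℝ}
    (hT' : T' < T) (hu3 : ∀ i, MemLp (comp u i) 3 (spaceTime T)) (hβ : 0 < β)
    (hC : ∀ i, HasModulus (spaceTime T) stShift 3 β C (comp u i)) :
    MemLp (fun p => pres P p - fct (pres P) 0 p.1) (3 / 2) (spaceTime T') ∧
    Tendsto (fun n => eLpNorm (fun p => pres P p - stConv chiK (scale n) (pres P) p) (3 / 2)
      (spaceTime T')) atTop (𝓝 0) ∧
    ∀ n, eLpNorm (fun p => pres P p - stConv chiK (scale n) (pres P) p) (3 / 2)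
      (spaceTime T') < ⊤ := by
  have hP := hu.integrable_pres hT'
  have hu2 : ∀ i, MemLp (comp u i) 2 (spaceTime T) := fun i =>
    (hu3 i).mono_exponent (by norm_num)
  have hu3' : ∀ i, MemLp (comp u i) 3 (spaceTime T') := fun i =>
    (hu3 i).mono_measure (spaceTime_mono hT'.le)
  have hC' := fun i => (hC i).mono hT'.le
  have huu : ∀ i j, Integrable (fun p => comp u j p * comp u i p) (spaceTime T') := fun i j =>
    (memLp_comp_mul (r := 3 / 2) (hu3' j) (hu3' i)).integrable one_le_three_halves
  have huuC := fun i j => (hC' j).mul (hu3' j) (hu3' i) (hC' i)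
  set Cij : Fin 3 → Fin 3 → ℝ≥0∞ := fun i j =>
    C * (eLpNorm (comp u i) 3 (spaceTime T') + eLpNorm (comp u j) 3 (spaceTime T'))
  have hCij : ∀ i j, Cij i j ≠ ⊤ := fun i j =>
    ENNReal.mul_ne_top ENNReal.coe_ne_top (ENNReal.add_ne_top.2 ⟨(hu3' i).2.ne, (hu3' j).2.ne⟩)
  choose A hA using fun i j =>
    exists_eLpNorm_stConv_le (presK i j) one_le_three_halves three_halves_ne_top hβ.le
  set R : ℕ → ℝ × T3 → ℂ := fun n => stConv chiK (scale n) (pres P) with hR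
  have hRm : ∀ n, AEStronglyMeasurable (R n) (spaceTime T') := fun n =>
    aestronglyMeasurable_stConv chiK.integrable _ hP.1
  set D : ℝ≥0∞ := ∑ i, ∑ j, A i j * Cij i j
  have hD : D ≠ ⊤ := by
    refine ENNReal.sum_ne_top.2 fun i _ => ENNReal.sum_ne_top.2 fun j _ => ?_
    exact ENNReal.mul_ne_top ENNReal.coe_ne_top (hCij i j)
  set a : ℕ → ℝ≥0∞ := fun n => D * ENNReal.ofReal (2 ^ (-(β * n))) with ha
  have ha_top : ∑' n, a n ≠ ⊤ := by
    have h1 : ∑' n, a n ≤ D * ENNReal.ofReal (1 - 2 ^ (-β))⁻¹ := by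
      rw [ENNReal.tsum_mul_left]
      gcongr
      rw [ENNReal.tsum_eq_iSup_nat]
      exact iSup_le fun J => sum_geometric_le hβ J
    exact (h1.trans_lt (ENNReal.mul_lt_top hD.lt_top ENNReal.ofReal_lt_top)).ne
  -- Each dyadic piece is a convolution of the products with kernels of mean zero, so the modulus of
  -- continuity of the products yields the factor 2^(-βn).
  have hstep : ∀ n, eLpNorm (fun p => R (n + 1) p - R n p) (3 / 2) (spaceTime T') ≤ a n := by
    intro n
    have h := hu.ae_stConv_pres_sub hs hT' hu2 (scale_pos (n + 1))
    rw [← scale_succ] at h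
    rw [eLpNorm_congr_ae h]
    have hz : ∀ i j, 𝓕 (presK i j : E3 → ℂ) 0 = 0 := fun i j => by
      rw [fourier_presK]; exact presSym_eq_zero_of_norm_le i j (by simp)
    have hmij := fun i j => aestronglyMeasurable_stConv (presK i j).integrable (scale (n + 1))
      (huu i j).1
    have e : ∀ (f : Fin 3 → ℝ × T3 → ℂ), (fun p => ∑ i, f i p) = ∑ i, f i := fun f => by
      funext p; simp
    rw [e fun i p => ∑ j, stConv (presK i j) (scale (n + 1)) (fun p => comp u j p * comp u i p) p]
    refine (eLpNorm_sum_le (fun i _ => Finset.aestronglyMeasurable_fun_sum _ fun j _ => hmij i j)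
      one_le_three_halves).trans ?_
    simp only [ha, D, Finset.sum_mul]
    refine Finset.sum_le_sum fun i _ => ?_
    rw [e fun j p => stConv (presK i j) (scale (n + 1)) (fun p => comp u j p * comp u i p) p]
    refine (eLpNorm_sum_le (fun j _ => hmij i j) one_le_three_halves).trans ?_
    refine Finset.sum_le_sum fun j _ => ?_
    have := hA i j (scale (n + 1)) (scale_pos _).le (huu i j) (huuC i j)
    simp only [hz, zero_mul, sub_zero, scale_succ_rpow] at this
    exact this
  have hsum : ∀ J n, eLpNorm (fun p => R (J + n) p - R J p) (3 / 2) (spaceTime T') ≤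
      ∑ m ∈ Finset.range n, a (m + J) := by
    intro J n
    induction n with
    | zero => simp
    | succ n ih =>
      rw [Finset.sum_range_succ]
      have e : (fun p => R (J + (n + 1)) p - R J p) = (fun p => R (J + n) p - R J p) +
          fun p => R (J + n + 1) p - R (J + n) p := by
        funext p; simp [← add_assoc]
      rw [e]
      refine (eLpNorm_add_le ((hRm _).sub (hRm _)) ((hRm _).sub (hRm _))
        one_le_three_halves).trans (add_le_add ih ?_)
      rw [add_comm n J]
      exact hstep (J + n)
  -- The telescoped bounds in L^(3/2) pass to the limit, although the mollified pressures are so far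
  -- known to converge in L¹ only.
  have htail : ∀ J, eLpNorm (fun p => pres P p - R J p) (3 / 2) (spaceTime T') ≤
      ∑' m, a (m + J) := by
    intro J
    refine eLpNorm_le_of_tendsto_eLpNorm_one (f := fun n p => R (J + n) p - R J p)
      (fun n => (hRm _).sub (hRm _)) (hP.1.sub (hRm _)) ?_
      fun n => (hsum J n).trans (ENNReal.sum_le_tsum _)
    have h1 := (tendsto_stConv_sub tendsto_scale hP).comp (tendsto_add_atTop_nat J)
    refine h1.congr fun n => ?_
    simp only [Function.comp_apply, hR]
    congr 1
    funext p
    rw [add_comm n J, Pi.sub_apply]; ring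
  refine ⟨?_, ?_, fun n => (htail n).trans_lt ((ENNReal.tsum_comp_le_tsum_of_injective
    (add_left_injective n) a).trans_lt ha_top.lt_top)⟩
  -- The coarsest mollification is the spatial mean, so the case J = 0 of the tail bound is the
  -- L^(3/2) bound for the pressure minus its mean.
  · have h0 : (fun p => pres P p - fct (pres P) 0 p.1) =ᵐ[spaceTime T'] fun p => pres P p - R 0 p := by
      filter_upwards [ae_stConv_scale_zero hP] with p hp
      simp only [hR]
      rw [hp]
    refine (memLp_congr_ae h0).2 ⟨hP.1.sub (hRm 0), (htail 0).trans_lt ?_⟩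
    simpa using ha_top.lt_top
  · exact tendsto_of_tendsto_of_tendsto_of_le_of_le tendsto_const_nhds
      (ENNReal.tendsto_sum_nat_add a ha_top) (fun _ => zero_le) htail

end

/-! ### Convergence in Lebesgue spaces -/

/-- Convergence in `L^p` of a sequence of functions of `L^p`. -/
structure TendstoLp {X : Type*} [MeasurableSpace X] (μ : Measure X) (p : ℝ≥0∞) (F : ℕ → X → ℂ)
    (f : X → ℂ) : Prop where
  mem : ∀ n, MemLp (F n) p μ
  lim_mem : MemLp f p μ
  tendsto : Tendsto (fun n => eLpNorm (fun x => F n x - f x) p μ) atTop (𝓝 0)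

namespace TendstoLp

variable {X : Type*} [MeasurableSpace X] {μ : Measure X} {p q r : ℝ≥0∞} {F G : ℕ → X → ℂ}
  {f g : X → ℂ}

lemma of_le (hf : MemLp f p μ) (hF : ∀ n, AEStronglyMeasurable (F n) μ) {a : ℕ → ℝ≥0∞}
    (ha : ∀ n, a n ≠ ⊤) (ha0 : Tendsto a atTop (𝓝 0))
    (h : ∀ n, eLpNorm (fun x => F n x - f x) p μ ≤ a n) : TendstoLp μ p F f := by
  refine ⟨fun n => ?_, hf, tendsto_of_tendsto_of_tendsto_of_le_of_le tendsto_const_nhds ha0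
    (fun _ => zero_le) h⟩
  have h1 : MemLp (fun x => F n x - f x) p μ := ⟨(hF n).sub hf.1, (h n).trans_lt (ha n).lt_top⟩
  have := h1.add hf
  refine (memLp_congr_ae (ae_of_all _ fun x => ?_)).1 this
  simp

lemma const (hf : MemLp f p μ) : TendstoLp μ p (fun _ => f) f := ⟨fun _ => hf, hf, by simp⟩

lemma congr (h : TendstoLp μ p F f) (hG : ∀ n, F n =ᵐ[μ] G n) : TendstoLp μ p G f := by
  refine ⟨fun n => (memLp_congr_ae (hG n)).1 (h.mem n), h.lim_mem, h.tendsto.congr fun n => ?_⟩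
  refine eLpNorm_congr_ae ?_
  filter_upwards [hG n] with x hx
  rw [hx]

lemma add (hp : 1 ≤ p) (hF : TendstoLp μ p F f) (hG : TendstoLp μ p G g) :
    TendstoLp μ p (fun n x => F n x + G n x) fun x => f x + g x := by
  refine ⟨fun n => (hF.mem n).add (hG.mem n), hF.lim_mem.add hG.lim_mem, ?_⟩
  have h0 := hF.tendsto.add hG.tendsto
  rw [add_zero] at h0
  refine tendsto_of_tendsto_of_tendsto_of_le_of_le tendsto_const_nhds h0 (fun _ => zero_le) fun n => ?_
  have e : (fun x => F n x + G n x - (f x + g x)) = (fun x => F n x - f x) + fun x => G n x - g x := by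
    funext x; simp only [Pi.add_apply]; ring
  dsimp only
  rw [e]
  exact eLpNorm_add_le ((hF.mem n).sub hF.lim_mem).1 ((hG.mem n).sub hG.lim_mem).1 hp

lemma sum {ι : Type*} (hp : 1 ≤ p) {s : Finset ι} {F : ι → ℕ → X → ℂ} {f : ι → X → ℂ}
    (h : ∀ i ∈ s, TendstoLp μ p (F i) (f i)) :
    TendstoLp μ p (fun n x => ∑ i ∈ s, F i n x) fun x => ∑ i ∈ s, f i x := by
  classical
  induction s using Finset.induction_on with
  | empty =>
    simp only [Finset.sum_empty]
    exact TendstoLp.const (f := fun _ => 0) MemLp.zero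
  | insert i s hi ih =>
    simp only [Finset.sum_insert hi]
    exact add hp (h i (Finset.mem_insert_self _ _)) (ih fun j hj => h j (Finset.mem_insert_of_mem hj))

lemma mul [ENNReal.HolderTriple p q r] (hr : 1 ≤ r) (hF : TendstoLp μ p F f)
    (hG : TendstoLp μ q G g) : TendstoLp μ r (fun n x => F n x * G n x) fun x => f x * g x := by
  refine ⟨fun n => (hG.mem n).mul (hF.mem n), hG.lim_mem.mul hF.lim_mem, ?_⟩
  have h0 : Tendsto (fun n => eLpNorm (fun x => F n x - f x) p μ * eLpNorm (fun x => G n x - g x) q μ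
      + (eLpNorm (fun x => F n x - f x) p μ * eLpNorm g q μ +
        eLpNorm f p μ * eLpNorm (fun x => G n x - g x) q μ)) atTop (𝓝 0) := by
    have h1 := ENNReal.Tendsto.mul hF.tendsto (Or.inr ENNReal.zero_ne_top) hG.tendsto
      (Or.inr ENNReal.zero_ne_top)
    have h2 := ENNReal.Tendsto.mul_const hF.tendsto (Or.inr hG.lim_mem.2.ne)
    have h3 := ENNReal.Tendsto.const_mul hG.tendsto (Or.inr hF.lim_mem.2.ne)
    simpa using h1.add (h2.add h3)
  refine tendsto_of_tendsto_of_tendsto_of_le_of_le tendsto_const_nhds h0 (fun _ => zero_le) fun n => ?_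
  have hFn := ((hF.mem n).sub hF.lim_mem).1
  have hGn := ((hG.mem n).sub hG.lim_mem).1
  have e : (fun x => F n x * G n x - f x * g x) = ((F n - f) • (G n - g)) +
      ((F n - f) • g + f • (G n - g)) := by
    funext x; simp only [Pi.add_apply, Pi.mul_apply, Pi.sub_apply, smul_eq_mul]; ring
  dsimp only
  rw [e]
  refine (eLpNorm_add_le (hFn.smul hGn) ((hFn.smul hG.lim_mem.1).add (hF.lim_mem.1.smul hGn)) hr).trans
    (add_le_add (eLpNorm_smul_le_mul_eLpNorm hGn hFn) ?_)
  exact (eLpNorm_add_le (hFn.smul hG.lim_mem.1) (hF.lim_mem.1.smul hGn) hr).trans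
    (add_le_add (eLpNorm_smul_le_mul_eLpNorm hG.lim_mem.1 hFn)
      (eLpNorm_smul_le_mul_eLpNorm hGn hF.lim_mem.1))

lemma const_fun_mul (hr : 1 ≤ p) (hF : TendstoLp μ p F f) (hg : MemLp g ⊤ μ) :
    TendstoLp μ p (fun n x => g x * F n x) fun x => g x * f x :=
  mul hr (TendstoLp.const hg) hF

lemma tendsto_integral (hF : TendstoLp μ 1 F f) :
    Tendsto (fun n => ∫ x, F n x ∂μ) atTop (𝓝 (∫ x, f x ∂μ)) := by
  refine tendsto_integral_of_L1 f hF.lim_mem.1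
    (Eventually.of_forall fun n => memLp_one_iff_integrable.1 (hF.mem n)) ?_
  simpa only [eLpNorm_one_eq_lintegral_enorm] using hF.tendsto

end TendstoLp

/-! ### Trigonometric truncations in space-time -/

/-- A finite Fourier multiplier applied to the time slices. -/
def stTrig (S : Finset (Fin 3 → ℤ)) (a : (Fin 3 → ℤ) → ℂ) (F : ℝ × T3 → ℂ) (p : ℝ × T3) : ℂ :=
  trigPoly S (fun k => a k * fct F k p.1) p.2

lemma aestronglyMeasurable_stTrig {T : ℝ} (S : Finset (Fin 3 → ℤ)) (a : (Fin 3 → ℤ) → ℂ)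
    {F : ℝ × T3 → ℂ} (hF : AEStronglyMeasurable F (spaceTime T)) :
    AEStronglyMeasurable (stTrig S a F) (spaceTime T) := by
  refine Finset.aestronglyMeasurable_fun_sum _ fun k _ => ?_
  exact ((aestronglyMeasurable_fct hF k).comp_fst.const_mul _).mul
    ((mFourier k).continuous.comp continuous_snd).aestronglyMeasurable

lemma stConv_ae_eq_stTrig {T : ℝ} (K : 𝓢(E3, ℂ)) (c : ℝ) {S : Finset (Fin 3 → ℤ)}
    (hS : ∀ k ∉ S, 𝓕 (K : E3 → ℂ) (c • freq k) = 0) {F : ℝ × T3 → ℂ}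
    (hF : Integrable F (spaceTime T)) :
    stConv K c F =ᵐ[spaceTime T] stTrig S (fun k => 𝓕 (K : E3 → ℂ) (c • freq k)) F := by
  refine ae_eq_spaceTime (aestronglyMeasurable_stConv K.integrable _ hF.1)
    (aestronglyMeasurable_stTrig _ _ hF.1) ?_
  filter_upwards [hF.prod_right_ae] with t ht
  exact kconv_ae_eq_trigOp K.integrable c hS ht

/-- The truncation `S_c F`. -/
def stLow (c : ℝ) (F : ℝ × T3 → ℂ) : ℝ × T3 → ℂ :=
  stTrig (modes (2 / c)) (fun k => chi (c • freq k)) F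

/-- The derivative `∂ⱼ S_c F`. -/
def stLowD (j : Fin 3) (c : ℝ) (F : ℝ × T3 → ℂ) : ℝ × T3 → ℂ :=
  stTrig (modes (2 / c)) (fun k => dsym j k * chi (c • freq k)) F

/-- Two forms of the same truncation: the convolution form gives the estimates, the trigonometric
form can be differentiated and multiplied exactly at every time. -/
lemma stConv_ae_eq_stLow {T c : ℝ} (hc : 0 < c) {F : ℝ × T3 → ℂ}
    (hF : Integrable F (spaceTime T)) : stConv chiK c F =ᵐ[spaceTime T] stLow c F := by
  have := stConv_ae_eq_stTrig chiK c (S := modes (2 / c)) (fun k hk => by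
    rw [fourier_chiK]; exact chi_eq_zero (two_lt_of_notMem_modes hc hk).le) hF
  simp only [fourier_chiK] at this
  exact this

/-- The symbol of `∂ⱼ` localised by `chi`. -/
def derSym (j : Fin 3) (ξ : E3) : ℂ := (2 * Real.pi * Complex.I) * ((ξ j : ℝ) : ℂ) * chi ξ

lemma exists_derK (j : Fin 3) : ∃ K : 𝓢(E3, ℂ), ∀ ξ, 𝓕 (K : E3 → ℂ) ξ = derSym j ξ := by
  refine exists_kernel (hasCompactSupport_chi.mul_left) ?_
  have : ContDiff ℝ ∞ fun ξ : E3 => ((ξ j : ℝ) : ℂ) :=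
    Complex.ofRealCLM.contDiff.comp (EuclideanSpace.proj (𝕜 := ℝ) j : E3 →L[ℝ] ℝ).contDiff
  exact (contDiff_const.mul this).mul contDiff_chi

def derK (j : Fin 3) : 𝓢(E3, ℂ) := (exists_derK j).choose

lemma fourier_derK (j : Fin 3) (ξ : E3) : 𝓕 (derK j : E3 → ℂ) ξ = derSym j ξ :=
  (exists_derK j).choose_spec ξ

/-- The symbol of ∂ⱼ has degree one, so evaluating the localised symbol at the rescaled frequency
produces a factor c, undone by the prefactor. -/
lemma stConv_ae_eq_stLowD {T c : ℝ} (hc : 0 < c) (j : Fin 3) {F : ℝ × T3 → ℂ}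
    (hF : Integrable F (spaceTime T)) :
    (fun p => (c : ℂ)⁻¹ * stConv (derK j) c F p) =ᵐ[spaceTime T] stLowD j c F := by
  have h := stConv_ae_eq_stTrig (derK j) c (S := modes (2 / c)) (fun k hk => by
    rw [fourier_derK, derSym, chi_eq_zero (two_lt_of_notMem_modes hc hk).le, mul_zero]) hF
  filter_upwards [h] with p hp
  rw [hp]
  simp only [stLowD, stTrig, trigPoly, Finset.mul_sum, fourier_derK, derSym]
  refine Finset.sum_congr rfl fun k _ => ?_
  have hc' : (c : ℂ) ≠ 0 := by exact_mod_cast hc.ne'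
  simp only [dsym, freq, PiLp.smul_apply, smul_eq_mul]
  push_cast
  field_simp

section Estimates

variable {T β : ℝ} {C : ℝ≥0∞}

lemma exists_eLpNorm_stLow_sub_le (hβ : 0 ≤ β) : ∃ A : ℝ≥0, ∀ {T : ℝ} {F : ℝ × T3 → ℂ} {C : ℝ≥0∞}
    (c : ℝ), 0 < c → MemLp F 3 (spaceTime T) → HasModulus (spaceTime T) stShift 3 β C F →
      eLpNorm (fun p => stLow c F p - F p) 3 (spaceTime T) ≤ A * C * ENNReal.ofReal (c ^ β) := by
  obtain ⟨A, hA⟩ := exists_eLpNorm_stConv_le chiK (p := 3) (by norm_num) (by simp) hβ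
  refine ⟨A, fun {T F C} c hc hF hC => ?_⟩
  have hFi := hF.integrable (by norm_num)
  have := hA c hc.le hFi hC
  rw [fourier_chiK, chi_eq_one (by simp)] at this
  refine le_trans (le_of_eq (eLpNorm_congr_ae ?_)) this
  filter_upwards [stConv_ae_eq_stLow hc hFi] with p hp
  rw [hp, one_mul]

/-- The kernel has mean zero because its symbol vanishes at the origin, which gives c^β; the
derivative costs c⁻¹. -/
lemma exists_eLpNorm_stLowD_le (hβ : 0 ≤ β) (j : Fin 3) :
    ∃ A : ℝ≥0, ∀ {T : ℝ} {F : ℝ × T3 → ℂ} {C : ℝ≥0∞}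
    (c : ℝ), 0 < c → MemLp F 3 (spaceTime T) → HasModulus (spaceTime T) stShift 3 β C F →
      eLpNorm (stLowD j c F) 3 (spaceTime T) ≤ A * C * ENNReal.ofReal (c ^ (β - 1)) := by
  obtain ⟨A, hA⟩ := exists_eLpNorm_stConv_le (derK j) (p := 3) (by norm_num) (by simp) hβ
  refine ⟨A, fun {T F C} c hc hF hC => ?_⟩
  have hFi := hF.integrable (by norm_num)
  have := hA c hc.le hFi hC
  have hz : derSym j 0 = 0 := by simp [derSym]
  simp only [fourier_derK, hz, zero_mul, sub_zero] at this
  rw [← eLpNorm_congr_ae (stConv_ae_eq_stLowD hc j hFi)]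
  have e : (fun p => (c : ℂ)⁻¹ * stConv (derK j) c F p) = (c : ℂ)⁻¹ • stConv (derK j) c F := rfl
  rw [e, eLpNorm_const_smul]
  refine (mul_le_mul_right this _).trans (le_of_eq ?_)
  have e2 : ‖((c : ℂ)⁻¹)‖ₑ = ENNReal.ofReal c⁻¹ := by
    rw [← ofReal_norm, norm_inv, Complex.norm_real, Real.norm_of_nonneg hc.le]
  rw [e2, mul_left_comm, ← ENNReal.ofReal_mul (by positivity), Real.rpow_sub_one hc.ne']
  congr 2
  rw [div_eq_mul_inv, mul_comm]

/-- The commutator estimate of Constantin, E and Titi. -/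
lemma exists_eLpNorm_commutator_le (hβ : 0 ≤ β) :
    ∃ A : ℝ≥0, ∀ {T : ℝ} {F G : ℝ × T3 → ℂ} {C : ℝ≥0∞} (c : ℝ), 0 < c →
      MemLp F 3 (spaceTime T) → MemLp G 3 (spaceTime T) →
      HasModulus (spaceTime T) stShift 3 β C F → HasModulus (spaceTime T) stShift 3 β C G →
      eLpNorm (fun p => stLow c (fun p => F p * G p) p - stLow c F p * stLow c G p) (3 / 2)
        (spaceTime T) ≤ A * C ^ 2 * ENNReal.ofReal (c ^ (β + β)) := by
  obtain ⟨A, hA⟩ := exists_moment_bound chiK one_le_three_halves three_halves_ne_top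
    (add_nonneg hβ hβ)
  obtain ⟨B, hB⟩ := exists_eLpNorm_stLow_sub_le hβ
  refine ⟨A + B ^ 2, fun {T F G C} c hc hF hG hFC hGC => ?_⟩
  have hsh := isShift_stShift T
  have hFi := hF.integrable (by norm_num)
  have hGi := hG.integrable (by norm_num)
  have hFG : MemLp (fun p => F p * G p) (3 / 2) (spaceTime T) := memLp_comp_mul hF hG
  have hFGi := hFG.integrable one_le_three_halves
  have hmF := hsh.aestronglyMeasurable_sub (measurable_neg_smul c) hF.1
  have hmG := hsh.aestronglyMeasurable_sub (measurable_neg_smul c) hG.1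
  set g : E3 → ℝ × T3 → ℂ := fun z p =>
    (F (stShift (-(c • z)) p) - F p) * (G (stShift (-(c • z)) p) - G p) with hg
  have hgm : AEStronglyMeasurable (Function.uncurry g) ((volume : Measure E3).prod (spaceTime T)) :=
    hmF.mul hmG
  have hdiff : ∀ {H : ℝ × T3 → ℂ}, MemLp H 3 (spaceTime T) → ∀ z,
      MemLp (fun p => H (stShift (-(c • z)) p) - H p) 3 (spaceTime T) := fun {H} hH z =>
    (hH.comp_measurePreserving (measurePreserving_stShift T (-(c • z)))).sub hH
  have hnz : ∀ z : E3, ‖-(c • z)‖ = c * ‖z‖ := fun z => by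
    rw [norm_neg, norm_smul, Real.norm_of_nonneg hc.le]
  have hgb : ∀ z, eLpNorm (g z) (3 / 2) (spaceTime T) ≤
      C ^ 2 * ENNReal.ofReal ((c * ‖z‖) ^ (β + β)) := by
    intro z
    have h1 := eLpNorm_smul_le_mul_eLpNorm (p := 3) (q := 3) (r := 3 / 2) (hdiff hG z).1
      (hdiff hF z).1
    refine h1.trans ((mul_le_mul' (hFC (-(c • z))) (hGC (-(c • z)))).trans (le_of_eq ?_))
    rw [hnz, Real.rpow_add_of_nonneg (by positivity) hβ hβ, ENNReal.ofReal_mul (by positivity)]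
    ring
  have h1 := hA g (C ^ 2) c hc.le hgm hgb
  have hmS : ∀ {H : ℝ × T3 → ℂ}, MemLp H 3 (spaceTime T) →
      AEStronglyMeasurable (fun p => stLow c H p - H p) (spaceTime T) := fun {H} hH =>
    (aestronglyMeasurable_stTrig _ _ hH.1).sub hH.1
  have h2 : eLpNorm (fun p => (stLow c F p - F p) * (stLow c G p - G p)) (3 / 2) (spaceTime T) ≤
      B ^ 2 * C ^ 2 * ENNReal.ofReal (c ^ (β + β)) := by
    refine (eLpNorm_smul_le_mul_eLpNorm (p := 3) (q := 3) (r := 3 / 2) (hmS hG) (hmS hF)).trans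
      ((mul_le_mul' (hB c hc hF hFC) (hB c hc hG hGC)).trans (le_of_eq ?_))
    rw [Real.rpow_add hc, ENNReal.ofReal_mul (by positivity)]
    ring
  have hm1 : AEStronglyMeasurable (fun p => ∫ z, chiK z * g z p) (spaceTime T) := by
    have : AEStronglyMeasurable (fun q : (ℝ × T3) × E3 => chiK q.2 * g q.2 q.1)
        ((spaceTime T).prod volume) :=
      (chiK.continuous.comp continuous_snd).aestronglyMeasurable.mul hgm.prod_swap
    exact this.integral_prod_right'
  -- As the kernel has integral one, S(FG) - SF·SG = ∫ K(z) δF δG dz - (SF - F)(SG - G). Both terms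
  -- are quadratic in increments, whence the exponent 2β.
  have key : (fun p => stLow c (fun p => F p * G p) p - stLow c F p * stLow c G p)
      =ᵐ[spaceTime T] (fun p => ∫ z, chiK z * g z p) -
        fun p => (stLow c F p - F p) * (stLow c G p - G p) := by
    have hK : Integrable (chiK : E3 → ℂ) := chiK.integrable
    filter_upwards [stConv_ae_eq_stLow hc hFi, stConv_ae_eq_stLow hc hGi,
      stConv_ae_eq_stLow hc hFGi, ae_integrable_kconv hsh hK c hFi, ae_integrable_kconv hsh hK c hGi,
      ae_integrable_kconv hsh hK c hFGi] with p e1 e2 e3 i1 i2 i3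
    have e4 : ∫ z, chiK z * g z p = stConv chiK c (fun p => F p * G p) p
        - G p * stConv chiK c F p - F p * stConv chiK c G p + F p * G p := by
      have e5 : ∀ z, chiK z * g z p = chiK z * (F (stShift (-(c • z)) p) * G (stShift (-(c • z)) p))
          - G p * (chiK z * F (stShift (-(c • z)) p)) - F p * (chiK z * G (stShift (-(c • z)) p))
          + chiK z * (F p * G p) := fun z => by simp only [hg]; ring
      simp only [e5]
      have j2 : Integrable fun z => chiK z * (F (stShift (-(c • z)) p) * G (stShift (-(c • z)) p))
          - G p * (chiK z * F (stShift (-(c • z)) p)) := i3.sub (i1.const_mul _)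
      have j3 : Integrable fun z => chiK z * (F (stShift (-(c • z)) p) * G (stShift (-(c • z)) p))
          - G p * (chiK z * F (stShift (-(c • z)) p)) - F p * (chiK z * G (stShift (-(c • z)) p)) :=
        j2.sub (i2.const_mul _)
      rw [integral_add j3 (hK.mul_const _), integral_sub j2 (i2.const_mul _),
        integral_sub i3 (i1.const_mul _), integral_const_mul, integral_const_mul,
        integral_mul_const, integral_kernel (K := chiK), fourier_chiK, chi_eq_one (by simp), one_mul]
      rfl
    simp only [Pi.sub_apply]
    rw [e4, e1, e2, e3]
    ring
  rw [eLpNorm_congr_ae key]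
  refine (eLpNorm_sub_le hm1 ((hmS hF).mul (hmS hG)) one_le_three_halves).trans ?_
  refine (add_le_add h1 h2).trans (le_of_eq ?_)
  push_cast; ring

end Estimates

/-! ### The local energy balance of the truncations -/

lemma integrable_of_continuous {f : T3 → ℂ} (hf : Continuous f) : Integrable f torusVol := by
  obtain ⟨C, hC⟩ := isCompact_univ.exists_bound_of_continuousOn hf.continuousOn
  exact (integrable_const C).mono' hf.aestronglyMeasurable (ae_of_all _ fun x => hC x (mem_univ x))

lemma integral_mul_trigPoly_mul_trigPoly {g : T3 → ℂ} (hg : Continuous g)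
    (S : Finset (Fin 3 → ℤ)) (a b : (Fin 3 → ℤ) → ℂ) :
    ∫ x, g x * (trigPoly S a x * trigPoly S b x) ∂torusVol =
      ∑ k ∈ S, ∑ l ∈ S, a k * b l * ∫ x, g x * (mFourier k x * mFourier l x) ∂torusVol := by
  have hi : ∀ k l, Integrable (fun x => a k * b l * (g x * (mFourier k x * mFourier l x))) torusVol :=
    fun k l => integrable_of_continuous (by fun_prop)
  simp only [← integral_const_mul]
  have e : ∀ k ∈ S, ∑ l ∈ S, ∫ x, a k * b l * (g x * (mFourier k x * mFourier l x)) ∂torusVol =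
      ∫ x, ∑ l ∈ S, a k * b l * (g x * (mFourier k x * mFourier l x)) ∂torusVol := fun k _ =>
    (integral_finsetSum _ fun l _ => hi k l).symm
  rw [Finset.sum_congr rfl e, ← integral_finsetSum _ fun k _ =>
    integrable_finsetSum _ fun l _ => hi k l]
  congr 1; ext x
  rw [trigPoly, trigPoly, Finset.sum_mul_sum, Finset.mul_sum]
  refine Finset.sum_congr rfl fun k _ => ?_
  rw [Finset.mul_sum]
  exact Finset.sum_congr rfl fun l _ => by ring

/-- Integration by parts in the nonlinear terms, for a divergence free field. -/
lemma integral_nonlinear_eq {w : Fin 3 → T3 → ℂ} {M : Fin 3 → Fin 3 → T3 → ℂ} {Q Ψ : T3 → ℂ}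
    (hw : ∀ i, TSmooth (w i)) (hM : ∀ i j, TSmooth (M i j)) (hQ : TSmooth Q) (hΨ : TSmooth Ψ)
    (hdiv : ∀ x, ∑ i, tderiv i (w i) x = 0) (p₀ : ℂ) :
    ∑ i, 2 * ∫ x, Ψ x * ((-∑ j, tderiv j (M i j) x - tderiv i Q x) * w i x) ∂torusVol =
      ∫ x, ((∑ j, w j x * tderiv j Ψ x) * (∑ i, w i x * w i x)
        + (∑ i, ∑ j, 2 * ((M i j x - w j x * w i x) *
            (tderiv j Ψ x * w i x + Ψ x * tderiv j (w i) x)))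
        + 2 * ((Q x - p₀) * ∑ j, w j x * tderiv j Ψ x)) ∂torusVol := by
  have cw := fun i => (hw i).continuous
  have cM := fun i j => (hM i j).continuous
  have cQ := hQ.continuous
  have cΨ := hΨ.continuous
  have cdw := fun j i => ((hw i).tderiv j).continuous
  have cdM := fun k i j => ((hM i j).tderiv k).continuous
  have cdQ := fun j => (hQ.tderiv j).continuous
  have cdΨ := fun j => (hΨ.tderiv j).continuous
  -- Z is chosen so that its divergence is the difference of the two integrands, up to a multiple of
  -- div w. Its integral vanishes on the torus.
  set Z : Fin 3 → T3 → ℂ := fun j x => Ψ x * (((∑ i, w i x * w i x) + 2 * p₀ - 2 * Q x) * w j x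
    - 2 * ∑ i, w i x * M i j x) with hZdef
  have hZ : ∀ j, TSmooth (Z j) := by
    intro j
    refine hΨ.mul (ContDiff.sub (ContDiff.mul (ContDiff.sub (ContDiff.add ?_ contDiff_const)
      (ContDiff.mul contDiff_const hQ)) (hw j)) (ContDiff.mul contDiff_const ?_))
    · exact ContDiff.sum fun i _ => ContDiff.mul (hw i) (hw i)
    · exact ContDiff.sum fun i _ => ContDiff.mul (hw i) (hM i j)
  have h0 : ∀ x (i : Fin 3), x + Pi.single i ((0 : ℝ) : UnitAddCircle) = x := by
    intro x i; simp
  have hdZ : ∀ j x, tderiv j (Z j) x =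
      tderiv j Ψ x * (((∑ i, w i x * w i x) + 2 * p₀ - 2 * Q x) * w j x
        - 2 * ∑ i, w i x * M i j x) +
      Ψ x * ((((∑ i, (tderiv j (w i) x * w i x + w i x * tderiv j (w i) x)) - 2 * tderiv j Q x)
        * w j x + ((∑ i, w i x * w i x) + 2 * p₀ - 2 * Q x) * tderiv j (w j) x)
        - 2 * ∑ i, (tderiv j (w i) x * M i j x + w i x * tderiv j (M i j) x)) := by
    intro j x
    have d1 := hΨ.hasDerivAt j x
    have d2 := fun i => (hw i).hasDerivAt j x
    have d3 := hQ.hasDerivAt j x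
    have d4 := fun i => (hM i j).hasDerivAt j x
    have d5 := HasDerivAt.fun_sum (u := Finset.univ) fun i _ => (d2 i).mul (d2 i)
    have d6 := HasDerivAt.fun_sum (u := Finset.univ) fun i _ => (d2 i).mul (d4 i)
    have d7 := d1.mul (((((d5.add_const (2 * p₀)).sub (d3.const_mul 2)).mul (d2 j))).sub
      (d6.const_mul 2))
    have d8 := d7.deriv
    simp only [Pi.mul_apply, Pi.sub_apply, h0] at d8
    exact d8
  have hL : ∀ i, Integrable (fun x => Ψ x * ((-∑ j, tderiv j (M i j) x - tderiv i Q x) * w i x))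
      torusVol := fun i => integrable_of_continuous (by fun_prop)
  have hR : Integrable (fun x => (∑ j, w j x * tderiv j Ψ x) * (∑ i, w i x * w i x)
        + (∑ i, ∑ j, 2 * ((M i j x - w j x * w i x) *
            (tderiv j Ψ x * w i x + Ψ x * tderiv j (w i) x)))
        + 2 * ((Q x - p₀) * ∑ j, w j x * tderiv j Ψ x)) torusVol :=
    integrable_of_continuous (by fun_prop)
  have hsum : ∫ x, ∑ j, tderiv j (Z j) x ∂torusVol = 0 := by
    rw [integral_finsetSum _ fun j _ => ((hZ j).tderiv j).integrable]
    exact Finset.sum_eq_zero fun j _ => (hZ j).integral_tderiv j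
  rw [← sub_eq_zero]
  simp only [← integral_const_mul]
  rw [← integral_finsetSum _ fun i _ => (hL i).const_mul 2, ← integral_sub
    (integrable_finsetSum _ fun i _ => (hL i).const_mul 2) hR, ← hsum]
  congr 1; ext x
  have hd := hdiv x
  simp only [hdZ, Fin.sum_univ_three] at hd ⊢
  -- All terms left over carry the factor div w = 0. This is also why the constant p₀ may be chosen
  -- freely.
  linear_combination (-(Ψ x * ((w 0 x * w 0 x + w 1 x * w 1 x + w 2 x * w 2 x) + 2 * p₀ - 2 * Q x))) * hd

/-- The symmetrised nonlinear flux of the truncated solution. -/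
def truncFlux (u : ℝ → T3 → E3) (P : ℝ → T3 → ℝ) (Ψ : ℝ → T3 → ℂ) (c : ℝ) (p : ℝ × T3) : ℂ :=
  deriv (fun τ => Ψ τ p.2) p.1 * (∑ i, stLow c (comp u i) p * stLow c (comp u i) p)
    + ((∑ j, stLow c (comp u j) p * tderiv j (Ψ p.1) p.2) *
          (∑ i, stLow c (comp u i) p * stLow c (comp u i) p)
      + (∑ i, ∑ j, 2 * ((stLow c (fun p => comp u j p * comp u i p) p
            - stLow c (comp u j) p * stLow c (comp u i) p) *
          (tderiv j (Ψ p.1) p.2 * stLow c (comp u i) p + Ψ p.1 p.2 * stLowD j c (comp u i) p)))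
      + 2 * ((stLow c (pres P) p - fct (pres P) 0 p.1) *
          ∑ j, stLow c (comp u j) p * tderiv j (Ψ p.1) p.2))

/-- The dissipation of the truncated solution. -/
def truncVisc (s : ℝ) (u : ℝ → T3 → E3) (Ψ : ℝ → T3 → ℂ) (c t : ℝ) : ℂ :=
  ∑ i, ∑ k ∈ modes (2 / c), ∑ l ∈ modes (2 / c),
    (chi (c • freq k) * ((wt (s / 2) k ^ 2 : ℝ) : ℂ) * fct (comp u i) k t) *
      (chi (c • freq l) * fct (comp u i) l t) *
      ∫ x, Ψ t x * (mFourier k x * mFourier l x) ∂torusVol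

section

variable {ν s T : ℝ} {u₀ : T3 → E3} {u : ℝ → T3 → E3} {P : ℝ → T3 → ℝ}

/-- The coefficients of the truncation satisfy ordinary differential equations in the weak sense.
The product rule for two of them, tested with ∫ Ψ e_k e_l dx and summed over k, l, gives the local
balance after integrating by parts in space. Squares are taken without conjugation, which keeps the
identity polynomial; in the limit the components are real. -/
lemma IsLerayHopf.truncated_balance (hu : IsLerayHopf ν s T u₀ u P) (hs : 0 ≤ s) {T' : ℝ}
    (hT0 : 0 < T') (hT' : T' < T) (hu2 : ∀ i, MemLp (comp u i) 2 (spaceTime T))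
    {Ψ : ℝ → T3 → ℂ} (hΨ : SmoothST Ψ) (hΨ0 : ∀ x, Ψ 0 x = 0) (hΨ1 : ∀ x, Ψ T' x = 0) (c : ℝ)
    (hint : Integrable (truncFlux u P Ψ c) (spaceTime T')) :
    ∫ t in Ioo 0 T', 2 * (ν : ℂ) * truncVisc s u Ψ c t = ∫ p, truncFlux u P Ψ c p ∂spaceTime T' := by
  set S := modes (2 / c) with hS
  set χ : (Fin 3 → ℤ) → ℂ := fun k => chi (c • freq k)
  set y : Fin 3 → (Fin 3 → ℤ) → ℝ → ℂ := fun i k => fct (comp u i) k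
  set G : Fin 3 → (Fin 3 → ℤ) → ℝ → ℂ := fun i k t =>
    -(ν * wt (s / 2) k ^ 2 : ℝ) * fct (comp u i) k t
      - ∑ j, dsym j k * fct (fun p => comp u j p * comp u i p) k t
      - dsym i k * fct (pres P) k t with hG
  set θ : (Fin 3 → ℤ) → (Fin 3 → ℤ) → ℝ → ℂ := fun k l t =>
    ∫ x, Ψ t x * (mFourier k x * mFourier l x) ∂torusVol with hθ
  set θ' : (Fin 3 → ℤ) → (Fin 3 → ℤ) → ℝ → ℂ := fun k l t =>
    ∫ x, deriv (fun τ => Ψ τ x) t * (mFourier k x * mFourier l x) ∂torusVol with hθ'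
  have hee : ∀ k l : Fin 3 → ℤ, Continuous fun x => mFourier k x * mFourier l x := fun k l => by
    fun_prop
  have hyi : ∀ i k, IntegrableOn (y i k) (Ioo 0 T') := fun i k =>
    integrableOn_fct (((hu2 i).mono_measure (spaceTime_mono hT'.le)).integrable one_le_two) k
  -- The temporal test function is ∫ Ψ e_k e_l dx, which vanishes at 0 and T' because Ψ does.
  have hpr := fun i k l => HasWeakDeriv.integral_mul_mul hT0 (hyi i k) (hyi i l)
    (hu.hasWeakDeriv_fct hs hT' hu2 i k).1 (hu.hasWeakDeriv_fct hs hT' hu2 i l).1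
    (hu.hasWeakDeriv_fct hs hT' hu2 i k).2 (hu.hasWeakDeriv_fct hs hT' hu2 i l).2
    (θ := θ k l) (θ' := θ' k l) (fun t => hΨ.hasDerivAt_integral_mul (hee k l) t)
    (hΨ.dt.continuous_integral_mul (hee k l)) (by simp [hθ, hΨ0]) (by simp [hθ, hΨ1])
  set E : ℝ → ℂ := fun t => ∑ i, ∑ k ∈ S, ∑ l ∈ S, χ k * χ l *
    (θ' k l t * (y i k t * y i l t) + θ k l t * (G i k t * y i l t + y i k t * G i l t)) with hE
  have hEi : ∀ i k l, IntegrableOn (fun t => χ k * χ l *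
      (θ' k l t * (y i k t * y i l t) + θ k l t * (G i k t * y i l t + y i k t * G i l t)))
      (Ioo 0 T') := fun i k l => ((hpr i k l).2.1.add (hpr i k l).2.2).const_mul _
  have hEint : IntegrableOn E (Ioo 0 T') :=
    integrable_finsetSum _ fun i _ => integrable_finsetSum _ fun k _ =>
      integrable_finsetSum _ fun l _ => hEi i k l
  have hE0 : ∫ t in Ioo 0 T', E t = 0 := by
    simp only [hE]
    rw [integral_finsetSum _ fun i _ => integrable_finsetSum _ fun k _ =>
      integrable_finsetSum _ fun l _ => hEi i k l]
    refine Finset.sum_eq_zero fun i _ => ?_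
    rw [integral_finsetSum _ fun k _ => integrable_finsetSum _ fun l _ => hEi i k l]
    refine Finset.sum_eq_zero fun k _ => ?_
    rw [integral_finsetSum _ fun l _ => hEi i k l]
    refine Finset.sum_eq_zero fun l _ => ?_
    rw [integral_const_mul, (hpr i k l).1, mul_zero]
  have hdiv := ae_restrict_of_ae_restrict_of_subset (Ioo_subset_Ioo_right hT'.le)
    (hu.ae_sum_dsym_mul_fct hu2)
  -- For fixed t this is algebra and integration by parts for trigonometric polynomials; integrated
  -- in time, E disappears.
  have key : ∀ᵐ t ∂(volume : Measure ℝ).restrict (Ioo 0 T'),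
      2 * (ν : ℂ) * truncVisc s u Ψ c t = (∫ x, truncFlux u P Ψ c (t, x) ∂torusVol) - E t := by
    filter_upwards [hdiv] with t hdiv
    set w : Fin 3 → T3 → ℂ := fun i => trigPoly S fun k => χ k * y i k t with hw
    set V : Fin 3 → T3 → ℂ := fun i => trigPoly S fun k => χ k * ((wt (s / 2) k ^ 2 : ℝ) : ℂ) * y i k t
    set M : Fin 3 → Fin 3 → T3 → ℂ := fun i j => trigPoly S fun k =>
      χ k * fct (fun p => comp u j p * comp u i p) k t
    set Q : T3 → ℂ := trigPoly S fun k => χ k * fct (pres P) k t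
    have hwc : ∀ i, Continuous (w i) := fun i => continuous_trigPoly _ _
    have hVc : ∀ i, Continuous (V i) := fun i => continuous_trigPoly _ _
    have hΨc : Continuous (Ψ t) := (hΨ.tsmooth t).continuous
    have hΨtc : Continuous fun x => deriv (fun τ => Ψ τ x) t := (hΨ.dt.tsmooth t).continuous
    have hWG : ∀ i x, trigPoly S (fun k => χ k * G i k t) x =
        -(ν : ℂ) * V i x + (-∑ j, tderiv j (M i j) x - tderiv i Q x) := by
      intro i x
      simp only [M, Q, V, tderiv_trigPoly]
      simp only [trigPoly, Finset.mul_sum]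
      rw [Finset.sum_comm, ← Finset.sum_neg_distrib, ← Finset.sum_sub_distrib,
        ← Finset.sum_add_distrib]
      refine Finset.sum_congr rfl fun k _ => ?_
      simp only [hG, y]
      rw [mul_sub, mul_sub, sub_mul, sub_mul, Finset.mul_sum, Finset.sum_mul]
      have : ∀ j, χ k * (dsym j k * fct (fun p => comp u j p * comp u i p) k t) * mFourier k x =
        dsym j k * (χ k * fct (fun p => comp u j p * comp u i p) k t) * mFourier k x :=
        fun j => by ring
      simp only [this]
      push_cast; ring
    have hdivw : ∀ x, ∑ i, tderiv i (w i) x = 0 := by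
      intro x
      simp only [hw, tderiv_trigPoly]
      simp only [trigPoly]
      rw [Finset.sum_comm]
      refine Finset.sum_eq_zero fun k _ => ?_
      rw [← Finset.sum_mul]
      have : ∑ i, dsym i k * (χ k * y i k t) = χ k * ∑ i, dsym i k * y i k t := by
        rw [Finset.mul_sum]; exact Finset.sum_congr rfl fun i _ => by ring
      rw [this, hdiv k, mul_zero, zero_mul]
    -- The free constant p₀ is taken to be the mean of the pressure at time t, since only P minus
    -- its mean is controlled in L^(3/2).
    have hnl := integral_nonlinear_eq (w := w) (M := M) (Q := Q) (fun i => tsmooth_trigPoly _ _)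
      (fun i j => tsmooth_trigPoly _ _) (tsmooth_trigPoly _ _) (hΨ.tsmooth t) hdivw
      (fct (pres P) 0 t)
    have hdw : ∀ i j x, tderiv j (w i) x = stLowD j c (comp u i) (t, x) := by
      intro i j x
      simp only [hw, tderiv_trigPoly, stLowD, stTrig, χ, y, ← mul_assoc, hS]
    have hEt : E t = (∑ i, ∫ x, deriv (fun τ => Ψ τ x) t * (w i x * w i x) ∂torusVol) +
        ∑ i, 2 * ∫ x, Ψ t x * (trigPoly S (fun k => χ k * G i k t) x * w i x) ∂torusVol := by
      rw [← Finset.sum_add_distrib]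
      refine Finset.sum_congr rfl fun i _ => ?_
      rw [integral_mul_trigPoly_mul_trigPoly hΨtc, integral_mul_trigPoly_mul_trigPoly hΨc, two_mul]
      -- The two halves of the product rule agree after exchanging k and l, which accounts for the
      -- factor 2.
      have hsymm : ∑ k ∈ S, ∑ l ∈ S, χ k * G i k t * (χ l * y i l t) *
          ∫ x, Ψ t x * (mFourier k x * mFourier l x) ∂torusVol =
          ∑ k ∈ S, ∑ l ∈ S, χ l * G i l t * (χ k * y i k t) *
          ∫ x, Ψ t x * (mFourier k x * mFourier l x) ∂torusVol := by
        rw [Finset.sum_comm]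
        refine Finset.sum_congr rfl fun k _ => Finset.sum_congr rfl fun l _ => ?_
        congr 2; ext x; ring
      nth_rewrite 2 [hsymm]
      simp only [← Finset.sum_add_distrib]
      refine Finset.sum_congr rfl fun k _ => Finset.sum_congr rfl fun l _ => ?_
      simp only [hθ, hθ']
      ring
    have hVt : truncVisc s u Ψ c t = ∑ i, ∫ x, Ψ t x * (V i x * w i x) ∂torusVol := by
      unfold truncVisc
      refine Finset.sum_congr rfl fun i _ => ?_
      rw [integral_mul_trigPoly_mul_trigPoly hΨc]
    have hsplit : ∀ i, ∫ x, Ψ t x * (trigPoly S (fun k => χ k * G i k t) x * w i x) ∂torusVol =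
        -(ν : ℂ) * (∫ x, Ψ t x * (V i x * w i x) ∂torusVol) +
        ∫ x, Ψ t x * ((-∑ j, tderiv j (M i j) x - tderiv i Q x) * w i x) ∂torusVol := by
      intro i
      have cdM := fun j => ((tsmooth_trigPoly S fun k =>
        χ k * fct (fun p => comp u j p * comp u i p) k t).tderiv j).continuous
      have cdQ := ((tsmooth_trigPoly S fun k => χ k * fct (pres P) k t).tderiv i).continuous
      have j1 : Integrable (fun x => -(ν : ℂ) * (Ψ t x * (V i x * w i x))) torusVol :=
        integrable_of_continuous (by fun_prop)
      have j2 : Integrable (fun x => Ψ t x * ((-∑ j, tderiv j (M i j) x - tderiv i Q x) * w i x))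
          torusVol := integrable_of_continuous (by fun_prop)
      rw [← integral_const_mul, ← integral_add j1 j2]
      congr 1; ext x
      rw [hWG]; ring
    have hflux : ∫ x, truncFlux u P Ψ c (t, x) ∂torusVol =
        (∑ i, ∫ x, deriv (fun τ => Ψ τ x) t * (w i x * w i x) ∂torusVol) +
        ∫ x, ((∑ j, w j x * tderiv j (Ψ t) x) * (∑ i, w i x * w i x)
        + (∑ i, ∑ j, 2 * ((M i j x - w j x * w i x) *
            (tderiv j (Ψ t) x * w i x + Ψ t x * tderiv j (w i) x)))
        + 2 * ((Q x - fct (pres P) 0 t) * ∑ j, w j x * tderiv j (Ψ t) x)) ∂torusVol := by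
      have j1 : ∀ i, Integrable (fun x => deriv (fun τ => Ψ τ x) t * (w i x * w i x)) torusVol :=
        fun i => integrable_of_continuous (by fun_prop)
      rw [← integral_finsetSum _ fun i _ => j1 i, ← integral_add]
      · congr 1; ext x
        have e : ∑ i, deriv (fun τ => Ψ τ x) t * (w i x * w i x) =
            deriv (fun τ => Ψ τ x) t * ∑ i, w i x * w i x := (Finset.mul_sum _ _ _).symm
        simp only [hdw]
        rw [e]
        rfl
      · exact integrable_finsetSum _ fun i _ => j1 i
      · have cM : ∀ i j, Continuous (M i j) := fun i j => continuous_trigPoly _ _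
        have cQ : Continuous Q := continuous_trigPoly _ _
        have cdΨ := fun j => ((hΨ.tsmooth t).tderiv j).continuous
        have cdw := fun i j => ((tsmooth_trigPoly S fun k => χ k * y i k t).tderiv j).continuous
        exact integrable_of_continuous (by fun_prop)
    rw [hflux, ← hnl, hEt, hVt]
    simp only [hsplit, mul_add, Finset.sum_add_distrib]
    rw [Finset.mul_sum]
    have : ∑ i, 2 * (-(ν : ℂ) * ∫ x, Ψ t x * (V i x * w i x) ∂torusVol) =
        -∑ i, 2 * (ν : ℂ) * ∫ x, Ψ t x * (V i x * w i x) ∂torusVol := by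
      rw [← Finset.sum_neg_distrib]; exact Finset.sum_congr rfl fun i _ => by ring
    rw [this]
    ring
  rw [integral_congr_ae key, integral_sub hint.integral_prod_left hEint, hE0, sub_zero,
    integral_prod _ hint]

end

/-! ### Passage to the limit in the nonlinear terms -/

lemma ae_fst_mem (T : ℝ) : ∀ᵐ p ∂spaceTime T, p.1 ∈ Ioo 0 T :=
  Measure.quasiMeasurePreserving_fst.ae (ae_restrict_mem measurableSet_Ioo)

lemma SmoothST.memLp_top {F : Type*} [NormedAddCommGroup F] [NormedSpace ℝ F]
    [SecondCountableTopology F] {Ψ : ℝ → T3 → F} (h : SmoothST Ψ) (T : ℝ) :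
    MemLp (fun p : ℝ × T3 => Ψ p.1 p.2) ⊤ (spaceTime T) := by
  obtain ⟨C, hC⟩ := h.exists_bound 0 T
  refine memLp_top_of_bound h.continuous.aestronglyMeasurable C ?_
  filter_upwards [ae_fst_mem T] with p hp
  exact hC p.1 (Ioo_subset_Icc_self hp) p.2

lemma tendsto_scale_rpow {r : ℝ} (hr : 0 < r) :
    Tendsto (fun n => ENNReal.ofReal (scale n ^ r)) atTop (𝓝 0) := by
  have h : Tendsto (fun n => scale n ^ r) atTop (𝓝 (0 ^ r)) :=
    tendsto_scale.rpow_const (Or.inr hr.le)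
  rw [Real.zero_rpow hr.ne'] at h
  simpa using ENNReal.tendsto_ofReal h

lemma tendsto_const_mul_scale_rpow {r : ℝ} (hr : 0 < r) {D : ℝ≥0∞} (hD : D ≠ ⊤) :
    Tendsto (fun n => D * ENNReal.ofReal (scale n ^ r)) atTop (𝓝 0) := by
  simpa using ENNReal.Tendsto.const_mul (tendsto_scale_rpow hr) (Or.inr hD)

/-- The limit of the truncated flux. -/
def limFlux (u : ℝ → T3 → E3) (P : ℝ → T3 → ℝ) (Ψ : ℝ → T3 → ℂ) (p : ℝ × T3) : ℂ :=
  deriv (fun τ => Ψ τ p.2) p.1 * (∑ i, comp u i p * comp u i p)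
    + ((∑ j, comp u j p * tderiv j (Ψ p.1) p.2) * (∑ i, comp u i p * comp u i p)
      + 2 * ((pres P p - fct (pres P) 0 p.1) * ∑ j, comp u j p * tderiv j (Ψ p.1) p.2))

section

variable {ν s T β : ℝ} {u₀ : T3 → E3} {u : ℝ → T3 → E3} {P : ℝ → T3 → ℝ} {C : ℝ≥0}

lemma tendstoLp_stLow (hβ : 0 < β) {F : ℝ × T3 → ℂ} (hF : MemLp F 3 (spaceTime T))
    (hC : HasModulus (spaceTime T) stShift 3 β C F) :
    TendstoLp (spaceTime T) 3 (fun n => stLow (scale n) F) F := by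
  obtain ⟨A, hA⟩ := exists_eLpNorm_stLow_sub_le hβ.le
  have hD : (A * C : ℝ≥0∞) ≠ ⊤ := by finiteness
  exact TendstoLp.of_le hF (fun n => aestronglyMeasurable_stTrig _ _ hF.1)
    (fun n => by finiteness) (tendsto_const_mul_scale_rpow hβ hD) fun n => hA _ (scale_pos n) hF hC

lemma tendstoLp_commutator (hβ : 0 < β) {F G : ℝ × T3 → ℂ} (hF : MemLp F 3 (spaceTime T))
    (hG : MemLp G 3 (spaceTime T)) (hFC : HasModulus (spaceTime T) stShift 3 β C F)
    (hGC : HasModulus (spaceTime T) stShift 3 β C G) :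
    TendstoLp (spaceTime T) (3 / 2) (fun n p => stLow (scale n) (fun p => F p * G p) p -
      stLow (scale n) F p * stLow (scale n) G p) fun _ => 0 := by
  obtain ⟨A, hA⟩ := exists_eLpNorm_commutator_le hβ.le
  have hD : (A * C ^ 2 : ℝ≥0∞) ≠ ⊤ := by finiteness
  refine TendstoLp.of_le MemLp.zero (fun n => ?_)
    (fun n => by finiteness) (tendsto_const_mul_scale_rpow (add_pos hβ hβ) hD) fun n => ?_
  · exact (aestronglyMeasurable_stTrig _ _ (hF.1.mul hG.1)).sub
      ((aestronglyMeasurable_stTrig _ _ hF.1).mul (aestronglyMeasurable_stTrig _ _ hG.1))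
  · simpa only [sub_zero] using hA _ (scale_pos n) hF hG hFC hGC

/-- The only place where `β > 1/3` is used. -/
lemma tendstoLp_commutator_mul_stLowD (hβ : 1 / 3 < β) (j : Fin 3) {F G : ℝ × T3 → ℂ}
    (hF : MemLp F 3 (spaceTime T))
    (hG : MemLp G 3 (spaceTime T)) (hFC : HasModulus (spaceTime T) stShift 3 β C F)
    (hGC : HasModulus (spaceTime T) stShift 3 β C G) :
    TendstoLp (spaceTime T) 1 (fun n p => (stLow (scale n) (fun p => F p * G p) p -
      stLow (scale n) F p * stLow (scale n) G p) * stLowD j (scale n) G p) fun _ => 0 := by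
  have hβ0 : 0 < β := by linarith
  obtain ⟨A, hA⟩ := exists_eLpNorm_commutator_le hβ0.le
  obtain ⟨B, hB⟩ := exists_eLpNorm_stLowD_le hβ0.le j
  have hD : (A * C ^ 2 * (B * C) : ℝ≥0∞) ≠ ⊤ := by finiteness
  have hm1 : ∀ n, AEStronglyMeasurable (fun p => stLow (scale n) (fun p => F p * G p) p -
      stLow (scale n) F p * stLow (scale n) G p) (spaceTime T) := fun n =>
    (aestronglyMeasurable_stTrig _ _ (hF.1.mul hG.1)).sub
      ((aestronglyMeasurable_stTrig _ _ hF.1).mul (aestronglyMeasurable_stTrig _ _ hG.1))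
  have hm2 : ∀ n, AEStronglyMeasurable (stLowD j (scale n) G) (spaceTime T) := fun n =>
    aestronglyMeasurable_stTrig _ _ hG.1
  -- The commutator contributes the exponent 2β and the gradient β - 1, so the product is of order
  -- c^(3β-1).
  refine TendstoLp.of_le MemLp.zero (fun n => (hm1 n).mul (hm2 n)) (fun n => by finiteness)
    (tendsto_const_mul_scale_rpow (show 0 < β + β + (β - 1) by linarith) hD) fun n => ?_
  simp only [sub_zero]
  refine (eLpNorm_smul_le_mul_eLpNorm (p := 3 / 2) (q := 3) (r := 1) (hm2 n) (hm1 n)).trans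
    ((mul_le_mul' (hA _ (scale_pos n) hF hG hFC hGC) (hB _ (scale_pos n) hG hGC)).trans
      (le_of_eq ?_))
  rw [Real.rpow_add (scale_pos n) (β + β), ENNReal.ofReal_mul (by have := scale_pos n; positivity)]
  ring

lemma IsLerayHopf.tendstoLp_stLow_pres (hu : IsLerayHopf ν s T u₀ u P) (hs : 0 ≤ s) {T' : ℝ}
    (hT' : T' < T) (hu3 : ∀ i, MemLp (comp u i) 3 (spaceTime T)) (hβ : 0 < β)
    (hC : ∀ i, HasModulus (spaceTime T) stShift 3 β C (comp u i)) :
    TendstoLp (spaceTime T') (3 / 2) (fun n p => stLow (scale n) (pres P) p - fct (pres P) 0 p.1)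
      fun p => pres P p - fct (pres P) 0 p.1 := by
  obtain ⟨h1, h2, h3⟩ := hu.memLp_pres_and_tendsto hs hT' hu3 hβ hC
  have hP := hu.integrable_pres hT'
  refine TendstoLp.of_le h1 (fun n => (aestronglyMeasurable_stTrig _ _ hP.1).sub
    (aestronglyMeasurable_fct hP.1 0).comp_fst) (fun n => (h3 n).ne) h2 fun n => le_of_eq ?_
  have e : (fun p => stLow (scale n) (pres P) p - fct (pres P) 0 p.1 -
      (pres P p - fct (pres P) 0 p.1)) =ᵐ[spaceTime T']
      -fun p => pres P p - stConv chiK (scale n) (pres P) p := by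
    filter_upwards [stConv_ae_eq_stLow (scale_pos n) hP] with p hp
    rw [Pi.neg_apply, hp]; ring
  rw [eLpNorm_congr_ae e, eLpNorm_neg]

/-- Hölder term by term: truncations converge in L³, their squares and the centred pressure in
L^(3/2), cubic and pressure terms in L¹. The commutator terms tend to zero. -/
lemma IsLerayHopf.tendstoLp_truncFlux (hu : IsLerayHopf ν s T u₀ u P) (hs : 0 ≤ s) {T' : ℝ}
    (hT' : T' < T) (hu3 : ∀ i, MemLp (comp u i) 3 (spaceTime T)) (hβ : 1 / 3 < β)
    (hC : ∀ i, HasModulus (spaceTime T) stShift 3 β C (comp u i)) {Ψ : ℝ → T3 → ℂ}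
    (hΨ : SmoothST Ψ) :
    TendstoLp (spaceTime T') 1 (fun n => truncFlux u P Ψ (scale n)) (limFlux u P Ψ) := by
  have hβ0 : 0 < β := by linarith
  have hu3' : ∀ i, MemLp (comp u i) 3 (spaceTime T') := fun i =>
    (hu3 i).mono_measure (spaceTime_mono hT'.le)
  have hC' := fun i => (hC i).mono hT'.le
  have hw := fun i => tendstoLp_stLow hβ0 (hu3' i) (hC' i)
  have hΨ0 := hΨ.memLp_top T'
  have hΨt := hΨ.dt.memLp_top T'
  have hΨj := fun j => (hΨ.tderiv j).memLp_top T'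
  have hq := TendstoLp.sum one_le_three_halves (s := Finset.univ) fun i _ =>
    (hw i).mul (r := 3 / 2) one_le_three_halves (hw i)
  have h1 := TendstoLp.const_fun_mul one_le_three_halves hq hΨt
  have hg := TendstoLp.sum (by norm_num : (1 : ℝ≥0∞) ≤ 3) (s := Finset.univ) fun j _ =>
    (hw j).mul (r := 3) (by norm_num) (TendstoLp.const (hΨj j))
  have h2 := hg.mul (r := 1) le_rfl hq
  have h4 := ((hu.tendstoLp_stLow_pres hs hT' hu3 hβ0 hC).mul (r := 1) le_rfl hg)
  have h2c : MemLp (fun _ : ℝ × T3 => (2 : ℂ)) ⊤ (spaceTime T') := memLp_top_const 2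
  have h3 := TendstoLp.sum le_rfl (s := Finset.univ) fun i _ =>
    TendstoLp.sum le_rfl (s := Finset.univ) fun j _ =>
      TendstoLp.const_fun_mul le_rfl (TendstoLp.add le_rfl
        ((tendstoLp_commutator hβ0 (hu3' j) (hu3' i) (hC' j) (hC' i)).mul (r := 1) le_rfl
          (TendstoLp.const_fun_mul (by norm_num) (hw i) (hΨj j)))
        (TendstoLp.const_fun_mul le_rfl
          (tendstoLp_commutator_mul_stLowD hβ j (hu3' j) (hu3' i) (hC' j) (hC' i)) hΨ0)) h2c
  have h3' : TendstoLp (spaceTime T') 1 (fun n p =>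
      ∑ i, ∑ j, 2 * ((stLow (scale n) (fun p => comp u j p * comp u i p) p
        - stLow (scale n) (comp u j) p * stLow (scale n) (comp u i) p) *
          (tderiv j (Ψ p.1) p.2 * stLow (scale n) (comp u i) p
            + Ψ p.1 p.2 * stLowD j (scale n) (comp u i) p))) _ :=
    h3.congr fun n => ae_of_all _ fun p => Finset.sum_congr rfl fun i _ =>
      Finset.sum_congr rfl fun j _ => by ring
  -- The term with the time derivative is only quadratic and converges in L^(3/2); finite measure
  -- brings it down to L¹.
  have h1' : TendstoLp (spaceTime T') 1 _ _ :=
    ⟨fun n => (h1.mem n).mono_exponent one_le_three_halves,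
      h1.lim_mem.mono_exponent one_le_three_halves, ?_⟩
  · have := h1'.add le_rfl ((h2.add le_rfl h3').add le_rfl (TendstoLp.const_fun_mul le_rfl h4 h2c))
    convert this using 1
    · rfl
    · funext p
      simp [limFlux]
  · have hm := fun n => ((h1.mem n).sub h1.lim_mem).1
    have hfin : (spaceTime T') univ ^ (1 / (1 : ℝ≥0∞).toReal - 1 / (3 / 2 : ℝ≥0∞).toReal) ≠ ⊤ := by
      refine ENNReal.rpow_ne_top_of_nonneg ?_ (measure_ne_top _ _)
      simp [ENNReal.toReal_div]
      norm_num
    refine tendsto_of_tendsto_of_tendsto_of_le_of_le tendsto_const_nhds ?_ (fun _ => zero_le)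
      fun n => eLpNorm_le_eLpNorm_mul_rpow_measure_univ one_le_three_halves (hm n)
    simpa using ENNReal.Tendsto.mul_const h1.tendsto (Or.inr hfin)

end

/-! ### Passage to the limit in the viscous term -/

section Pairs

variable {A X : (Fin 3 → ℤ) → ℝ}

/-- The shear (k, l) ↦ (k, k + l) decouples the two indices. -/
lemma hasSum_pairs (hA : Summable A) (hA0 : ∀ k, 0 ≤ A k) (hX : Summable fun k => X k ^ 2) :
    HasSum (fun q : (Fin 3 → ℤ) × (Fin 3 → ℤ) => A (q.1 + q.2) * X q.1 ^ 2)
      ((∑' k, A k) * ∑' k, X k ^ 2) := by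
  have h1 : Summable fun q : (Fin 3 → ℤ) × (Fin 3 → ℤ) => X q.1 ^ 2 * A q.2 :=
    hX.mul_of_nonneg hA (fun _ => sq_nonneg _) hA0
  have h2 : HasSum (fun q : (Fin 3 → ℤ) × (Fin 3 → ℤ) => X q.1 ^ 2 * A q.2)
      ((∑' k, X k ^ 2) * ∑' k, A k) := hX.hasSum.mul hA.hasSum h1
  have h3 := (Equiv.hasSum_iff (Equiv.prodShear (Equiv.refl (Fin 3 → ℤ)) fun k => Equiv.addLeft k)).2 h2
  rw [mul_comm (∑' k, A k)]
  refine h3.congr_fun fun q => ?_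
  simp [mul_comm]

lemma hasSum_pairs' (hA : Summable A) (hA0 : ∀ k, 0 ≤ A k) (hX : Summable fun k => X k ^ 2) :
    HasSum (fun q : (Fin 3 → ℤ) × (Fin 3 → ℤ) => A (q.1 + q.2) * X q.2 ^ 2)
      ((∑' k, A k) * ∑' k, X k ^ 2) := by
  have := (Equiv.hasSum_iff (Equiv.prodComm _ _)).2 (hasSum_pairs hA hA0 hX)
  refine this.congr_fun fun q => ?_
  simp [add_comm]

lemma hasSum_pairs_bound (hA : Summable A) (hA0 : ∀ k, 0 ≤ A k) (hX : Summable fun k => X k ^ 2) :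
    HasSum (fun q : (Fin 3 → ℤ) × (Fin 3 → ℤ) => A (q.1 + q.2) * ((X q.1 ^ 2 + X q.2 ^ 2) / 2))
      ((∑' k, A k) * ∑' k, X k ^ 2) := by
  have := ((hasSum_pairs hA hA0 hX).add (hasSum_pairs' hA hA0 hX)).div_const 2
  rw [add_self_div_two] at this
  refine this.congr_fun fun q => ?_
  ring

end Pairs

/-- The terms of the double series for `∫ A^{s/2} f · A^{s/2} (Ψ f)`. -/
def viscTerm (s : ℝ) (f Ψ : T3 → ℂ) (q : (Fin 3 → ℤ) × (Fin 3 → ℤ)) : ℂ :=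
  ((wt (s / 2) q.1 ^ 2 : ℝ) : ℂ) * fc f q.1 * fc f q.2 * fc Ψ (-q.1 - q.2)

section Visc

variable {s : ℝ} {f Ψ : T3 → ℂ} {A : (Fin 3 → ℤ) → ℝ}

/-- One of the two weights at k stays on f. Peetre's inequality for -k = (-k - l) + l moves the
other to the test function and to the second copy of f; then xz ≤ (x² + z²)/2. Only s derivatives of
f are used in each factor. -/
lemma norm_viscTerm_le (hs : 0 ≤ s) (hA' : ∀ k, A (-k) = A k)
    (hΨA : ∀ k, jap s k * ‖fc Ψ k‖ ≤ A k) (q : (Fin 3 → ℤ) × (Fin 3 → ℤ)) :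
    ‖viscTerm s f Ψ q‖ ≤ 2 ^ (s / 2) * (A (q.1 + q.2) *
      (((jap s q.1 * ‖fc f q.1‖) ^ 2 + (jap s q.2 * ‖fc f q.2‖) ^ 2) / 2)) := by
  obtain ⟨k, l⟩ := q
  have hj := jap_pos s
  have h1 : wt (s / 2) k ^ 2 ≤ jap s k * (2 ^ (s / 2) * jap s (-k - l) * jap s l) := by
    have e : jap s (-k) ≤ 2 ^ (s / 2) * jap s (-k - l) * jap s l := by
      have := jap_add_le hs (-k - l) l
      rwa [sub_add_cancel] at this
    rw [jap_neg] at e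
    rw [pow_two]
    exact mul_le_mul (wt_le_jap hs k) ((wt_le_jap hs k).trans e) (wt_nonneg _ _) (hj k).le
  have hA := hΨA (-k - l)
  rw [show -k - l = -(k + l) by abel, hA', ← show -k - l = -(k + l) by abel] at hA
  have hA0 : 0 ≤ A (k + l) := (mul_nonneg (hj _).le (norm_nonneg _)).trans hA
  set x := jap s k * ‖fc f k‖
  set z := jap s l * ‖fc f l‖
  have hx : 0 ≤ x := mul_nonneg (hj _).le (norm_nonneg _)
  have hz : 0 ≤ z := mul_nonneg (hj _).le (norm_nonneg _)
  have h2 : ‖viscTerm s f Ψ (k, l)‖ ≤ 2 ^ (s / 2) * (A (k + l) * (x * z)) := by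
    rw [viscTerm, norm_mul, norm_mul, norm_mul, Complex.norm_real,
      Real.norm_of_nonneg (sq_nonneg _)]
    calc _ ≤ (jap s k * (2 ^ (s / 2) * jap s (-k - l) * jap s l)) * ‖fc f k‖ * ‖fc f l‖ *
          ‖fc Ψ (-k - l)‖ := by gcongr
      _ = 2 ^ (s / 2) * ((jap s (-k - l) * ‖fc Ψ (-k - l)‖) * (x * z)) := by simp only [x, z]; ring
      _ ≤ _ := by gcongr
  refine h2.trans ?_
  have : x * z ≤ (x ^ 2 + z ^ 2) / 2 := by nlinarith [sq_nonneg (x - z)]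
  gcongr

lemma summable_sq_of_tsum_ne_top {X : (Fin 3 → ℤ) → ℝ} (hX : ∀ k, 0 ≤ X k)
    (h : ∑' k, ENNReal.ofReal (X k) ^ 2 ≠ ⊤) : Summable fun k => X k ^ 2 := by
  refine (ENNReal.summable_toReal h).congr fun k => ?_
  rw [ENNReal.toReal_pow, ENNReal.toReal_ofReal (hX k)]

lemma tsum_sq_eq_toReal {X : (Fin 3 → ℤ) → ℝ} (hX : ∀ k, 0 ≤ X k) :
    ∑' k, X k ^ 2 = (∑' k, ENNReal.ofReal (X k) ^ 2).toReal := by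
  rw [ENNReal.tsum_toReal_eq fun k => by finiteness]
  refine tsum_congr fun k => ?_
  rw [ENNReal.toReal_pow, ENNReal.toReal_ofReal (hX k)]

lemma jap_mul_nonneg (s : ℝ) (f : T3 → ℂ) (k : Fin 3 → ℤ) : 0 ≤ jap s k * ‖fc f k‖ :=
  mul_nonneg (jap_pos _ _).le (norm_nonneg _)

lemma summable_viscTerm (hs : 0 ≤ s) (hA : Summable A) (hA' : ∀ k, A (-k) = A k)
    (hΨA : ∀ k, jap s k * ‖fc Ψ k‖ ≤ A k)
    (hf : ∑' k, ENNReal.ofReal (jap s k * ‖fc f k‖) ^ 2 ≠ ⊤) : Summable (viscTerm s f Ψ) :=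
  .of_norm_bounded ((hasSum_pairs_bound hA (fun k => (jap_mul_nonneg s Ψ k).trans (hΨA k))
    (summable_sq_of_tsum_ne_top (jap_mul_nonneg s f) hf)).summable.mul_left _)
    (norm_viscTerm_le hs hA' hΨA)

/-- The truncated double series. -/
def truncSum (s : ℝ) (f Ψ : T3 → ℂ) (c : ℝ) : ℂ :=
  ∑' q : (Fin 3 → ℤ) × (Fin 3 → ℤ), chi (c • freq q.1) * chi (c • freq q.2) * viscTerm s f Ψ q

lemma norm_chi_mul_viscTerm_le (c : ℝ) (q : (Fin 3 → ℤ) × (Fin 3 → ℤ)) :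
    ‖chi (c • freq q.1) * chi (c • freq q.2) * viscTerm s f Ψ q‖ ≤ ‖viscTerm s f Ψ q‖ := by
  rw [norm_mul, norm_mul]
  refine mul_le_of_le_one_left (norm_nonneg _) ?_
  exact mul_le_one₀ (norm_chi_le _) (norm_nonneg _) (norm_chi_le _)

/-- The bound does not depend on c, so it dominates all truncations at once when the limit is taken
under the time integral. -/
lemma norm_truncSum_le (hs : 0 ≤ s) (hA : Summable A) (hA' : ∀ k, A (-k) = A k)
    (hΨA : ∀ k, jap s k * ‖fc Ψ k‖ ≤ A k)
    (hf : ∑' k, ENNReal.ofReal (jap s k * ‖fc f k‖) ^ 2 ≠ ⊤) (c : ℝ) :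
    ‖truncSum s f Ψ c‖ ≤ 2 ^ (s / 2) * ((∑' k, A k) *
      (∑' k, ENNReal.ofReal (jap s k * ‖fc f k‖) ^ 2).toReal) := by
  rw [← tsum_sq_eq_toReal (jap_mul_nonneg s f)]
  exact tsum_of_norm_bounded ((hasSum_pairs_bound hA (fun k => (jap_mul_nonneg s Ψ k).trans (hΨA k))
    (summable_sq_of_tsum_ne_top (jap_mul_nonneg s f) hf)).mul_left _)
    fun q => (norm_chi_mul_viscTerm_le c q).trans (norm_viscTerm_le hs hA' hΨA q)

lemma tendsto_truncSum (hs : 0 ≤ s) (hA : Summable A) (hA' : ∀ k, A (-k) = A k)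
    (hΨA : ∀ k, jap s k * ‖fc Ψ k‖ ≤ A k)
    (hf : ∑' k, ENNReal.ofReal (jap s k * ‖fc f k‖) ^ 2 ≠ ⊤) :
    Tendsto (fun n => truncSum s f Ψ (scale n)) atTop (𝓝 (∑' q, viscTerm s f Ψ q)) := by
  refine tendsto_tsum_of_dominated_convergence (summable_viscTerm hs hA hA' hΨA hf).norm
    (fun q => ?_) (Eventually.of_forall fun n q => norm_chi_mul_viscTerm_le _ _)
  have hone : ∀ k : Fin 3 → ℤ, ∀ᶠ n in atTop, chi (scale n • freq k) = 1 := by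
    intro k
    have h1 : Tendsto (fun n => scale n • freq k) atTop (𝓝 0) := by
      simpa using tendsto_scale.smul_const (freq k)
    filter_upwards [h1 (Metric.closedBall_mem_nhds 0 one_pos)] with n hn
    refine chi_eq_one ?_
    simpa using hn
  refine tendsto_const_nhds.congr' ?_
  filter_upwards [hone q.1, hone q.2] with n h1 h2
  rw [h1, h2, one_mul, one_mul]

lemma truncSum_eq_sum {c : ℝ} (hc : 0 < c) : truncSum s f Ψ c =
    ∑ k ∈ modes (2 / c), ∑ l ∈ modes (2 / c),
    (chi (c • freq k) * ((wt (s / 2) k ^ 2 : ℝ) : ℂ) * fc f k) * (chi (c • freq l) * fc f l) *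
      ∫ x, Ψ x * (mFourier k x * mFourier l x) ∂torusVol := by
  have hz : ∀ k ∉ modes (2 / c), chi (c • freq k) = 0 := fun k hk =>
    chi_eq_zero (two_lt_of_notMem_modes hc hk).le
  rw [truncSum, tsum_eq_sum (s := modes (2 / c) ×ˢ modes (2 / c)), Finset.sum_product]
  · refine Finset.sum_congr rfl fun k _ => Finset.sum_congr rfl fun l _ => ?_
    have e : fc Ψ (-k - l) = ∫ x, Ψ x * (mFourier k x * mFourier l x) ∂torusVol := by
      unfold fc
      congr 1; ext x
      rw [show -(-k - l) = k + l by abel, UnitAddTorus.mFourier_add]; ring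
    simp only [viscTerm]
    rw [e]; ring
  · intro q hq
    rw [Finset.mem_product, not_and_or] at hq
    rcases hq with h | h
    · rw [hz _ h]; ring
    · rw [hz _ h]; ring

end Visc

lemma memℓp_fracCoeff_mul {s : ℝ} (hs : 0 ≤ s) {f φ : T3 → ℝ} (hφ : Continuous φ)
    (hf : Integrable f torusVol) {A : (Fin 3 → ℤ) → ℝ} (hA : Summable A)
    (hφA : ∀ k, jap s k * ‖coeff φ k‖ ≤ A k)
    (h : ∑' k, ENNReal.ofReal (jap s k * ‖coeff f k‖) ^ 2 ≠ ⊤) :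
    Memℓp (fracCoeff (s / 2) fun y => φ y * f y) 2 := by
  refine memℓp_fracCoeff_of_tsum hs ?_
  have := tsum_jap_mul_ne_top hs (ψ := fun x => (φ x : ℂ)) (f := fun x => (f x : ℂ))
    (Complex.continuous_ofReal.comp hφ) hf.ofReal hA hφA h
  simpa only [coeff_eq_fc, Complex.ofReal_mul] using this

/-- The viscous term as a double series. -/
lemma integral_fracLapL2_mul_eq_tsum {s : ℝ} (hs : 0 ≤ s) {f φ : T3 → ℝ} (hφ : Continuous φ)
    (hf : Integrable f torusVol) {A : (Fin 3 → ℤ) → ℝ} (hA : Summable A) (hA' : ∀ k, A (-k) = A k)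
    (hφA : ∀ k, jap s k * ‖coeff φ k‖ ≤ A k)
    (h : ∑' k, ENNReal.ofReal (jap s k * ‖coeff f k‖) ^ 2 ≠ ⊤) :
    ((∫ x, (fracLapL2 (s / 2) f x).re * (fracLapL2 (s / 2) (fun y => φ y * f y) x).re ∂torusVol
      : ℝ) : ℂ) = ∑' q, viscTerm s (fun x => (f x : ℂ)) (fun x => (φ x : ℂ)) q := by
  set F : T3 → ℂ := fun x => (f x : ℂ)
  set Ψ : T3 → ℂ := fun x => (φ x : ℂ)
  have hΨ : Continuous Ψ := Complex.continuous_ofReal.comp hφ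
  have hsum : Summable fun k => ‖fc Ψ k‖ := hA.of_nonneg_of_le (fun _ => norm_nonneg _) fun k =>
    (le_mul_of_one_le_left (norm_nonneg _) (one_le_jap hs k)).trans (hφA k)
  have hP := hasSum_fracLapL2_mul (memℓp_fracCoeff_of_tsum hs h)
    (memℓp_fracCoeff_mul hs hφ hf hA hφA h)
  -- Passing to -k turns the conjugated coefficient of the real function f into an unconjugated one,
  -- as in `viscTerm`; l ↦ -k - l below similarly aligns the convolution.
  have hP2 := (Equiv.hasSum_iff (Equiv.neg (Fin 3 → ℤ))).2 hP
  rw [(summable_viscTerm hs hA hA' hφA h).tsum_prod, ← hP2.tsum_eq]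
  refine tsum_congr fun k => ?_
  have hF : Integrable F torusVol := hf.ofReal
  have hm := hasSum_fc_mul hΨ hsum hF (-k)
  have hm2 := (Equiv.hasSum_iff (Equiv.subLeft (-k))).2 hm
  have e : coeff (fun y => φ y * f y) (-k) = fc (fun x => Ψ x * F x) (-k) := by
    rw [coeff_eq_fc]; simp only [Complex.ofReal_mul, Ψ, F]
  simp only [Function.comp_apply, Equiv.neg_apply]
  rw [fracCoeff_eq, fracCoeff_eq, wt_neg, coeff_neg, e, ← hm2.tsum_eq, map_mul,
    Complex.conj_ofReal, Complex.conj_conj, ← tsum_mul_left, ← tsum_mul_left]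
  refine tsum_congr fun l => ?_
  simp only [viscTerm, Function.comp_apply, Equiv.subLeft_apply, coeff_eq_fc]
  rw [show -k - (-k - l) = l by abel]
  push_cast
  ring

section

variable {ν s T : ℝ} {u₀ : T3 → E3} {u : ℝ → T3 → E3} {P : ℝ → T3 → ℝ}

/-- The limit of the viscous term. -/
lemma IsLerayHopf.visc_limit (hu : IsLerayHopf ν s T u₀ u P) (hs : 0 ≤ s) {T' : ℝ} (hT' : T' < T)
    {ψ : ℝ → T3 → ℝ} (hψ : SmoothST ψ) (hψc : SmoothST fun t x => (ψ t x : ℂ)) :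
    (∀ᵐ t ∂(volume : Measure ℝ).restrict (Ioo 0 T'), ∀ i,
      Memℓp (fracCoeff (s / 2) fun y => (ψ t y • u t y) i) 2) ∧
    IntegrableOn (fun t => ∫ x, viscIntegrand s u ψ t x ∂torusVol) (Ioo 0 T') ∧
    Tendsto (fun n => ∫ t in Ioo 0 T', 2 * (ν : ℂ) *
        truncVisc s u (fun t x => (ψ t x : ℂ)) (scale n) t) atTop
      (𝓝 (2 * (ν : ℂ) * ((∫ t in Ioo 0 T', ∫ x, viscIntegrand s u ψ t x ∂torusVol : ℝ) : ℂ))) := by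
  set Ψ : ℝ → T3 → ℂ := fun t x => (ψ t x : ℂ)
  obtain ⟨A, hA0, hA, hA', hΨA⟩ := hψc.exists_summable_bound 0 T' s
  have hsub : Ioo 0 T' ⊆ Ioo 0 T := Ioo_subset_Ioo_right hT'.le
  have hm := ae_restrict_of_ae_restrict_of_subset hsub hu.ae_memLp
  have hsob := ae_restrict_of_ae_restrict_of_subset hsub hu.ae_sobolevSq_lt_top
  have hmem := ae_restrict_mem (μ := (volume : Measure ℝ)) (measurableSet_Ioo (a := (0 : ℝ)) (b := T'))
  have hX : ∀ i t, sobolevSq s (fun x => u t x i) =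
      ∑' k, ENNReal.ofReal (jap s k * ‖fc (fun x => comp u i (t, x)) k‖) ^ 2 := fun i t =>
    sobolevSq_eq s _
  -- Dominating function in time, integrable because u ∈ L²(H^s).
  set N : ℝ → ℝ := fun t => ∑ i, 2 ^ (s / 2) * ((∑' k, A k) *
    (sobolevSq s (fun x => u t x i)).toReal) with hN
  have hNi : IntegrableOn N (Ioo 0 T') := by
    refine integrable_finsetSum _ fun i _ => Integrable.const_mul (Integrable.const_mul ?_ _) _
    refine IntegrableOn.mono_set ?_ hsub
    exact integrable_toReal_of_lintegral_ne_top (hu.aemeasurable_sobolevSq i) (hu.sobolev i).ne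
  have hV : ∀ t n, truncVisc s u Ψ (scale n) t =
      ∑ i, truncSum s (fun x => comp u i (t, x)) (Ψ t) (scale n) := fun t n =>
    Finset.sum_congr rfl fun i _ => (truncSum_eq_sum (scale_pos n)).symm
  have hVm : ∀ n, AEStronglyMeasurable (truncVisc s u Ψ (scale n))
      ((volume : Measure ℝ).restrict (Ioo 0 T')) := by
    intro n
    have hy := fun i k => (aestronglyMeasurable_fct (aestronglyMeasurable_comp hu.meas i)
      k).mono_measure (Measure.restrict_mono hsub le_rfl)
    have hθ : ∀ k l : Fin 3 → ℤ, Continuous fun t =>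
        ∫ x, Ψ t x * (mFourier k x * mFourier l x) ∂torusVol := fun k l =>
      hψc.continuous_integral_mul (by fun_prop)
    refine Finset.aestronglyMeasurable_fun_sum _ fun i _ =>
      Finset.aestronglyMeasurable_fun_sum _ fun k _ =>
      Finset.aestronglyMeasurable_fun_sum _ fun l _ => ?_
    exact (((hy i k).const_mul _).mul ((hy i l).const_mul _)).mul (hθ k l).aestronglyMeasurable
  have hVle : ∀ n, ∀ᵐ t ∂(volume : Measure ℝ).restrict (Ioo 0 T'),
      ‖truncVisc s u Ψ (scale n) t‖ ≤ N t := by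
    intro n
    filter_upwards [hsob, hmem] with t h1 h2
    rw [hV]
    refine norm_sum_le_of_le _ fun i _ => ?_
    have h3 := (h1 i).ne
    rw [hX] at h3 ⊢
    exact norm_truncSum_le hs hA hA' (hΨA t (Ioo_subset_Icc_self h2)) h3 _
  have hmemlp : ∀ᵐ t ∂(volume : Measure ℝ).restrict (Ioo 0 T'), ∀ i,
      Memℓp (fracCoeff (s / 2) fun y => (ψ t y • u t y) i) 2 := by
    filter_upwards [hsob, hmem, hm] with t h1 h2 h3 i
    have h4 := (h1 i).ne
    rw [hX] at h4
    exact memℓp_fracCoeff_mul hs (hψ.tsmooth t).continuous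
      ((memLp_coord h3 i).integrable one_le_two) hA (hΨA t (Ioo_subset_Icc_self h2)) h4
  have hVt : ∀ᵐ t ∂(volume : Measure ℝ).restrict (Ioo 0 T'),
      Tendsto (fun n => truncVisc s u Ψ (scale n) t) atTop
        (𝓝 ((∫ x, viscIntegrand s u ψ t x ∂torusVol : ℝ) : ℂ)) := by
    filter_upwards [hsob, hmem, hm] with t h1 h2 h3
    have e : ((∫ x, viscIntegrand s u ψ t x ∂torusVol : ℝ) : ℂ) =
        ∑ i, ∑' q, viscTerm s (fun x => comp u i (t, x)) (Ψ t) q := by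
      have e1 : ∀ x, viscIntegrand s u ψ t x = ∑ i, (fracLapL2 (s / 2) (fun y => u t y i) x).re *
          (fracLapL2 (s / 2) (fun y => ψ t y * u t y i) x).re := by
        intro x
        simp only [viscIntegrand, PiLp.inner_apply, fracLap]
        exact Finset.sum_congr rfl fun i _ => mul_comm _ _
      simp only [e1]
      rw [integral_finsetSum _ fun i _ => integrable_fracLapL2_mul _ _ _, Complex.ofReal_sum]
      refine Finset.sum_congr rfl fun i _ => ?_
      have h4 := (h1 i).ne
      rw [hX] at h4
      exact integral_fracLapL2_mul_eq_tsum hs (hψ.tsmooth t).continuous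
        ((memLp_coord h3 i).integrable one_le_two) hA hA' (hΨA t (Ioo_subset_Icc_self h2)) h4
    rw [e]
    simp only [hV]
    refine tendsto_finsetSum _ fun i _ => ?_
    have h4 := (h1 i).ne
    rw [hX] at h4
    exact tendsto_truncSum hs hA hA' (hΨA t (Ioo_subset_Icc_self h2)) h4
  have hlim : IntegrableOn (fun t => ((∫ x, viscIntegrand s u ψ t x ∂torusVol : ℝ) : ℂ))
      (Ioo 0 T') := by
    -- Measurability in time of the viscous pairing is not evident from its definition slice by
    -- slice; it is inherited from the truncations.
    refine hNi.mono' (aestronglyMeasurable_of_tendsto_ae atTop hVm hVt) ?_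
    filter_upwards [hVt, ae_all_iff.2 hVle] with t h1 h2
    exact le_of_tendsto h1.norm (Eventually.of_forall h2)
  refine ⟨hmemlp, ?_, ?_⟩
  · have h : Integrable (fun t => ∫ x, viscIntegrand s u ψ t x ∂torusVol)
        (volume.restrict (Ioo 0 T')) := by simpa using hlim.re
    exact h
  · have h := tendsto_integral_of_dominated_convergence N hVm hNi hVle hVt
    rw [integral_complex_ofReal] at h
    simpa only [integral_const_mul] using h.const_mul (2 * (ν : ℂ))

end

/-! ### Assembling the local energy equality -/

lemma integral_viscIntegrand_of_eq_zero (s : ℝ) (u : ℝ → T3 → E3) {ψ : ℝ → T3 → ℝ} {t : ℝ}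
    (h : ∀ x, ψ t x = 0) : ∫ x, viscIntegrand s u ψ t x ∂torusVol = 0 := by
  have e : ∀ x, fracLap (s / 2) (fun y => ψ t y • u t y) x = 0 := fun x => by
    ext j
    simp [fracLap, h, fracLapL2_zero]
  simp [viscIntegrand, e]

lemma integrable_viscIntegrand (s : ℝ) (u : ℝ → T3 → E3) (ψ : ℝ → T3 → ℝ) (t : ℝ) :
    Integrable (viscIntegrand s u ψ t) torusVol := by
  have e : viscIntegrand s u ψ t = fun x => ∑ i, (fracLapL2 (s / 2) (fun y => u t y i) x).re *
      (fracLapL2 (s / 2) (fun y => (ψ t y • u t y) i) x).re := by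
    ext x
    simp only [viscIntegrand, PiLp.inner_apply, fracLap]
    exact Finset.sum_congr rfl fun i _ => mul_comm _ _
  rw [e]
  exact integrable_finsetSum _ fun i _ => integrable_fracLapL2_mul _ _ _

lemma SmoothST.ofReal {ψ : ℝ → T3 → ℝ} (h : SmoothST ψ) : SmoothST fun t x => (ψ t x : ℂ) :=
  Complex.ofRealCLM.contDiff.comp h

lemma TSmooth.tderiv_ofReal {f : T3 → ℝ} (hf : TSmooth f) (i : Fin 3) (x : T3) :
    FracNS.tderiv i (fun x => (f x : ℂ)) x = (pderiv i f x : ℂ) :=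
  hf.tderiv_clm Complex.ofRealCLM i x

/-- The limit flux was formed with the centred pressure; the true flux differs from it exactly by
the contribution of the mean of the pressure. -/
lemma fluxIntegrand_eq (u : ℝ → T3 → E3) (P : ℝ → T3 → ℝ) {ψ : ℝ → T3 → ℝ} (hψ : SmoothST ψ)
    (p : ℝ × T3) :
    (fluxIntegrand u P ψ p.1 p.2 : ℂ) = limFlux u P (fun t x => (ψ t x : ℂ)) p +
      2 * (fct (pres P) 0 p.1 * ∑ j, comp u j p * tderiv j (fun x => (ψ p.1 x : ℂ)) p.2) := by
  have e1 : deriv (fun τ => (ψ τ p.2 : ℂ)) p.1 = (deriv (fun τ => ψ τ p.2) p.1 : ℝ) :=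
    (hψ.hasDerivAt p.1 p.2).ofReal_comp.deriv
  have e2 : ((inner ℝ (u p.1 p.2) (grad (ψ p.1) p.2) : ℝ) : ℂ) =
      ∑ j, comp u j p * tderiv j (fun x => (ψ p.1 x : ℂ)) p.2 := by
    rw [PiLp.inner_apply, Complex.ofReal_sum]
    refine Finset.sum_congr rfl fun j _ => ?_
    rw [(hψ.tsmooth p.1).tderiv_ofReal]
    simp [grad, comp, mul_comm]
  have e3 : ((‖u p.1 p.2‖ ^ 2 : ℝ) : ℂ) = ∑ i, comp u i p * comp u i p := by
    rw [EuclideanSpace.real_norm_sq_eq, Complex.ofReal_sum]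
    exact Finset.sum_congr rfl fun i _ => by simp [comp, sq]
  rw [limFlux, ← e2, ← e3, e1, fluxIntegrand, pres]
  push_cast
  ring

/-- A square integrable field whose divergence vanishes is orthogonal to gradients. -/
lemma integral_sum_mul_tderiv_eq_zero {v : T3 → E3} (hv : MemLp v 2 torusVol)
    (hdiv : ∀ k, ∑ i, dsym i k * fc (fun x => (v x i : ℂ)) k = 0) {ψ : T3 → ℝ}
    (hψ : TSmooth ψ) :
    ∫ x, ∑ j, (v x j : ℂ) * tderiv j (fun x => (ψ x : ℂ)) x ∂torusVol = 0 := by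
  have hi : ∀ j, MemLp (fun x => v x j) 2 torusVol := fun j => memLp_coord hv j
  have hp : ∀ j, MemLp (pderiv j ψ) 2 torusVol := fun j => (hψ.tderiv j).memLp 2
  have hψc : TSmooth fun x => (ψ x : ℂ) := hψ.clm Complex.ofRealCLM
  have h1 : ∀ j, HasSum (fun k => conj (coeff (pderiv j ψ) k) * coeff (fun x => v x j) k)
      ((∫ x, pderiv j ψ x * v x j ∂torusVol : ℝ) : ℂ) := fun j => hasSum_coeff_mul (hp j) (hi j)
  have h2 := hasSum_sum fun j (_ : j ∈ Finset.univ) => h1 j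
  have e : ∀ k, ∑ j, conj (coeff (pderiv j ψ) k) * coeff (fun x => v x j) k = 0 := by
    intro k
    have e1 : ∀ j, conj (coeff (pderiv j ψ) k) * coeff (fun x => v x j) k =
        -conj (fc (fun x => (ψ x : ℂ)) k) * (dsym j k * fc (fun x => (v x j : ℂ)) k) := by
      intro j
      have e2 : coeff (pderiv j ψ) k = dsym j k * fc (fun x => (ψ x : ℂ)) k := by
        rw [coeff_eq_fc, ← fc_tderiv hψc]
        congr 1; ext x
        exact (hψ.tderiv_ofReal j x).symm
      have e3 : conj (dsym j k) = -dsym j k := by simp [dsym, map_ofNat]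
      rw [e2, map_mul, e3, coeff_eq_fc]
      ring
    simp only [e1]
    rw [← Finset.mul_sum, hdiv, mul_zero]
  simp only [e] at h2
  have h3 := h2.unique hasSum_zero
  have e4 : ∀ x, ∑ j, (v x j : ℂ) * tderiv j (fun x => (ψ x : ℂ)) x =
      ((∑ j, pderiv j ψ x * v x j : ℝ) : ℂ) := by
    intro x
    rw [Complex.ofReal_sum]
    exact Finset.sum_congr rfl fun j _ => by rw [hψ.tderiv_ofReal]; push_cast; ring
  simp only [e4]
  have e5 : ∫ x, ∑ j, pderiv j ψ x * v x j ∂torusVol =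
      ∑ j, ∫ x, pderiv j ψ x * v x j ∂torusVol :=
    integral_finsetSum _ fun j _ => (hp j).integrable_mul (hi j)
  rw [integral_complex_ofReal, e5, ← h3, Complex.ofReal_sum]

/-- The mean of the pressure is merely integrable in time, so it has to be paired with the bound on
u that is uniform in time rather than with the L³ bound. -/
lemma integrable_fst_mul {T : ℝ} {a : ℝ → ℂ} (ha : IntegrableOn a (Ioo 0 T)) {F : ℝ × T3 → ℂ}
    (hF : AEStronglyMeasurable F (spaceTime T)) {M : ℝ≥0}
    (hM : ∀ᵐ t ∂(volume : Measure ℝ).restrict (Ioo 0 T),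
      eLpNorm (fun x => F (t, x)) 1 torusVol ≤ M) :
    Integrable (fun p => a p.1 * F p) (spaceTime T) := by
  have hm : AEStronglyMeasurable (fun p : ℝ × T3 => a p.1 * F p) (spaceTime T) :=
    (ha.aestronglyMeasurable.comp_fst).mul hF
  refine ⟨hm, ?_⟩
  rw [HasFiniteIntegral, lintegral_prod _ hm.enorm]
  have ha' : ∫⁻ t in Ioo 0 T, ‖a t‖ₑ * M < ⊤ := by
    rw [lintegral_mul_const' _ _ ENNReal.coe_ne_top]
    exact ENNReal.mul_lt_top ha.2 ENNReal.coe_lt_top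
  refine lt_of_le_of_lt (lintegral_mono_ae ?_) ha'
  filter_upwards [hM] with t ht
  rw [eLpNorm_one_eq_lintegral_enorm] at ht
  simp only [enorm_mul]
  rw [lintegral_const_mul' _ _ enorm_ne_top]
  gcongr

lemma spaceTime_eq_restrict (T : ℝ) :
    spaceTime T = ((volume : Measure ℝ).prod torusVol).restrict (Ioo 0 T ×ˢ univ) := by
  rw [spaceTime, ← Measure.prod_restrict, Measure.restrict_univ]

lemma isDefectTerm_zero {T : ℝ} {u : ℝ → T3 → E3} (h : DefectVanishesL1 T u) :
    IsDefectTerm T u fun _ => 0 := by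
  intro φ hφ ψ hψ
  obtain ⟨-, h0⟩ := h φ hφ
  obtain ⟨C, hC⟩ := hψ.1.exists_bound 0 T
  have hb : ∀ ε, ‖∫ p, mollDefect φ ε (u p.1) p.2 * ψ p.1 p.2 ∂spaceTime T‖ₑ ≤
      C * eLpNorm (fun p : ℝ × T3 => mollDefect φ ε (u p.1) p.2) 1 (spaceTime T) := by
    intro ε
    refine (enorm_integral_le_lintegral_enorm _).trans ?_
    rw [eLpNorm_one_eq_lintegral_enorm, ← lintegral_const_mul' _ _ ENNReal.coe_ne_top]
    refine lintegral_mono_ae ?_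
    filter_upwards [ae_fst_mem T] with p hp
    rw [enorm_mul, mul_comm]
    gcongr
    rw [← ofReal_norm]
    exact ENNReal.ofReal_le_of_le_toReal (by simpa using hC p.1 (Ioo_subset_Icc_self hp) p.2)
  have h1 : Tendsto (fun ε => ∫ p, mollDefect φ ε (u p.1) p.2 * ψ p.1 p.2 ∂spaceTime T)
      (𝓝[>] 0) (𝓝 0) := by
    rw [tendsto_zero_iff_enorm_tendsto_zero]
    have h2 := ENNReal.Tendsto.const_mul h0 (Or.inr (ENNReal.coe_ne_top (r := C)))
    rw [mul_zero] at h2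
    exact tendsto_of_tendsto_of_tendsto_of_le_of_le tendsto_const_nhds h2 (fun _ => bot_le) hb
  simpa only [mul_zero] using h1.const_mul (1 / 2)

section

variable {ν s T β : ℝ} {u₀ : T3 → E3} {u : ℝ → T3 → E3} {P : ℝ → T3 → ℝ} {C : ℝ≥0}

/-- The mean value of the pressure does not contribute to the flux. -/
lemma IsLerayHopf.mean_pressure_flux (hu : IsLerayHopf ν s T u₀ u P)
    (hu2 : ∀ i, MemLp (comp u i) 2 (spaceTime T)) {T' : ℝ} (hT' : T' < T)
    {ψ : ℝ → T3 → ℝ} (hψ : SmoothST ψ) :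
    Integrable (fun p : ℝ × T3 => fct (pres P) 0 p.1 *
      ∑ j, comp u j p * tderiv j (fun x => (ψ p.1 x : ℂ)) p.2) (spaceTime T') ∧
    ∫ p, fct (pres P) 0 p.1 *
      ∑ j, comp u j p * tderiv j (fun x => (ψ p.1 x : ℂ)) p.2 ∂spaceTime T' = 0 := by
  have hsub : Ioo 0 T' ⊆ Ioo 0 T := Ioo_subset_Ioo_right hT'.le
  have hint : Integrable (fun p : ℝ × T3 => fct (pres P) 0 p.1 *
      ∑ j, comp u j p * tderiv j (fun x => (ψ p.1 x : ℂ)) p.2) (spaceTime T') := by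
    obtain ⟨M, hM⟩ := hu.bounded
    simp only [Finset.mul_sum]
    refine integrable_finsetSum _ fun j _ => ?_
    have h1 : Integrable (fun p : ℝ × T3 => fct (pres P) 0 p.1 * comp u j p) (spaceTime T') := by
      refine integrable_fst_mul (M := M) (integrableOn_fct (hu.integrable_pres hT') 0)
        ((hu2 j).aestronglyMeasurable.mono_measure (spaceTime_mono hT'.le)) ?_
      filter_upwards [ae_restrict_of_ae_restrict_of_subset hsub hM,
        ae_restrict_of_ae_restrict_of_subset hsub hu.ae_memLp] with t h1 h2
      refine le_trans ?_ h1
      refine le_trans (eLpNorm_le_eLpNorm_of_exponent_le one_le_two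
        (memLp_coord h2 j).ofReal.aestronglyMeasurable) ?_
      refine eLpNorm_mono fun x => ?_
      simpa [comp] using PiLp.norm_apply_le (u t x) j
    have h2 := memLp_one_iff_integrable.2 h1
    have h3 := ((hψ.ofReal).tderiv j).memLp_top T'
    refine (memLp_one_iff_integrable.1 (h3.mul (r := 1) h2)).congr (ae_of_all _ fun p => ?_)
    simp only [Pi.mul_apply]; ring
  refine ⟨hint, ?_⟩
  rw [integral_prod _ hint]
  refine integral_eq_zero_of_ae ?_
  filter_upwards [ae_restrict_of_ae_restrict_of_subset hsub (hu.ae_sum_dsym_mul_fct hu2),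
    ae_restrict_of_ae_restrict_of_subset hsub hu.ae_memLp] with t h1 h2
  simp only [integral_const_mul]
  have := integral_sum_mul_tderiv_eq_zero h2 h1 (hψ.tsmooth t)
  simp only [comp, this, mul_zero, Pi.zero_apply]

/-- Both sides of the truncated balance converge on (0, T'), where T' < T lies beyond the support of
ψ. The mean of the pressure is then restored, and everything is extended by zero to (0, T). -/
lemma IsLerayHopf.energyBalance (hu : IsLerayHopf ν s T u₀ u P) (hs : 0 ≤ s) (hT : 0 < T)
    (hu3 : ∀ i, MemLp (comp u i) 3 (spaceTime T)) (hβ : 1 / 3 < β)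
    (hC : ∀ i, HasModulus (spaceTime T) stShift 3 β C (comp u i)) {ψ : ℝ → T3 → ℝ}
    (hψ : TestOpen T ψ) : EnergyBalance ν s T u P ψ := by
  have hu2 : ∀ i, MemLp (comp u i) 2 (spaceTime T) := fun i =>
    (hu3 i).mono_exponent (by norm_num)
  obtain ⟨hψs, a, b, ha, hb, hψ0⟩ := hψ
  -- The maximum with 0 guarantees T' > 0 whatever the sign of b; T' < T is needed for the pressure
  -- to be integrable.
  obtain ⟨T', hbT', hT'⟩ := exists_between (max_lt hb hT)
  rw [max_lt_iff] at hbT'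
  obtain ⟨hbT', hT'0⟩ := hbT'
  have hsub : Ioo 0 T' ⊆ Ioo 0 T := Ioo_subset_Ioo_right hT'.le
  have hz : ∀ t, T' ≤ t → ∀ x, ψ t x = 0 := fun t ht => hψ0 t (Or.inr (hbT'.le.trans ht))
  set Ψ : ℝ → T3 → ℂ := fun t x => (ψ t x : ℂ) with hΨ
  obtain ⟨hsob, hvt, hvlim⟩ := hu.visc_limit hs hT' hψs hψs.ofReal
  have hfl := hu.tendstoLp_truncFlux hs hT' hu3 hβ hC hψs.ofReal
  have hbal : ∫ p, limFlux u P Ψ p ∂spaceTime T' =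
      2 * (ν : ℂ) * ((∫ t in Ioo 0 T', ∫ x, viscIntegrand s u ψ t x ∂torusVol : ℝ) : ℂ) := by
    -- The truncated balance says that the flux and viscous sequences coincide, hence so do their
    -- limits.
    refine tendsto_nhds_unique hfl.tendsto_integral (hvlim.congr fun n => ?_)
    refine hu.truncated_balance hs hT'0 hT' hu2 hψs.ofReal (fun x => ?_) (fun x => ?_) _
      (memLp_one_iff_integrable.1 (hfl.mem n))
    · simp [hψ0 0 (Or.inl ha.le)]
    · simp [hz T' le_rfl]
  obtain ⟨hmi, hm0⟩ := hu.mean_pressure_flux hu2 hT' hψs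
  have hli := memLp_one_iff_integrable.1 hfl.lim_mem
  have hfi' : Integrable (fun p : ℝ × T3 => fluxIntegrand u P ψ p.1 p.2) (spaceTime T') := by
    have h := (hli.add (hmi.const_mul 2)).re
    refine h.congr (ae_of_all _ fun p => ?_)
    simp only [Pi.add_apply]
    rw [← fluxIntegrand_eq u P hψs p]
    exact Complex.ofReal_re _
  have hfint : ((∫ p, fluxIntegrand u P ψ p.1 p.2 ∂spaceTime T' : ℝ) : ℂ) =
      2 * (ν : ℂ) * ((∫ t in Ioo 0 T', ∫ x, viscIntegrand s u ψ t x ∂torusVol : ℝ) : ℂ) := by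
    rw [← integral_complex_ofReal, ← hbal]
    simp only [fluxIntegrand_eq u P hψs]
    rw [integral_add hli (hmi.const_mul 2), integral_const_mul, hm0, mul_zero, add_zero]
  have hfz : ∀ t, T' ≤ t → ∀ x, fluxIntegrand u P ψ t x = 0 := by
    intro t ht x
    have e1 : deriv (fun τ => ψ τ x) t = 0 := by
      have : (fun τ => ψ τ x) =ᶠ[𝓝 t] fun _ => 0 := by
        filter_upwards [lt_mem_nhds (hbT'.trans_le ht)] with τ hτ using hψ0 τ (Or.inr hτ.le) x
      rw [this.deriv_eq, deriv_const]
    have e2 : grad (ψ t) x = 0 := by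
      have : ψ t = fun _ => 0 := funext (hz t ht)
      ext j
      simp [grad, pderiv, this]
    rw [fluxIntegrand, e1, e2]
    simp
  -- The flux vanishes for t ≥ T', so integrability up to T does not require integrability of the
  -- pressure there.
  have hfi : Integrable (fun p : ℝ × T3 => fluxIntegrand u P ψ p.1 p.2) (spaceTime T) := by
    rw [spaceTime_eq_restrict] at hfi' ⊢
    refine IntegrableOn.of_forall_sdiff_eq_zero hfi' (measurableSet_Ioo.prod .univ) ?_
    rintro ⟨t, x⟩ ⟨⟨h1, -⟩, h2⟩
    refine hfz t ?_ x
    by_contra h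
    exact h2 ⟨⟨h1.1, not_le.1 h⟩, mem_univ _⟩
  have hvz : ∀ t ∈ Ioo 0 T \ Ioo 0 T', ∫ x, viscIntegrand s u ψ t x ∂torusVol = 0 := by
    rintro t ⟨h1, h2⟩
    refine integral_viscIntegrand_of_eq_zero s u (hz t ?_)
    by_contra h
    exact h2 ⟨h1.1, not_le.1 h⟩
  have hvT : IntegrableOn (fun t => ∫ x, viscIntegrand s u ψ t x ∂torusVol) (Ioo 0 T) :=
    hvt.of_forall_sdiff_eq_zero measurableSet_Ioo hvz
  refine ⟨hfi, ?_, ae_of_all _ fun t => integrable_viscIntegrand s u ψ t, hvT, ?_⟩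
  · rw [ae_restrict_iff' measurableSet_Ioo] at hsob ⊢
    filter_upwards [hsob] with t h ht i
    rcases lt_or_ge t T' with h1 | h1
    · exact h ⟨ht.1, h1⟩ i
    · have : fracCoeff (s / 2) (fun y => (ψ t y • u t y) i) = 0 := by
        ext k
        simp [fracCoeff, coeff, hz t h1]
      rw [this]
      exact zero_memℓp
  · have e1 : ∀ᵐ t ∂(volume : Measure ℝ).restrict (Ioo 0 T),
        ∫ x, (fluxIntegrand u P ψ t x - 2 * ν * viscIntegrand s u ψ t x) ∂torusVol =
        ∫ x, fluxIntegrand u P ψ t x ∂torusVol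
          - 2 * ν * ∫ x, viscIntegrand s u ψ t x ∂torusVol := by
      filter_upwards [hfi.prod_right_ae] with t ht
      rw [integral_sub ht ((integrable_viscIntegrand s u ψ t).const_mul _), integral_const_mul]
    have e2 : ∫ t in Ioo 0 T, ∫ x, fluxIntegrand u P ψ t x ∂torusVol =
        ∫ t in Ioo 0 T', ∫ x, fluxIntegrand u P ψ t x ∂torusVol := by
      refine setIntegral_eq_of_subset_of_forall_sdiff_eq_zero measurableSet_Ioo hsub ?_
      rintro t ⟨h1, h2⟩
      have h3 : T' ≤ t := by
        by_contra h
        exact h2 ⟨h1.1, not_le.1 h⟩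
      simp [hfz t h3]
    have e3 : ∫ t in Ioo 0 T, ∫ x, viscIntegrand s u ψ t x ∂torusVol =
        ∫ t in Ioo 0 T', ∫ x, viscIntegrand s u ψ t x ∂torusVol :=
      setIntegral_eq_of_subset_of_forall_sdiff_eq_zero measurableSet_Ioo hsub hvz
    rw [integral_congr_ae e1, integral_sub hfi.integral_prod_left (hvT.const_mul _),
      integral_const_mul, e2, e3, ← integral_prod _ hfi', sub_eq_zero]
    exact_mod_cast hfint

end

end FracNS

end

theorem proposition3p3 (ν s T α : ℝ) (hν : 0 < ν) (hs : 0 ≤ s) (hT : 0 < T) (hα : 1 / 3 < α)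
    (ρ : FracNS.E3 → ℝ) (hρ : FracNS.IsDyadicPartition ρ)
    (u₀ : FracNS.T3 → FracNS.E3) (u : ℝ → FracNS.T3 → FracNS.E3) (P : ℝ → FracNS.T3 → ℝ)
    (hu : FracNS.IsLerayHopf ν s T u₀ u P) (hB : FracNS.MemL3Besov ρ α T u) :
    FracNS.DefectVanishesL1 T u ∧
      FracNS.IsDefectTerm T u (fun _ => 0) ∧
      ∀ ψ, FracNS.TestOpen T ψ → FracNS.EnergyBalance ν s T u P ψ := by
  obtain ⟨β, C, hβ, -, h⟩ := FracNS.MemL3Besov.exists_modulus hρ hα hB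
  have hD := FracNS.defectVanishesL1_of_hasModulus hβ hB.meas fun i => (h i).2
  exact ⟨hD, FracNS.isDefectTerm_zero hD, fun ψ hψ =>
    hu.energyBalance hs hT (fun i => (h i).1) hβ (fun i => (h i).2) hψ⟩
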